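/- **Theorem 1.** Let $(M,d_M)$ be a compact metric space, $A:M\times M\to\mathbb R$ continuous and $I\subset\mathbb R$ compact. Let $\mathcal B=\mathcal B(A,I)$ be the set of sequences $x=(x_n)_{n\ge1}\in M^{\mathbb N}$ with $A(x_n,x_{n+1})\in I$ for all $n\ge 1$, with the metric $d(x,y)=\sum_{n\ge1}2^{-n}d_M(x_n,y_n)$ and the shift $\sigma$. For $b\in M$ put $s(b)=\{a\in M: A(a,b)\in I\}$. Assume that $\mathcal B\ne\emptyset$ and that the map $b\mapsto s(b)$ is locally constant. Assume that $\mathcal B$ is topologically transitive (for all non-empty open $U,V\subset\mathcal B$ there is $n\ge1$ with $\sigma^{-n}(U)\cap V\neq\emptyset$) and has a spectral decomposition: $\mathcal B=\mathcal B_1\cup\dots\cup\mathcal B_k$ with pairwise disjoint closed sets $\mathcal B_i$ such that $\sigma(\mathcal B_i)=\mathcal B_{\mathbf p(i)}$ for a permutation $\mathbf p$ of $\{1,\dots,k\}$, where each $\mathcal B_i$ is topologically mixing for $\sigma^{m_i}$, $m_i$ being the least positive integer with $\mathbf p^{m_i}(i)=i$. Let $\nu$ be a Borel probability measure on $M$ with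 full support which also has full support on the sections: for every $x\in\mathcal B$, every non-empty relatively open subset of $s(x_1)$ has positive $\nu$-measure. For $\varphi:\mathcal B\to\mathbb R$ the generalized Ruelle operator is $\mathcal L_\varphi\psi(x)=\int_{s(x_1)}e^{\varphi(ax)}\psi(ax)\,d\nu(a)$, where $ax$ is the concatenation, and $\mathcal L_\varphi^*\mu$ is the measure with $\int\psi\,d\mathcal L^*_\varphi\mu=\int\mathcal L_\varphi\psi\,d\mu$ for all continuous $\psi$. Let $0<\alpha\le1$ and let $\mathcal H_\alpha$ be the Banach space of complex valued $\alpha$-Hölder functions on $\mathcal B$ with the norm $\|\psi\|_\alpha=\|\psi\|_\infty+\mathrm{Hol}_\psi$, where $\mathrm{Hol}_\psi$ is the least $\alpha$-Hölder constant of $\psi$. Then for every real valued $\alpha$-Hölder function $\varphi$ on $\mathcal B$ there are $\lambda_\varphi>0$, a strictly positive $\alpha$-Hölder function $f_\varphi$ and Borel probability measures $\rho_\varphi$, $\mu_\varphi$ on $\mathcal B$ such that: 1. $\mathcal L_\varphi f_\varphi=\lambda_\varphi f_\varphi$. The eigenvalue $\lambda_\varphi$ is simple (every continuous complex valued eigenfunction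 for $\lambda_\varphi$ is a multiple of $f_\varphi$, and $\lambda_\varphi$ has algebraic multiplicity one for $\mathcal L_\varphi$ on $\mathcal H_\alpha$) and maximal (every complex eigenvalue $z$ of $\mathcal L_\varphi$ with a continuous eigenfunction has $|z|\le\lambda_\varphi$). 2. $\mathcal L_\varphi^*\rho_\varphi=\lambda_\varphi\rho_\varphi$. 3. For $\overline\varphi=\varphi+\log f_\varphi-\log(f_\varphi\circ\sigma)-\log\lambda_\varphi$, the measure $\mu_\varphi$ is the unique Borel probability measure with $\mathcal L^*_{\overline\varphi}\mu_\varphi=\mu_\varphi$. Moreover $d\mu_\varphi=f_\varphi\,d\rho_\varphi$, and $\mu_\varphi$ is $\sigma$-invariant. 4. If, in addition, $\mathcal B$ is topologically mixing (for all non-empty open $U,V\subset\mathcal B$ there is $n$ with $\sigma^{-m}(U)\cap V\ne\emptyset$ for all $m\ge n$), then $\mathcal L^n_{\overline\varphi}\psi\to\int\psi\,d\mu_\varphi$ uniformly on $\mathcal B$ for every real valued $\alpha$-Hölder function $\psi$. Moreover there is $0\le r<\lambda_\varphi$ such that every point of the spectrum of $\mathcal L_\varphi$ on $\mathcal H_\alpha$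 other than $\lambda_\varphi$ lies in the disc $\{z\in\mathbb C:|z|\le r\}$. -/

import Mathlib

set_option linter.unusedSectionVars false

open MeasureTheory Filter Topology
open scoped NNReal ENNReal

namespace RPF

/-- The set of admissible sequences: all `x ∈ M^ℕ` with `A (x_n, x_{n+1}) ∈ I` for every `n`.
Coordinates are indexed from `0`, so the first letter of `x` is `x 0`. -/
def Subshift {M : Type*} (A : M × M → ℝ) (I : Set ℝ) : Type _ :=
  {x : ℕ → M // ∀ n, A (x n, x (n + 1)) ∈ I}

/-- The section `s(b) = {a ∈ M : A(a, b) ∈ I}`. -/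
def sec {M : Type*} (A : M × M → ℝ) (I : Set ℝ) (b : M) : Set M := {a | A (a, b) ∈ I}

namespace Subshift

section Basic

variable {M : Type*} {A : M × M → ℝ} {I : Set ℝ}

instance : CoeFun (Subshift A I) (fun _ => ℕ → M) := ⟨fun x => x.1⟩

/-- The concatenation `ax` of a letter `a ∈ s(x_1)` and an admissible sequence `x`. -/
def cons (x : Subshift A I) (a : M) (h : a ∈ sec A I (x 0)) : Subshift A I :=
  ⟨fun n => Nat.casesOn n a (fun k => x k), by
    intro n
    cases n with
    | zero => exact h
    | succ k => exact x.2 k⟩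

/-- The shift map `σ` on the set of admissible sequences. -/
def shift (x : Subshift A I) : Subshift A I := ⟨fun n => x (n + 1), fun n => x.2 (n + 1)⟩

@[simp] lemma cons_zero (x : Subshift A I) (a : M) (h : a ∈ sec A I (x 0)) :
    x.cons a h 0 = a := rfl

@[simp] lemma cons_succ (x : Subshift A I) (a : M) (h : a ∈ sec A I (x 0)) (n : ℕ) :
    x.cons a h (n + 1) = x n := rfl

end Basic

section Metric

variable {M : Type*} [MetricSpace M] [CompactSpace M] {A : M × M → ℝ} {I : Set ℝ}

lemma dist_le_diam (a b : M) : dist a b ≤ Metric.diam (Set.univ : Set M) :=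
  Metric.dist_le_diam_of_mem (isCompact_univ).isBounded (Set.mem_univ a) (Set.mem_univ b)

lemma summable_half : Summable (fun n : ℕ => (1 / 2 : ℝ) ^ (n + 1)) :=
  (summable_nat_add_iff 1).2 summable_geometric_two

lemma tsum_half : ∑' n : ℕ, (1 / 2 : ℝ) ^ (n + 1) = 1 := by
  simp_rw [pow_succ]
  rw [tsum_mul_right, tsum_geometric_two]
  norm_num

lemma summable_dist (x y : ℕ → M) :
    Summable (fun n : ℕ => (1 / 2 : ℝ) ^ (n + 1) * dist (x n) (y n)) := by
  refine Summable.of_nonneg_of_le (fun n => by positivity) (fun n => ?_)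
    (summable_half.mul_right (Metric.diam (Set.univ : Set M)))
  exact mul_le_mul_of_nonneg_left (dist_le_diam _ _) (by positivity)

/-- The metric `d(x, y) = ∑_{n ≥ 1} 2^{-n} d_M(x_n, y_n)`. -/
noncomputable instance : MetricSpace (Subshift A I) where
  dist x y := ∑' n : ℕ, (1 / 2 : ℝ) ^ (n + 1) * dist (x n) (y n)
  dist_self x := by simp
  dist_comm x y := by simp_rw [dist_comm]
  dist_triangle x y z := by
    rw [← (summable_dist x.1 y.1).tsum_add (summable_dist y.1 z.1)]
    refine (summable_dist x.1 z.1).tsum_le_tsum (fun n => ?_)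
      ((summable_dist x.1 y.1).add (summable_dist y.1 z.1))
    rw [← mul_add]
    exact mul_le_mul_of_nonneg_left (dist_triangle _ _ _) (by positivity)
  eq_of_dist_eq_zero := by
    intro x y h
    have h0 := (hasSum_zero_iff_of_nonneg (fun n => by positivity)).1
      (h ▸ (summable_dist x.1 y.1).hasSum)
    refine Subtype.ext (funext fun n => ?_)
    have := congrFun h0 n
    simpa using this

lemma dist_def (x y : Subshift A I) :
    dist x y = ∑' n : ℕ, (1 / 2 : ℝ) ^ (n + 1) * dist (x n) (y n) := rfl

noncomputable instance : MeasurableSpace (Subshift A I) := borel _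

instance : BorelSpace (Subshift A I) := ⟨rfl⟩

lemma dist_head_le (x y : Subshift A I) : dist (x 0) (y 0) ≤ 2 * dist x y := by
  have := (summable_dist x.1 y.1).le_tsum 0 (fun n _ => by positivity)
  rw [dist_def]
  simp only [zero_add, pow_one] at this
  linarith

lemma dist_le (x y : Subshift A I) : dist x y ≤ Metric.diam (Set.univ : Set M) := by
  rw [dist_def, ← one_mul (Metric.diam (Set.univ : Set M))]
  conv_rhs => rw [← tsum_half, ← tsum_mul_right]
  refine (summable_dist x.1 y.1).tsum_le_tsum (fun n => ?_) (summable_half.mul_right _)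
  exact mul_le_mul_of_nonneg_left (dist_le_diam _ _) (by positivity)

lemma dist_cons (x y : Subshift A I) (a b : M) (h : a ∈ sec A I (x 0))
    (h' : b ∈ sec A I (y 0)) :
    dist (x.cons a h) (y.cons b h') = (1 / 2) * dist a b + (1 / 2) * dist x y := by
  rw [dist_def, (summable_dist _ _).tsum_eq_zero_add, dist_def, ← tsum_mul_left]
  simp only [cons_zero, cons_succ, zero_add, pow_one]
  congr 1
  refine tsum_congr fun n => ?_
  rw [pow_succ]
  ring

lemma continuous_cons (x : Subshift A I) :
    Continuous (fun a : sec A I (x 0) => x.cons a.1 a.2) := by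
  refine LipschitzWith.continuous (K := 1) (LipschitzWith.of_dist_le_mul fun a b => ?_)
  rw [dist_cons, dist_self, Subtype.dist_eq]
  have := dist_nonneg (x := (a : M)) (y := (b : M))
  simp
  linarith

end Metric

end Subshift

open Subshift

section Dynamics

variable {M : Type*} [MetricSpace M] [CompactSpace M]

/-- Topological transitivity of the subshift: for all non-empty open sets `U`, `V` there is
`n ≥ 1` with `σ^{-n}(U) ∩ V ≠ ∅`. -/
def IsTransitive (A : M × M → ℝ) (I : Set ℝ) : Prop :=
  ∀ U V : Set (Subshift A I), IsOpen U → IsOpen V → U.Nonempty → V.Nonempty →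
    ∃ n : ℕ, 1 ≤ n ∧ ((shift^[n]) ⁻¹' U ∩ V).Nonempty

/-- The set `C` is topologically mixing for `σ^k` (with its relative topology). -/
def IsMixingOn {A : M × M → ℝ} {I : Set ℝ} (k : ℕ) (C : Set (Subshift A I)) : Prop :=
  ∀ U V : Set (Subshift A I), IsOpen U → IsOpen V → (U ∩ C).Nonempty → (V ∩ C).Nonempty →
    ∃ n : ℕ, ∀ m, n ≤ m → ((shift^[k * m]) ⁻¹' (U ∩ C) ∩ (V ∩ C)).Nonempty

/-- Topological mixing of the subshift. -/
def IsMixing (A : M × M → ℝ) (I : Set ℝ) : Prop :=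
  IsMixingOn (A := A) (I := I) 1 Set.univ

/-- The subshift is a finite disjoint union of closed sets which are permuted by `σ`, each of them
topologically mixing for the first power of `σ` that maps it to itself under the permutation. -/
def HasSpectralDecomposition (A : M × M → ℝ) (I : Set ℝ) : Prop :=
  ∃ (k : ℕ) (p : Equiv.Perm (Fin k)) (C : Fin k → Set (Subshift A I)),
    (⋃ i, C i) = Set.univ ∧
    Pairwise (fun i j => Disjoint (C i) (C j)) ∧
    (∀ i, IsClosed (C i)) ∧
    (∀ i, shift '' C i = C (p i)) ∧
    ∀ i, IsMixingOn (Function.minimalPeriod p i) (C i)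

end Dynamics

section Ruelle

variable {M : Type*} [MeasurableSpace M] {A : M × M → ℝ} {I : Set ℝ}

/-- The generalized Ruelle operator
`(L_φ ψ)(x) = ∫_{s(x_1)} e^{φ(ax)} ψ(ax) dν(a)`, for real or complex valued `ψ`. -/
noncomputable def ruelle {E : Type*} [NormedAddCommGroup E] [NormedSpace ℝ E]
    (ν : Measure M) (φ : Subshift A I → ℝ) (ψ : Subshift A I → E) (x : Subshift A I) : E :=
  ∫ a : sec A I (x 0), Real.exp (φ (x.cons a.1 a.2)) • ψ (x.cons a.1 a.2)
    ∂(ν.comap (Subtype.val : sec A I (x 0) → M))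

/-- The normalized potential `φ + log f - log (f ∘ σ) - log lam`. -/
noncomputable def normalized (φ f : Subshift A I → ℝ) (lam : ℝ) (x : Subshift A I) : ℝ :=
  φ x + Real.log (f x) - Real.log (f x.shift) - Real.log lam

end Ruelle

section Dual

variable {M : Type*} [MetricSpace M] [CompactSpace M] [MeasurableSpace M]
  {A : M × M → ℝ} {I : Set ℝ}

/-- `μ'` is the image `L_φ^* μ` of `μ` under the dual Ruelle operator: it is the measure that
satisfies `μ'(ψ) = μ(L_φ ψ)` for all continuous `ψ`. -/
def IsDualImage (ν : Measure M) (φ : Subshift A I → ℝ) (μ μ' : Measure (Subshift A I)) : Prop :=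
  ∀ ψ : C(Subshift A I, ℝ), ∫ x, ψ x ∂μ' = ∫ x, ruelle ν φ ψ x ∂μ

end Dual

section HolderSpace

variable {M : Type*} [MetricSpace M] [CompactSpace M]

/-- The space `H_α` of complex valued `α`-Hölder functions on the subshift. -/
@[ext]
structure HolderSpace (A : M × M → ℝ) (I : Set ℝ) (α : ℝ≥0) where
  /-- the underlying function -/
  toFun : Subshift A I → ℂ
  mem : MemHolder α toFun

namespace HolderSpace

variable {A : M × M → ℝ} {I : Set ℝ} {α : ℝ≥0}

instance : CoeFun (HolderSpace A I α) (fun _ => Subshift A I → ℂ) := ⟨HolderSpace.toFun⟩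

lemma toFun_injective :
    Function.Injective (toFun : HolderSpace A I α → Subshift A I → ℂ) :=
  fun _ _ h => HolderSpace.ext h

instance : Zero (HolderSpace A I α) := ⟨⟨0, memHolder_zero⟩⟩
instance : Add (HolderSpace A I α) := ⟨fun f g => ⟨f.toFun + g.toFun, f.mem.add g.mem⟩⟩
noncomputable instance : SMul ℂ (HolderSpace A I α) := ⟨fun c f => ⟨c • f.toFun, f.mem.smul⟩⟩
instance : SMul ℕ (HolderSpace A I α) := ⟨fun c f => ⟨c • f.toFun, f.mem.nsmul c⟩⟩
instance : Neg (HolderSpace A I α) :=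
  ⟨fun f => ⟨-f.toFun, by simpa using MemHolder.smul (c := (-1 : ℂ)) f.mem⟩⟩
instance : Sub (HolderSpace A I α) :=
  ⟨fun f g => ⟨f.toFun - g.toFun, by rw [sub_eq_add_neg]; exact f.mem.add (-g).mem⟩⟩
instance : SMul ℤ (HolderSpace A I α) :=
  ⟨fun c f => ⟨c • f.toFun, by
    simpa [Int.cast_smul_eq_zsmul] using MemHolder.smul (c := (c : ℂ)) f.mem⟩⟩

@[simp] lemma toFun_zero : (0 : HolderSpace A I α).toFun = 0 := rfl
@[simp] lemma toFun_add (f g : HolderSpace A I α) : (f + g).toFun = f.toFun + g.toFun := rfl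
@[simp] lemma toFun_neg (f : HolderSpace A I α) : (-f).toFun = -f.toFun := rfl
@[simp] lemma toFun_sub (f g : HolderSpace A I α) : (f - g).toFun = f.toFun - g.toFun := rfl
@[simp] lemma toFun_smul (c : ℂ) (f : HolderSpace A I α) : (c • f).toFun = c • f.toFun := rfl

instance : AddCommGroup (HolderSpace A I α) :=
  toFun_injective.addCommGroup _ rfl (fun _ _ => rfl) (fun _ => rfl) (fun _ _ => rfl)
    (fun _ _ => rfl) (fun _ _ => rfl)

noncomputable instance : Module ℂ (HolderSpace A I α) :=
  Function.Injective.module ℂ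
    ({ toFun := toFun, map_zero' := rfl, map_add' := fun _ _ => rfl } :
      HolderSpace A I α →+ (Subshift A I → ℂ)) toFun_injective (fun _ _ => rfl)

lemma dist_apply_le {E : Type*} [NormedAddCommGroup E] {f : Subshift A I → E} {C : ℝ≥0}
    (hf : HolderWith C α f) (x y : Subshift A I) :
    ‖f x - f y‖ ≤ C * dist x y ^ (α : ℝ) := by
  rw [← dist_eq_norm]
  exact hf.dist_le x y

lemma memHolder_of_le {E : Type*} [NormedAddCommGroup E] {f : Subshift A I → E} {C : ℝ≥0}
    (h : ∀ x y, ‖f x - f y‖ ≤ C * dist x y ^ (α : ℝ)) : HolderWith C α f := by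
  intro x y
  rw [edist_nndist, edist_nndist, ← ENNReal.coe_rpow_of_nonneg _ (NNReal.coe_nonneg α), ← ENNReal.coe_mul,
    ENNReal.coe_le_coe, ← NNReal.coe_le_coe]
  have := h x y
  rw [← dist_eq_norm] at this
  exact_mod_cast this

lemma bddAbove {E : Type*} [NormedAddCommGroup E] {f : Subshift A I → E}
    (hf : MemHolder α f) : BddAbove (Set.range fun x => ‖f x‖) := by
  rcases isEmpty_or_nonempty (Subshift A I) with h | ⟨⟨z⟩⟩
  · simp
  · obtain ⟨C, hC⟩ := hf
    refine ⟨C * Metric.diam (Set.univ : Set M) ^ (α : ℝ) + ‖f z‖, ?_⟩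
    rintro _ ⟨x, rfl⟩
    have h1 := dist_apply_le hC x z
    have h2 : dist x z ^ (α : ℝ) ≤ Metric.diam (Set.univ : Set M) ^ (α : ℝ) :=
      Real.rpow_le_rpow dist_nonneg (dist_le x z) α.2
    have h3 : ‖f x‖ ≤ ‖f x - f z‖ + ‖f z‖ := by
      simpa using norm_add_le (f x - f z) (f z)
    have h4 := mul_le_mul_of_nonneg_left h2 C.2
    simp only [NNReal.val_eq_coe] at h4
    show ‖f x‖ ≤ _
    linarith

/-- The norm `‖f‖_α = ‖f‖_∞ + Hol_f`. -/
noncomputable instance : Norm (HolderSpace A I α) :=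
  ⟨fun f => (⨆ x, ‖f x‖) + nnHolderNorm α f.toFun⟩

lemma norm_def (f : HolderSpace A I α) : ‖f‖ = (⨆ x, ‖f x‖) + nnHolderNorm α f.toFun := rfl

lemma norm_apply_le (f : HolderSpace A I α) (x : Subshift A I) : ‖f x‖ ≤ ⨆ x, ‖f x‖ :=
  le_ciSup (bddAbove f.mem) x

lemma sup_nonneg (f : HolderSpace A I α) : 0 ≤ ⨆ x, ‖f x‖ :=
  Real.iSup_nonneg fun _ => norm_nonneg _

lemma core : NormedSpace.Core ℂ (HolderSpace A I α) where
  norm_nonneg f := by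
    rw [norm_def]
    have := sup_nonneg f
    positivity
  norm_smul c f := by
    rw [norm_def, norm_def, mul_add, Real.mul_iSup_of_nonneg (norm_nonneg c)]
    have h1 : nnHolderNorm α (c • f).toFun = ‖c‖₊ * nnHolderNorm α f.toFun :=
      MemHolder.nnHolderNorm_smul f.mem c
    rw [h1]
    congr 1
    refine iSup_congr fun x => ?_
    exact norm_smul c (f x)
  norm_triangle f g := by
    rw [norm_def, norm_def, norm_def]
    have h1 : nnHolderNorm α (f + g).toFun ≤ nnHolderNorm α f.toFun + nnHolderNorm α g.toFun :=
      MemHolder.nnHolderNorm_add_le f.mem g.mem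
    have h1' : (nnHolderNorm α (f + g).toFun : ℝ) ≤ nnHolderNorm α f.toFun + nnHolderNorm α g.toFun := by
      exact_mod_cast h1
    have h2 : (⨆ x, ‖(f + g) x‖) ≤ (⨆ x, ‖f x‖) + ⨆ x, ‖g x‖ := by
      refine Real.iSup_le (fun x => ?_) (add_nonneg (sup_nonneg f) (sup_nonneg g))
      exact (norm_add_le (f x) (g x)).trans (add_le_add (norm_apply_le f x) (norm_apply_le g x))
    linarith
  norm_eq_zero_iff f := by
    constructor
    · intro h
      rw [norm_def] at h
      have h0 := sup_nonneg f
      have h1 : (0 : ℝ) ≤ nnHolderNorm α f.toFun := NNReal.coe_nonneg _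
      refine HolderSpace.ext (funext fun x => ?_)
      have h2 := norm_apply_le f x
      exact norm_le_zero_iff.1 (by linarith)
    · rintro rfl
      have h1 : nnHolderNorm α (0 : HolderSpace A I α).toFun = 0 := nnHolderNorm_zero _ α
      rw [norm_def, h1]
      simp

noncomputable instance : NormedAddCommGroup (HolderSpace A I α) :=
  NormedAddCommGroup.ofCore core

noncomputable instance : NormedSpace ℂ (HolderSpace A I α) :=
  NormedSpace.ofCore core

end HolderSpace

end HolderSpace

section RuelleHolder

variable {M : Type*} [MetricSpace M] [CompactSpace M] [MeasurableSpace M] [BorelSpace M]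
  {A : M × M → ℝ} {I : Set ℝ} {α : ℝ≥0}

lemma integrable_aux {E : Type*} [NormedAddCommGroup E] [NormedSpace ℝ E]
    (ν : Measure M) [IsFiniteMeasure ν]
    {φ : Subshift A I → ℝ} (hφ : Continuous φ) {ψ : Subshift A I → E} (hψ : Continuous ψ)
    {c : ℝ} (hc : ∀ x, Real.exp (φ x) * ‖ψ x‖ ≤ c) (x : Subshift A I) :
    Integrable (fun a : sec A I (x 0) =>
      Real.exp (φ (x.cons a.1 a.2)) • ψ (x.cons a.1 a.2))
      (ν.comap (Subtype.val : sec A I (x 0) → M)) := by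
  have hcont : Continuous (fun a : sec A I (x 0) =>
      Real.exp (φ (x.cons a.1 a.2)) • ψ (x.cons a.1 a.2)) :=
    ((Real.continuous_exp.comp hφ).comp x.continuous_cons).smul (hψ.comp x.continuous_cons)
  refine Integrable.of_bound hcont.aestronglyMeasurable c (ae_of_all _ fun a => ?_)
  rw [norm_smul, Real.norm_eq_abs, Real.abs_exp]
  exact hc _

lemma ruelle_eq {E : Type*} [NormedAddCommGroup E] [NormedSpace ℝ E]
    (ν : Measure M) (φ : Subshift A I → ℝ) (ψ : Subshift A I → E) (y : Subshift A I)
    (S : Set M) (h : S = sec A I (y 0)) :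
    ruelle ν φ ψ y = ∫ a : S, Real.exp (φ (y.cons a.1 (h ▸ a.2))) • ψ (y.cons a.1 (h ▸ a.2))
      ∂(ν.comap (Subtype.val : S → M)) := by
  subst h
  rfl

lemma comap_real_le (ν : Measure M) [IsFiniteMeasure ν] (S : Set M) :
    (ν.comap (Subtype.val : S → M)).real Set.univ ≤ ν.real Set.univ := by
  refine ENNReal.toReal_mono (measure_ne_top _ _) ?_
  exact (Measure.comap_apply_le _ _ nullMeasurableSet_univ).trans
    (measure_mono (Set.subset_univ _))

lemma exists_sec_eq (hs : IsLocallyConstant (sec A I)) :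
    ∃ δ > 0, ∀ x y : Subshift A I, dist x y < δ → sec A I (x 0) = sec A I (y 0) := by
  obtain ⟨δ, hδ, h⟩ := lebesgue_number_lemma_of_metric (isCompact_univ (X := M))
    (c := fun S : Set M => {b | sec A I b = S}) (fun S => hs.isOpen_fiber S)
    (fun b _ => Set.mem_iUnion.2 ⟨sec A I b, rfl⟩)
  refine ⟨δ / 2, half_pos hδ, fun x y hxy => ?_⟩
  obtain ⟨S, hS⟩ := h (x 0) (Set.mem_univ _)
  have h1 : sec A I (x 0) = S := hS (Metric.mem_ball_self hδ)
  have h2 : sec A I (y 0) = S := hS (by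
    rw [Metric.mem_ball, dist_comm]
    have := dist_head_le x y
    linarith)
  rw [h1, h2]

/-- The Ruelle operator of a Hölder potential acts boundedly on Hölder functions. -/
lemma ruelle_bounds (hs : IsLocallyConstant (sec A I)) (ν : Measure M) [IsFiniteMeasure ν]
    (hα : 0 < α) {φ : Subshift A I → ℝ} (hφ : MemHolder α φ) :
    ∃ K : ℝ≥0, ∀ ψ : HolderSpace A I α,
      (∀ x, ‖ruelle ν φ ψ.toFun x‖ ≤ K * ‖ψ‖) ∧
      ∀ x y, ‖ruelle ν φ ψ.toFun x - ruelle ν φ ψ.toFun y‖ ≤ (K * ‖ψ‖) * dist x y ^ (α : ℝ) := by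
  obtain ⟨δ, hδ, hsec⟩ := exists_sec_eq hs
  obtain ⟨H, hH⟩ := hφ
  obtain ⟨P, hP⟩ := HolderSpace.bddAbove (A := A) (I := I) ⟨H, hH⟩
  have hP' : ∀ x, |φ x| ≤ P := fun x => hP ⟨x, rfl⟩
  set m : ℝ := ν.real Set.univ
  have hm : 0 ≤ m := measureReal_nonneg
  set Q : ℝ := Real.exp P
  have hQ : 0 < Q := Real.exp_pos P
  have hexp : ∀ x, Real.exp (φ x) ≤ Q := fun x =>
    Real.exp_le_exp.2 ((le_abs_self _).trans (hP' x))
  have hexpd : ∀ x y, |Real.exp (φ x) - Real.exp (φ y)| ≤ Q * H * dist x y ^ (α : ℝ) := by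
    have key : ∀ x y, Real.exp (φ x) - Real.exp (φ y) ≤ Q * H * dist x y ^ (α : ℝ) := by
      intro x y
      have h1 : φ x - φ y ≤ H * dist x y ^ (α : ℝ) :=
        (le_abs_self _).trans (HolderSpace.dist_apply_le hH x y)
      have h2 : 1 - (φ x - φ y) ≤ Real.exp (-(φ x - φ y)) := by
        have := Real.add_one_le_exp (-(φ x - φ y))
        linarith
      have h3 : Real.exp (φ y) = Real.exp (φ x) * Real.exp (-(φ x - φ y)) := by
        rw [← Real.exp_add]
        congr 1
        ring
      have h4 : 0 ≤ (H : ℝ) * dist x y ^ (α : ℝ) := by positivity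
      calc Real.exp (φ x) - Real.exp (φ y)
          ≤ Real.exp (φ x) * (φ x - φ y) := by
            rw [h3]
            nlinarith [Real.exp_pos (φ x)]
        _ ≤ Real.exp (φ x) * (H * dist x y ^ (α : ℝ)) :=
            mul_le_mul_of_nonneg_left h1 (Real.exp_pos _).le
        _ ≤ Q * (H * dist x y ^ (α : ℝ)) := mul_le_mul_of_nonneg_right (hexp x) h4
        _ = _ := by ring
    intro x y
    rw [abs_le]
    have := key y x
    rw [dist_comm] at this
    exact ⟨by linarith, key x y⟩
  have hφc : Continuous φ := hH.continuous hα
  have hδα : 0 < δ ^ (α : ℝ) := Real.rpow_pos_of_pos hδ _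
  have hKnn : 0 ≤ Q * m + (Q + Q * H) * m + 2 * Q * m / δ ^ (α : ℝ) := by positivity
  refine ⟨⟨_, hKnn⟩, fun ψ => ?_⟩
  have hψc : Continuous ψ.toFun := ψ.mem.holderWith.continuous hα
  set N : ℝ := ‖ψ‖
  have hN : 0 ≤ N := norm_nonneg ψ
  have hsupN : ∀ x, ‖ψ x‖ ≤ N := fun x => by
    refine (HolderSpace.norm_apply_le ψ x).trans ?_
    exact le_add_of_nonneg_right (NNReal.coe_nonneg _)
  have hholN : ∀ x y, ‖ψ x - ψ y‖ ≤ N * dist x y ^ (α : ℝ) := fun x y => by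
    refine (HolderSpace.dist_apply_le ψ.mem.holderWith x y).trans ?_
    refine mul_le_mul_of_nonneg_right ?_ (by positivity)
    exact le_add_of_nonneg_left (HolderSpace.sup_nonneg ψ)
  have hb : ∀ x, Real.exp (φ x) * ‖ψ x‖ ≤ Q * N := fun x =>
    mul_le_mul (hexp x) (hsupN x) (norm_nonneg _) hQ.le
  have hsup : ∀ x, ‖ruelle ν φ ψ.toFun x‖ ≤ Q * N * m := by
    intro x
    refine (norm_integral_le_of_norm_le_const (C := Q * N) (ae_of_all _ fun a => ?_)).trans ?_
    · rw [norm_smul, Real.norm_eq_abs, Real.abs_exp]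
      exact hb _
    · exact mul_le_mul_of_nonneg_left (comap_real_le ν _) (by positivity)
  have e1 : 0 ≤ Q * m * N := by positivity
  have e2 : 0 ≤ (Q + Q * H) * m * N := by positivity
  have e3 : 0 ≤ 2 * Q * m / δ ^ (α : ℝ) * N := by positivity
  show (∀ x, ‖ruelle ν φ ψ.toFun x‖ ≤ (Q * m + (Q + Q * H) * m + 2 * Q * m / δ ^ (α : ℝ)) * N) ∧
    ∀ x y, ‖ruelle ν φ ψ.toFun x - ruelle ν φ ψ.toFun y‖ ≤
      (Q * m + (Q + Q * H) * m + 2 * Q * m / δ ^ (α : ℝ)) * N * dist x y ^ (α : ℝ)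
  refine ⟨fun x => ?_, fun x y => ?_⟩
  · refine (hsup x).trans ?_
    linarith
  · rcases lt_or_ge (dist x y) δ with hd | hd
    · have hxy := hsec x y hd
      have hpt : ∀ a : sec A I (x 0),
          ‖Real.exp (φ (x.cons a.1 a.2)) • ψ.toFun (x.cons a.1 a.2)
            - Real.exp (φ (y.cons a.1 (hxy ▸ a.2))) • ψ.toFun (y.cons a.1 (hxy ▸ a.2))‖
          ≤ (Q + Q * H) * N * dist x y ^ (α : ℝ) := by
        intro a
        set u := x.cons a.1 a.2
        set v := y.cons a.1 (hxy ▸ a.2)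
        have huv : dist u v ^ (α : ℝ) ≤ dist x y ^ (α : ℝ) := by
          refine Real.rpow_le_rpow dist_nonneg ?_ α.2
          rw [dist_cons, dist_self]
          have := dist_nonneg (x := x) (y := y)
          linarith
        have hsplit : Real.exp (φ u) • ψ.toFun u - Real.exp (φ v) • ψ.toFun v
            = Real.exp (φ u) • (ψ.toFun u - ψ.toFun v)
              + (Real.exp (φ u) - Real.exp (φ v)) • ψ.toFun v := by
          rw [smul_sub, sub_smul]
          abel
        rw [hsplit]
        refine (norm_add_le _ _).trans ?_
        rw [norm_smul, norm_smul, Real.norm_eq_abs, Real.norm_eq_abs, Real.abs_exp]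
        have t1 : Real.exp (φ u) * ‖ψ.toFun u - ψ.toFun v‖ ≤ Q * (N * dist x y ^ (α : ℝ)) :=
          mul_le_mul (hexp u) ((hholN u v).trans (mul_le_mul_of_nonneg_left huv hN))
            (norm_nonneg _) hQ.le
        have t2 : |Real.exp (φ u) - Real.exp (φ v)| * ‖ψ.toFun v‖
            ≤ (Q * H * dist x y ^ (α : ℝ)) * N :=
          mul_le_mul ((hexpd u v).trans (mul_le_mul_of_nonneg_left huv (by positivity)))
            (hsupN v) (norm_nonneg _) (by positivity)
        calc _ ≤ _ := add_le_add t1 t2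
          _ = _ := by ring
      have i1 := integrable_aux ν hφc hψc hb x
      have i2 : Integrable (fun a : sec A I (x 0) =>
          Real.exp (φ (y.cons a.1 (hxy ▸ a.2))) • ψ.toFun (y.cons a.1 (hxy ▸ a.2)))
          (ν.comap (Subtype.val : sec A I (x 0) → M)) := by
        have i3 := integrable_aux ν hφc hψc hb y
        revert i3
        have gen : ∀ (S : Set M) (h : S = sec A I (y 0)),
            Integrable (fun a : sec A I (y 0) =>
              Real.exp (φ (y.cons a.1 a.2)) • ψ.toFun (y.cons a.1 a.2))
              (ν.comap (Subtype.val : sec A I (y 0) → M)) →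
            Integrable (fun a : S =>
              Real.exp (φ (y.cons a.1 (h ▸ a.2))) • ψ.toFun (y.cons a.1 (h ▸ a.2)))
              (ν.comap (Subtype.val : S → M)) := by
          intro S h
          subst h
          exact id
        exact gen _ hxy
      rw [ruelle_eq ν φ ψ.toFun y (sec A I (x 0)) hxy, ruelle, ← integral_sub i1 i2]
      refine (norm_integral_le_of_norm_le_const (ae_of_all _ hpt)).trans ?_
      have hda : 0 ≤ dist x y ^ (α : ℝ) := by positivity
      calc _ ≤ (Q + Q * H) * N * dist x y ^ (α : ℝ) * m :=
            mul_le_mul_of_nonneg_left (comap_real_le ν _) (by positivity)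
        _ = (Q + Q * H) * m * N * dist x y ^ (α : ℝ) := by ring
        _ ≤ _ := mul_le_mul_of_nonneg_right (by linarith) hda
    · have hda : δ ^ (α : ℝ) ≤ dist x y ^ (α : ℝ) := Real.rpow_le_rpow hδ.le hd α.2
      have hda0 : 0 ≤ dist x y ^ (α : ℝ) := by positivity
      calc _ ≤ ‖ruelle ν φ ψ.toFun x‖ + ‖ruelle ν φ ψ.toFun y‖ := norm_sub_le _ _
        _ ≤ 2 * Q * m * N := by linarith [hsup x, hsup y]
        _ = 2 * Q * m / δ ^ (α : ℝ) * N * δ ^ (α : ℝ) := by field_simp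
        _ ≤ 2 * Q * m / δ ^ (α : ℝ) * N * dist x y ^ (α : ℝ) :=
            mul_le_mul_of_nonneg_left hda e3
        _ ≤ _ := mul_le_mul_of_nonneg_right (by linarith) hda0

lemma ruelle_memHolder (hs : IsLocallyConstant (sec A I)) (ν : Measure M) [IsFiniteMeasure ν]
    (hα : 0 < α) {φ : Subshift A I → ℝ} (hφ : MemHolder α φ) (ψ : HolderSpace A I α) :
    MemHolder α (ruelle ν φ ψ.toFun) := by
  obtain ⟨K, hK⟩ := ruelle_bounds hs ν hα hφ
  exact ⟨K * ‖ψ‖₊, HolderSpace.memHolder_of_le fun x y => by simpa using (hK ψ).2 x y⟩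

lemma integrable_ruelle (ν : Measure M) [IsFiniteMeasure ν]
    (hα : 0 < α) {φ : Subshift A I → ℝ} (hφ : MemHolder α φ) (ψ : HolderSpace A I α)
    (x : Subshift A I) :
    Integrable (fun a : sec A I (x 0) =>
      Real.exp (φ (x.cons a.1 a.2)) • ψ.toFun (x.cons a.1 a.2))
      (ν.comap (Subtype.val : sec A I (x 0) → M)) := by
  obtain ⟨P, hP⟩ := HolderSpace.bddAbove hφ
  refine integrable_aux ν (hφ.holderWith.continuous hα) (ψ.mem.holderWith.continuous hα)
    (c := Real.exp P * ⨆ x, ‖ψ x‖) (fun y => ?_) x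
  exact mul_le_mul (Real.exp_le_exp.2 ((le_abs_self _).trans (hP ⟨y, rfl⟩)))
    (HolderSpace.norm_apply_le ψ y) (norm_nonneg _) (Real.exp_pos _).le

/-- The Ruelle operator of a Hölder potential, as a linear map of the Hölder space. -/
noncomputable def ruelleLinear (hs : IsLocallyConstant (sec A I)) (ν : Measure M)
    [IsFiniteMeasure ν] (hα : 0 < α) {φ : Subshift A I → ℝ} (hφ : MemHolder α φ) :
    HolderSpace A I α →ₗ[ℂ] HolderSpace A I α where
  toFun ψ := ⟨ruelle ν φ ψ.toFun, ruelle_memHolder hs ν hα hφ ψ⟩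
  map_add' ψ ψ' := by
    refine HolderSpace.ext (funext fun x => ?_)
    show ruelle ν φ (ψ + ψ').toFun x = ruelle ν φ ψ.toFun x + ruelle ν φ ψ'.toFun x
    rw [ruelle, ruelle, ruelle,
      ← integral_add (integrable_ruelle ν hα hφ ψ x) (integrable_ruelle ν hα hφ ψ' x)]
    refine integral_congr_ae (ae_of_all _ fun a => ?_)
    exact smul_add _ _ _
  map_smul' c ψ := by
    refine HolderSpace.ext (funext fun x => ?_)
    show ruelle ν φ (c • ψ).toFun x = c • ruelle ν φ ψ.toFun x
    rw [ruelle, ruelle, ← integral_smul]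
    refine integral_congr_ae (ae_of_all _ fun a => ?_)
    exact smul_comm (Real.exp _) c (ψ.toFun _)

/-- The Ruelle operator of a Hölder potential, as a bounded operator of the Hölder space
`(H_α, ‖·‖_α)`. -/
noncomputable def ruelleHolder (hs : IsLocallyConstant (sec A I)) (ν : Measure M)
    [IsFiniteMeasure ν] (hα : 0 < α) {φ : Subshift A I → ℝ} (hφ : MemHolder α φ) :
    HolderSpace A I α →L[ℂ] HolderSpace A I α :=
  (ruelleLinear hs ν hα hφ).mkContinuousOfExistsBound (by
    obtain ⟨K, hK⟩ := ruelle_bounds hs ν hα hφ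
    refine ⟨K + K, fun ψ => ?_⟩
    rw [HolderSpace.norm_def, add_mul]
    refine add_le_add (Real.iSup_le (hK ψ).1 (by positivity)) ?_
    have : nnHolderNorm α (ruelleLinear hs ν hα hφ ψ).toFun ≤ K * ‖ψ‖₊ :=
      (HolderSpace.memHolder_of_le fun x y => by
        rw [NNReal.coe_mul, coe_nnnorm]; exact (hK ψ).2 x y).nnholderNorm_le
    exact_mod_cast this)

lemma ruelleHolder_apply (hs : IsLocallyConstant (sec A I)) (ν : Measure M)
    [IsFiniteMeasure ν] (hα : 0 < α) {φ : Subshift A I → ℝ} (hφ : MemHolder α φ)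
    (ψ : HolderSpace A I α) (x : Subshift A I) :
    ruelleHolder hs ν hα hφ ψ x = ruelle ν φ ψ.toFun x := rfl

end RuelleHolder

end RPF

/-!
The Ruelle operator `L_φ` is a positive operator on the continuous functions of a compact space, and
everything rests on three facts. First, since the sections `s(b)` are locally constant, the inverse
branches `x ↦ ax` of the shift are defined on balls of a fixed radius, where they halve distances.
With transitivity this makes every backward orbit dense, and since `ν` has full support on the
sections, `L_φ` is irreducible: finitely many iterates of a non-zero `ψ ≥ 0` add up to a strictly
positive function (`RPF.exists_sum_transfer_pow_pos`). Second, as the inverse branches contract, the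
cone of functions with `f(x) ≤ e^{C d(x, y)^α} f(y)` at small distances is invariant, and it has a
compact unit sphere. Third, for a potential with `L_φ 1 = 1` the oscillation of `L_φ^n ψ` satisfies
a Lasota–Yorke inequality (`RPF.exists_oscillation_bound_pow`), so that the iterates of a continuous
function are equicontinuous.

The eigenvalue `λ` is the largest `t` for which some non-zero `f` in the cone satisfies
`t f ≤ L_φ f`. It is attained by compactness, and irreducibility improves `t` unless `L_φ f = λ f`;
no fixed point theorem is needed (`RPF.exists_eigenfunction`). Passing to the normalized potential,
one obtains an operator `T` with `T 1 = 1`. Its continuous fixed functions are constant by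
irreducibility, so the Cesàro averages of every continuous function converge along an ultrafilter to
a constant. This constant is the integral with respect to the stationary measure `μ`, which therefore
exists and is unique, and `ρ = f⁻¹ μ` is the eigenmeasure of `L_φ^*`. Integrating `TG = G + c`
against `μ` gives `c = 0`, which rules out generalized eigenfunctions.

In the mixing case preimages become dense uniformly in the base point, and the iterates `T^n ψ`
themselves converge to `∫ ψ dμ` (`RPF.tendsto_transfer_pow`). The unit ball of the Hölder space is
compact in the sup norm, so this convergence is uniform on it, and the Lasota–Yorke inequality
upgrades it to the Hölder norm: some `T^n` is at distance at most `1 / 2` from the projection to the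
constants. This is the spectral gap (`RPF.exists_spectrum_subset`), which multiplication by `f`
carries over to `L_φ`.
-/

namespace RPF

open Subshift

/-! ### Topology of the subshift and density of backward orbits -/

section Topology

variable {M : Type*} [MetricSpace M] [CompactSpace M] [MeasurableSpace M] [BorelSpace M]
  {A : M × M → ℝ} {I : Set ℝ}

/-- The topology of the metric `∑ 2^{-n} d_M(x_n, y_n)` is coarser than the product topology,
in which the subshift is a closed subset of a compact space. -/
theorem compactSpace_subshift (hA : Continuous A) (hI : IsClosed I) :
    CompactSpace (Subshift A I) := by
  let Z : Set (ℕ → M) := {x | ∀ n, A (x n, x (n + 1)) ∈ I}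
  have hZ : IsClosed Z := by
    have : Z = ⋂ n, (fun x : ℕ → M => A (x n, x (n + 1))) ⁻¹' I := by
      ext x
      simp [Z]
    rw [this]
    exact isClosed_iInter fun n => hI.preimage (by fun_prop)
  have : CompactSpace Z := isCompact_iff_compactSpace.1 hZ.isCompact
  let e : Z → Subshift A I := fun z => ⟨z.1, z.2⟩
  have hc : Continuous e := by
    rw [continuous_iff_continuousAt]
    intro y
    rw [ContinuousAt, tendsto_iff_dist_tendsto_zero]
    have h : Continuous fun z : Z => dist (e z) (e y) := by
      refine continuous_tsum (u := fun n : ℕ => (1 / 2 : ℝ) ^ (n + 1) *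
        Metric.diam (Set.univ : Set M)) (fun n => ?_) (summable_half.mul_right _) fun n z => ?_
      · have h1 : Continuous fun z : Z => z.1 n := (continuous_apply n).comp continuous_subtype_val
        exact continuous_const.mul (h1.dist continuous_const)
      · rw [Real.norm_of_nonneg (by positivity)]
        exact mul_le_mul_of_nonneg_left (dist_le_diam _ _) (by positivity)
    have := h.tendsto y
    rwa [dist_self] at this
  have hsurj : Function.Surjective e := fun x => ⟨⟨x.1, x.2⟩, rfl⟩
  exact hsurj.compactSpace hc

theorem isClosed_sec (hA : Continuous A) (hI : IsClosed I) (b : M) : IsClosed (sec A I b) :=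
  hI.preimage (by fun_prop)

theorem shift_cons (x : Subshift A I) (a : M) (h : a ∈ sec A I (x 0)) :
    (x.cons a h).shift = x := rfl

theorem cons_shift (x : Subshift A I) : x.shift.cons (x 0) (x.2 0) = x := by
  refine Subtype.ext (funext fun n => ?_)
  cases n <;> rfl

theorem dist_shift_le (x y : Subshift A I) : dist x.shift y.shift ≤ 2 * dist x y := by
  have h := dist_cons x.shift y.shift (x 0) (y 0) (x.2 0) (y.2 0)
  rw [cons_shift, cons_shift] at h
  have := dist_nonneg (x := x 0) (y := y 0)
  linarith

theorem continuous_shift : Continuous (shift : Subshift A I → Subshift A I) :=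
  LipschitzWith.continuous (K := 2) (LipschitzWith.of_dist_le_mul fun x y => by
    simpa using dist_shift_le x y)

open Classical in
/-- The concatenation `ax` as a total function of the letter `a`, with the junk value `x` for the
letters `a ∉ s(x_1)`. -/
noncomputable def prepend (x : Subshift A I) (a : M) : Subshift A I :=
  if h : a ∈ sec A I (x 0) then x.cons a h else x

theorem prepend_eq_cons (x : Subshift A I) {a : M} (h : a ∈ sec A I (x 0)) :
    prepend x a = x.cons a h := dif_pos h

theorem shift_prepend {x : Subshift A I} {a : M} (h : a ∈ sec A I (x 0)) :
    (prepend x a).shift = x := by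
  rw [prepend_eq_cons x h, shift_cons]

theorem prepend_shift (x : Subshift A I) : prepend x.shift (x 0) = x := by
  rw [prepend_eq_cons x.shift (x.2 0), cons_shift]

theorem dist_prepend {x y : Subshift A I} {a : M} (h : a ∈ sec A I (x 0))
    (h' : a ∈ sec A I (y 0)) : dist (prepend x a) (prepend y a) = dist x y / 2 := by
  rw [prepend_eq_cons x h, prepend_eq_cons y h', dist_cons, dist_self]
  ring

theorem continuousOn_prepend (x : Subshift A I) : ContinuousOn (prepend x) (sec A I (x 0)) := by
  rw [continuousOn_iff_continuous_domRestrict]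
  refine x.continuous_cons.congr fun a => ?_
  exact (prepend_eq_cons x a.2).symm

/-- Inverse branches of `σ^n` are defined on balls of a fixed radius `δ`, where they contract by
`2^{-n}`. -/
theorem exists_inverse_branch {δ : ℝ}
    (hδ : ∀ x y : Subshift A I, dist x y < δ → sec A I (x 0) = sec A I (y 0)) (n : ℕ) :
    ∀ w x : Subshift A I, dist x (shift^[n] w) < δ →
      ∃ y, shift^[n] y = x ∧ dist y w ≤ (1 / 2) ^ n * dist x (shift^[n] w) := by
  induction n with
  | zero => exact fun w x _ => ⟨x, rfl, by simp⟩
  | succ n ih =>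
    intro w x hx
    rw [Function.iterate_succ_apply] at hx ⊢
    obtain ⟨y, hy, hyw⟩ := ih w.shift x hx
    have hle : (1 / 2 : ℝ) ^ n * dist x (shift^[n] w.shift) ≤ dist x (shift^[n] w.shift) :=
      mul_le_of_le_one_left dist_nonneg (pow_le_one₀ (by norm_num) (by norm_num))
    have hsec := hδ y w.shift (by linarith)
    have hmem : w 0 ∈ sec A I (y 0) := hsec ▸ w.2 0
    refine ⟨prepend y (w 0), ?_, ?_⟩
    · rw [Function.iterate_succ_apply, shift_prepend hmem, hy]
    · have h1 : dist (prepend y (w 0)) w = dist y w.shift / 2 := by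
        calc dist (prepend y (w 0)) w
            = dist (prepend y (w 0)) (prepend w.shift (w 0)) := by rw [prepend_shift]
          _ = _ := dist_prepend hmem (w.2 0)
      rw [h1, pow_succ]
      linarith

/-- The image of a non-empty open set under a suitable iterate of the shift contains a ball whose
radius does not depend on the set. -/
theorem exists_ball_subset_image {δ : ℝ}
    (hδ : ∀ x y : Subshift A I, dist x y < δ → sec A I (x 0) = sec A I (y 0))
    {U : Set (Subshift A I)} (hU : IsOpen U) (hne : U.Nonempty) :
    ∃ (N : ℕ) (v : Subshift A I), Metric.ball v δ ⊆ shift^[N] '' U := by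
  obtain ⟨u, hu⟩ := hne
  obtain ⟨ε, hε, hball⟩ := Metric.isOpen_iff.1 hU u hu
  rcases le_or_gt δ 0 with h0 | h0
  · exact ⟨0, u, by rw [Metric.ball_eq_empty.2 h0]; exact Set.empty_subset _⟩
  obtain ⟨N, hN⟩ := exists_pow_lt_of_lt_one (div_pos hε h0) (by norm_num : (1 / 2 : ℝ) < 1)
  refine ⟨N, shift^[N] u, fun x hx => ?_⟩
  obtain ⟨y, hy, hyu⟩ := exists_inverse_branch hδ N u x hx
  refine ⟨y, hball (Metric.mem_ball.2 ?_), hy⟩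
  rw [lt_div_iff₀ h0] at hN
  have : (1 / 2 : ℝ) ^ N * dist x (shift^[N] u) ≤ (1 / 2) ^ N * δ :=
    mul_le_mul_of_nonneg_left (le_of_lt hx) (by positivity)
  linarith

/-- If `σ^n` maps a point of the ball of radius `δ / 2` around `v` close to `x`, then the inverse
branch through this point yields an `n`-th preimage of `x` in the ball of radius `δ`. -/
theorem exists_preimage_mem_ball {δ : ℝ}
    (hδ : ∀ x y : Subshift A I, dist x y < δ → sec A I (x 0) = sec A I (y 0)) {n : ℕ}
    {v w x : Subshift A I} (hw : dist w v < δ / 2) (hx : dist x (shift^[n] w) < δ / 2) :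
    ∃ y ∈ Metric.ball v δ, shift^[n] y = x := by
  have := dist_nonneg (x := w) (y := v)
  obtain ⟨y, hy, hyw⟩ := exists_inverse_branch hδ n w x (by linarith)
  have hle : (1 / 2 : ℝ) ^ n * dist x (shift^[n] w) ≤ dist x (shift^[n] w) :=
    mul_le_of_le_one_left dist_nonneg (pow_le_one₀ (by norm_num) (by norm_num))
  refine ⟨y, Metric.mem_ball.2 ?_, hy⟩
  linarith [dist_triangle y w v]

/-- For a transitive subshift with locally constant sections, every backward orbit is dense. -/
theorem IsTransitive.exists_preimage_mem (hs : IsLocallyConstant (sec A I))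
    (ht : IsTransitive A I) {U : Set (Subshift A I)} (hU : IsOpen U) (hne : U.Nonempty)
    (x : Subshift A I) : ∃ (n : ℕ), ∃ y ∈ U, shift^[n] y = x := by
  obtain ⟨δ, hδ, hsec⟩ := exists_sec_eq hs
  obtain ⟨N, v, hv⟩ := exists_ball_subset_image hsec hU hne
  obtain ⟨n, -, w, hw1, hw2⟩ := ht (Metric.ball x (δ / 2)) (Metric.ball v (δ / 2))
    Metric.isOpen_ball Metric.isOpen_ball ⟨x, Metric.mem_ball_self (half_pos hδ)⟩
    ⟨v, Metric.mem_ball_self (half_pos hδ)⟩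
  rw [Set.mem_preimage, Metric.mem_ball, dist_comm] at hw1
  obtain ⟨y', hy', hyx⟩ := exists_preimage_mem_ball hsec (Metric.mem_ball.1 hw2) hw1
  obtain ⟨y, hyU, rfl⟩ := hv hy'
  exact ⟨n + N, y, hyU, by rw [Function.iterate_add_apply, hyx]⟩

/-- For a mixing subshift with locally constant sections, a non-empty open set contains an `n`-th
preimage of every point, with the same `n` for all points. -/
theorem IsMixing.exists_preimage_mem [CompactSpace (Subshift A I)]
    (hs : IsLocallyConstant (sec A I)) (hm : IsMixing A I) {U : Set (Subshift A I)}
    (hU : IsOpen U) (hne : U.Nonempty) :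
    ∃ n : ℕ, ∀ x : Subshift A I, ∃ y ∈ U, shift^[n] y = x := by
  obtain ⟨δ, hδ, hsec⟩ := exists_sec_eq hs
  obtain ⟨N, v, hv⟩ := exists_ball_subset_image hsec hU hne
  have hδ4 : 0 < δ / 4 := by positivity
  have key : ∀ z : Subshift A I, ∃ n : ℕ, ∀ m, n ≤ m →
      ∃ w, dist w v < δ / 2 ∧ dist (shift^[m] w) z < δ / 4 := by
    intro z
    obtain ⟨n, hn⟩ := hm (Metric.ball z (δ / 4)) (Metric.ball v (δ / 2))
      Metric.isOpen_ball Metric.isOpen_ball ⟨z, Metric.mem_ball_self hδ4, trivial⟩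
      ⟨v, Metric.mem_ball_self (half_pos hδ), trivial⟩
    refine ⟨n, fun m h => ?_⟩
    obtain ⟨w, hw1, hw2⟩ := hn m h
    rw [one_mul] at hw1
    exact ⟨w, hw2.1, hw1.1⟩
  choose k hk using key
  obtain ⟨t, -, htf, ht⟩ := (isCompact_univ (X := Subshift A I)).finite_cover_balls hδ4
  obtain ⟨n, hn⟩ := (htf.image k).bddAbove
  refine ⟨n + N, fun x => ?_⟩
  obtain ⟨z, hz, hxz⟩ := Set.mem_iUnion₂.1 (ht (Set.mem_univ x))
  obtain ⟨w, hw, hwz⟩ := hk z n (hn ⟨z, hz, rfl⟩)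
  rw [Metric.mem_ball] at hxz
  obtain ⟨y', hy', hyx⟩ := exists_preimage_mem_ball (x := x) (n := n) hsec hw (by
    linarith [dist_triangle_right x (shift^[n] w) z])
  obtain ⟨y, hyU, rfl⟩ := hv hy'
  exact ⟨y, hyU, by rw [Function.iterate_add_apply, hyx]⟩

theorem IsTransitive.sec_nonempty [CompactSpace (Subshift A I)]
    (ht : IsTransitive A I) (x : Subshift A I) : (sec A I (x 0)).Nonempty := by
  have hdense : Dense (Set.range (shift : Subshift A I → Subshift A I)) := by
    rw [dense_iff_inter_open]
    intro U hU hne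
    obtain ⟨n, hn, w, hw, -⟩ := ht U U hU hU hne hne
    obtain ⟨m, rfl⟩ : ∃ m, n = m + 1 := ⟨n - 1, by omega⟩
    rw [Set.mem_preimage, Function.iterate_succ_apply'] at hw
    exact ⟨_, hw, _, rfl⟩
  have hclosed : IsClosed (Set.range (shift : Subshift A I → Subshift A I)) :=
    (isCompact_range continuous_shift).isClosed
  obtain ⟨y, rfl⟩ : x ∈ Set.range shift := by
    rw [← hclosed.closure_eq, hdense.closure_eq]
    trivial
  exact ⟨y 0, y.2 0⟩

end Topology

/-! ### The Ruelle operator on continuous functions -/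

section Transfer

variable {M : Type*} [MetricSpace M] [CompactSpace M] [MeasurableSpace M] [BorelSpace M]
  {A : M × M → ℝ} {I : Set ℝ}

/-- The measure `ν` has full support on the sections `s(x_1)`. -/
def HasFullSupportOnSections (A : M × M → ℝ) (I : Set ℝ) (ν : Measure M) : Prop :=
  ∀ (x : Subshift A I) (U : Set M), IsOpen U →
    (U ∩ sec A I (x 0)).Nonempty → 0 < ν (U ∩ sec A I (x 0))

theorem ruelle_eq_setIntegral {E : Type*} [NormedAddCommGroup E] [NormedSpace ℝ E]
    (hA : Continuous A) (hI : IsClosed I) (ν : Measure M) (φ : Subshift A I → ℝ)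
    (ψ : Subshift A I → E) (x : Subshift A I) :
    ruelle ν φ ψ x =
      ∫ a in sec A I (x 0), Real.exp (φ (prepend x a)) • ψ (prepend x a) ∂ν := by
  rw [← integral_subtype_comap (isClosed_sec hA hI _).measurableSet, ruelle]
  exact integral_congr_ae (ae_of_all _ fun a => by simp only [prepend_eq_cons x a.2])

theorem integrableOn_comp_prepend {E : Type*} [NormedAddCommGroup E]
    (hA : Continuous A) (hI : IsClosed I) (ν : Measure M) [IsFiniteMeasure ν]
    {G : Subshift A I → E} (hG : Continuous G) (x : Subshift A I) :
    IntegrableOn (fun a => G (prepend x a)) (sec A I (x 0)) ν :=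
  (hG.comp_continuousOn (continuousOn_prepend x)).integrableOn_compact
    (isClosed_sec hA hI _).isCompact

theorem ruelle_mono (hA : Continuous A) (hI : IsClosed I) (ν : Measure M) [IsFiniteMeasure ν]
    {φ ψ ψ' : Subshift A I → ℝ} (hφ : Continuous φ) (hψ : Continuous ψ) (hψ' : Continuous ψ')
    {x : Subshift A I} (h : ∀ u, u.shift = x → ψ u ≤ ψ' u) :
    ruelle ν φ ψ x ≤ ruelle ν φ ψ' x := by
  rw [ruelle_eq_setIntegral hA hI, ruelle_eq_setIntegral hA hI]
  refine setIntegral_mono_on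
    (integrableOn_comp_prepend hA hI ν (G := fun u => Real.exp (φ u) • ψ u) (by fun_prop) x)
    (integrableOn_comp_prepend hA hI ν (G := fun u => Real.exp (φ u) • ψ' u) (by fun_prop) x)
    (isClosed_sec hA hI _).measurableSet fun a ha => ?_
  exact mul_le_mul_of_nonneg_left (h _ (shift_prepend ha)) (Real.exp_pos _).le

theorem ruelle_const_mul (ν : Measure M) (φ ψ : Subshift A I → ℝ) (c : ℝ) (x : Subshift A I) :
    ruelle ν φ (fun u => c * ψ u) x = c * ruelle ν φ ψ x := by
  rw [ruelle, ruelle, ← integral_const_mul]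
  refine integral_congr_ae (ae_of_all _ fun a => ?_)
  simp only [smul_eq_mul]
  ring

/-- The Ruelle operator commutes with continuous linear maps of the values, such as the real and
the imaginary part. -/
theorem map_ruelle {E F : Type*} [NormedAddCommGroup E] [NormedSpace ℝ E] [CompleteSpace E]
    [NormedAddCommGroup F] [NormedSpace ℝ F] [CompleteSpace F]
    (hA : Continuous A) (hI : IsClosed I) (ν : Measure M) [IsFiniteMeasure ν]
    {φ : Subshift A I → ℝ} (hφ : Continuous φ) {ψ : Subshift A I → E} (hψ : Continuous ψ)
    (T : E →L[ℝ] F) (x : Subshift A I) :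
    T (ruelle ν φ ψ x) = ruelle ν φ (fun u => T (ψ u)) x := by
  rw [ruelle_eq_setIntegral hA hI, ruelle_eq_setIntegral hA hI, ← T.integral_comp_comm
    (integrableOn_comp_prepend hA hI ν (G := fun u => Real.exp (φ u) • ψ u) (by fun_prop) x)]
  simp only [map_smul]

/-- The oscillation of `L_φ ψ` between two points whose first letters have the same section is
controlled by the oscillation of `e^φ ψ` along the inverse branches of the shift. -/
theorem abs_ruelle_sub_le (hA : Continuous A) (hI : IsClosed I) (ν : Measure M)
    [IsFiniteMeasure ν] {φ ψ K : Subshift A I → ℝ} (hφ : Continuous φ) (hψ : Continuous ψ)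
    (hK : Continuous K) {x y : Subshift A I} (hxy : sec A I (x 0) = sec A I (y 0))
    (h : ∀ u v, u.shift = x → v.shift = y → dist u v = dist x y / 2 →
      |Real.exp (φ u) * ψ u - Real.exp (φ v) * ψ v| ≤ K u) :
    |ruelle ν φ ψ x - ruelle ν φ ψ y| ≤ ∫ a in sec A I (x 0), K (prepend x a) ∂ν := by
  rw [ruelle_eq_setIntegral hA hI, ruelle_eq_setIntegral hA hI, ← hxy]
  have hi := integrableOn_comp_prepend hA hI ν (G := fun u => Real.exp (φ u) • ψ u)
    (by fun_prop) y
  rw [← hxy] at hi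
  rw [← integral_sub (integrableOn_comp_prepend hA hI ν
    (G := fun u => Real.exp (φ u) • ψ u) (by fun_prop) x) hi, ← Real.norm_eq_abs]
  refine norm_integral_le_of_norm_le (integrableOn_comp_prepend hA hI ν hK x) ?_
  refine (ae_restrict_iff' (isClosed_sec hA hI _).measurableSet).2 (ae_of_all _ fun a ha => ?_)
  have ha' : a ∈ sec A I (y 0) := hxy ▸ ha
  exact h _ _ (shift_prepend ha) (shift_prepend ha') (dist_prepend ha ha')

theorem setIntegral_const_le (ν : Measure M) [IsProbabilityMeasure ν] (S : Set M) {c : ℝ}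
    (hc : 0 ≤ c) : ∫ _ in S, c ∂ν ≤ c := by
  rw [setIntegral_const, smul_eq_mul]
  exact mul_le_of_le_one_left hc measureReal_le_one

theorem continuous_ruelle [CompactSpace (Subshift A I)] (hA : Continuous A) (hI : IsClosed I)
    (hs : IsLocallyConstant (sec A I)) (ν : Measure M) [IsProbabilityMeasure ν]
    {φ ψ : Subshift A I → ℝ} (hφ : Continuous φ) (hψ : Continuous ψ) :
    Continuous (ruelle ν φ ψ) := by
  obtain ⟨δ, hδ, hsec⟩ := exists_sec_eq hs
  have huc : UniformContinuous fun u => Real.exp (φ u) * ψ u :=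
    CompactSpace.uniformContinuous_of_continuous (by fun_prop)
  refine Metric.continuous_iff.2 fun x ε hε => ?_
  obtain ⟨η, hη, hη'⟩ := Metric.uniformContinuous_iff.1 huc (ε / 2) (half_pos hε)
  refine ⟨min δ η, lt_min hδ hη, fun y hy => ?_⟩
  rw [Real.dist_eq]
  have hyx := lt_min_iff.1 hy
  refine (abs_ruelle_sub_le hA hI ν hφ hψ (K := fun _ => ε / 2) continuous_const
    (hsec y x hyx.1) fun u v _ _ huv => ?_).trans_lt ?_
  · rw [← Real.dist_eq]
    exact (hη' (by rw [huv]; linarith [dist_nonneg (x := y) (y := x)])).le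
  · exact (setIntegral_const_le ν _ (half_pos hε).le).trans_lt (half_lt_self hε)

/-- A non-negative continuous function that is positive at one preimage of `x` has positive image
at `x`, because `ν` has full support on the section of `x`. -/
theorem ruelle_pos (hA : Continuous A) (hI : IsClosed I) {ν : Measure M} [IsFiniteMeasure ν]
    (hν : HasFullSupportOnSections A I ν)
    {φ ψ : Subshift A I → ℝ} (hφ : Continuous φ) (hψ : Continuous ψ) (h0 : ∀ u, 0 ≤ ψ u)
    {u x : Subshift A I} (hux : u.shift = x) (hu : 0 < ψ u) : 0 < ruelle ν φ ψ x := by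
  subst hux
  rw [ruelle_eq_setIntegral hA hI]
  set S := sec A I (u.shift 0)
  have hS : MeasurableSet S := (isClosed_sec hA hI _).measurableSet
  have hcont : Continuous fun v => Real.exp (φ v) • ψ v := by fun_prop
  have hnn : ∀ v, 0 ≤ Real.exp (φ v) • ψ v := fun v => mul_nonneg (Real.exp_pos _).le (h0 v)
  rw [setIntegral_pos_iff_support_of_nonneg_ae (ae_of_all _ fun a => hnn _)
    (integrableOn_comp_prepend hA hI ν hcont _)]
  obtain ⟨U, hU, hUS⟩ := (continuousOn_iff'.1
    (hcont.comp_continuousOn (continuousOn_prepend u.shift))) (Set.Ioi 0) isOpen_Ioi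
  have hmem : u 0 ∈ U ∩ S := by
    rw [← hUS]
    refine ⟨?_, u.2 0⟩
    rw [Set.mem_preimage, Function.comp_apply, prepend_shift]
    exact mul_pos (Real.exp_pos _) hu
  refine (hν u.shift U hU ⟨_, hmem⟩).trans_le (measure_mono ?_)
  rw [← hUS]
  exact fun a ha => ⟨ne_of_gt ha.1, ha.2⟩

variable [CompactSpace (Subshift A I)]

/-- The Ruelle operator of a continuous potential, as a bounded operator of the space of real valued
continuous functions. -/
noncomputable def transfer (hA : Continuous A) (hI : IsClosed I)
    (hs : IsLocallyConstant (sec A I)) (ν : Measure M) [IsProbabilityMeasure ν]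
    (φ : C(Subshift A I, ℝ)) : C(Subshift A I, ℝ) →L[ℝ] C(Subshift A I, ℝ) :=
  LinearMap.mkContinuous
    { toFun := fun ψ => ⟨ruelle ν φ ψ, continuous_ruelle hA hI hs ν φ.continuous ψ.continuous⟩
      map_add' := fun ψ ψ' => by
        ext x
        have h : ∀ ψ : C(Subshift A I, ℝ), IntegrableOn (fun a => Real.exp (φ (prepend x a)) •
            ψ (prepend x a)) (sec A I (x 0)) ν := fun ψ => integrableOn_comp_prepend hA hI ν
          (G := fun u => Real.exp (φ u) • ψ u) (by fun_prop) x
        simp only [ContinuousMap.coe_mk, ContinuousMap.add_apply]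
        rw [ruelle_eq_setIntegral hA hI, ruelle_eq_setIntegral hA hI,
          ruelle_eq_setIntegral hA hI, ← integral_add (h ψ) (h ψ')]
        simp only [ContinuousMap.add_apply, smul_add]
      map_smul' := fun c ψ => by
        ext x
        exact ruelle_const_mul ν φ ψ c x }
    (Real.exp ‖φ‖) fun ψ => by
      refine (ContinuousMap.norm_le _ (by positivity)).2 fun x => ?_
      simp only [LinearMap.coe_mk, AddHom.coe_mk, ContinuousMap.coe_mk]
      rw [ruelle_eq_setIntegral hA hI]
      refine (norm_setIntegral_le_of_norm_le_const (C := Real.exp ‖φ‖ * ‖ψ‖)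
        (measure_lt_top _ _) fun a _ => ?_).trans ?_
      · rw [norm_smul, Real.norm_eq_abs, Real.abs_exp]
        exact mul_le_mul (Real.exp_le_exp.2 (φ.apply_le_norm _)) (ψ.norm_coe_le_norm _)
          (norm_nonneg _) (Real.exp_pos _).le
      · exact mul_le_of_le_one_right (by positivity) measureReal_le_one

variable (hA : Continuous A) (hI : IsClosed I) (hs : IsLocallyConstant (sec A I))
  (ν : Measure M) [IsProbabilityMeasure ν] (φ : C(Subshift A I, ℝ))

theorem transfer_apply (ψ : C(Subshift A I, ℝ)) (x : Subshift A I) :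
    transfer hA hI hs ν φ ψ x = ruelle ν φ ψ x := rfl

theorem coe_transfer_pow (ψ : C(Subshift A I, ℝ)) (n : ℕ) :
    ⇑((transfer hA hI hs ν φ ^ n) ψ) = (ruelle ν φ)^[n] ψ := by
  induction n with
  | zero => rfl
  | succ n ih =>
    rw [Function.iterate_succ_apply', ← ih, pow_succ']
    rfl

theorem transfer_mono {ψ ψ' : C(Subshift A I, ℝ)} (h : ψ ≤ ψ') :
    transfer hA hI hs ν φ ψ ≤ transfer hA hI hs ν φ ψ' := fun _ =>
  ruelle_mono hA hI ν φ.continuous ψ.continuous ψ'.continuous fun u _ => h u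

theorem transfer_pow_mono {ψ ψ' : C(Subshift A I, ℝ)} (h : ψ ≤ ψ') (n : ℕ) :
    (transfer hA hI hs ν φ ^ n) ψ ≤ (transfer hA hI hs ν φ ^ n) ψ' := by
  induction n with
  | zero => exact h
  | succ n ih =>
    rw [pow_succ']
    exact transfer_mono hA hI hs ν φ ih

theorem transfer_pow_nonneg {ψ : C(Subshift A I, ℝ)} (h : 0 ≤ ψ) (n : ℕ) :
    0 ≤ (transfer hA hI hs ν φ ^ n) ψ := by
  simpa using transfer_pow_mono hA hI hs ν φ h n

variable {ν} in
theorem transfer_pow_pos (hν : HasFullSupportOnSections A I ν)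
    {ψ : C(Subshift A I, ℝ)} (h0 : 0 ≤ ψ) {u : Subshift A I} (hu : 0 < ψ u) (n : ℕ) :
    ∀ x, shift^[n] u = x → 0 < (transfer hA hI hs ν φ ^ n) ψ x := by
  induction n with
  | zero =>
    rintro x rfl
    exact hu
  | succ n ih =>
    intro x hx
    rw [Function.iterate_succ_apply'] at hx
    rw [pow_succ']
    exact ruelle_pos hA hI hν φ.continuous (ContinuousMap.continuous _)
      (transfer_pow_nonneg hA hI hs ν φ h0 n) hx (ih _ rfl)

variable {ν} in
/-- Irreducibility: for a transitive subshift, finitely many iterates of a non-zero `ψ ≥ 0` add up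
to a strictly positive function. -/
theorem exists_sum_transfer_pow_pos (hν : HasFullSupportOnSections A I ν)
    (ht : IsTransitive A I) {ψ : C(Subshift A I, ℝ)} (h0 : 0 ≤ ψ) (hne : ψ ≠ 0) :
    ∃ n : ℕ, ∀ x, 0 < (∑ k ∈ Finset.range n, (transfer hA hI hs ν φ ^ k) ψ) x := by
  set T := transfer hA hI hs ν φ
  obtain ⟨u, hu⟩ : ∃ u, 0 < ψ u := by
    by_contra! h
    exact hne (ContinuousMap.ext fun u => le_antisymm (h u) (h0 u))
  have hcover : ∀ x, ∃ n, 0 < (T ^ n) ψ x := by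
    intro x
    obtain ⟨n, y, hy, hyx⟩ := ht.exists_preimage_mem hs
      (isOpen_lt continuous_const ψ.continuous) ⟨u, hu⟩ x
    exact ⟨n, transfer_pow_pos hA hI hs φ hν h0 hy n x hyx⟩
  obtain ⟨t, ht⟩ := (isCompact_univ (X := Subshift A I)).elim_finite_subcover
    (fun n => {x | 0 < (T ^ n) ψ x})
    (fun n => isOpen_lt continuous_const (ContinuousMap.continuous _))
    fun x _ => Set.mem_iUnion.2 (hcover x)
  obtain ⟨n, hn⟩ := t.exists_nat_subset_range
  refine ⟨n, fun x => ?_⟩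
  obtain ⟨k, hk, hkx⟩ := Set.mem_iUnion₂.1 (ht (Set.mem_univ x))
  rw [ContinuousMap.sum_apply]
  exact Finset.sum_pos' (fun j _ => transfer_pow_nonneg hA hI hs ν φ h0 j x) ⟨k, hn hk, hkx⟩

end Transfer

/-! ### Compactness and Hölder estimates -/

section Estimates

/-- A form of the Arzelà–Ascoli theorem for sets of real valued functions on a compact metric
space. -/
theorem isCompact_of_uniformEquicontinuous {X : Type*} [PseudoMetricSpace X] [CompactSpace X]
    {S : Set C(X, ℝ)} (hS : IsClosed S) (R : ℝ) (hR : ∀ f ∈ S, ‖f‖ ≤ R)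
    (h : ∀ ε > 0, ∃ δ > 0, ∀ f ∈ S, ∀ x y, dist x y < δ → |f x - f y| < ε) : IsCompact S := by
  let e := ContinuousMap.isometryEquivBoundedOfCompact X ℝ
  have hcompact : IsCompact (e '' S) := by
    refine BoundedContinuousFunction.arzela_ascoli₂ (Set.Icc (-R) R) isCompact_Icc _
      (e.toHomeomorph.isClosedMap S hS) ?_ ?_
    · rintro _ x ⟨f, hf, rfl⟩
      exact abs_le.1 ((f.norm_coe_le_norm x).trans (hR f hf))
    · intro x
      refine Metric.equicontinuousAt_iff.2 fun ε hε => ?_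
      obtain ⟨δ, hδ, hδ'⟩ := h ε hε
      refine ⟨δ, hδ, ?_⟩
      rintro y hy ⟨_, f, hf, rfl⟩
      rw [dist_comm] at hy
      exact hδ' f hf x y hy
  have := hcompact.image e.symm.continuous
  rwa [Set.image_image, Set.image_congr (fun f _ => e.symm_apply_apply f), Set.image_id'] at this

/-- A bounded function that is Hölder at distances below `δ` is Hölder. -/
theorem norm_sub_le_of_local {X E : Type*} [PseudoMetricSpace X] [NormedAddCommGroup E]
    {f : X → E} {α δ B R : ℝ} (hα : 0 ≤ α) (hδ : 0 < δ) (hB : 0 ≤ B)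
    (hR : ∀ x, ‖f x‖ ≤ R) (h : ∀ x y, dist x y < δ → ‖f x - f y‖ ≤ B * dist x y ^ α) (x y : X) :
    ‖f x - f y‖ ≤ (B + 2 * R / δ ^ α) * dist x y ^ α := by
  have hR0 : 0 ≤ R := (norm_nonneg _).trans (hR x)
  have hδα : 0 < δ ^ α := Real.rpow_pos_of_pos hδ _
  have hd : 0 ≤ dist x y ^ α := Real.rpow_nonneg dist_nonneg _
  rw [add_mul]
  rcases lt_or_ge (dist x y) δ with hxy | hxy
  · have : 0 ≤ 2 * R / δ ^ α * dist x y ^ α := by positivity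
    linarith [h x y hxy]
  · have h1 : 2 * R / δ ^ α * δ ^ α ≤ 2 * R / δ ^ α * dist x y ^ α :=
      mul_le_mul_of_nonneg_left (Real.rpow_le_rpow hδ.le hxy hα) (by positivity)
    rw [div_mul_cancel₀ _ hδα.ne'] at h1
    have : 0 ≤ B * dist x y ^ α := by positivity
    linarith [norm_sub_le (f x) (f y), hR x, hR y]

theorem tendsto_const_mul_rpow_zero {α : ℝ≥0} (hα : 0 < α) (B : ℝ) :
    Tendsto (fun t : ℝ => B * t ^ (α : ℝ)) (𝓝 0) (𝓝 0) := by
  have : ContinuousAt (fun t : ℝ => B * t ^ (α : ℝ)) 0 :=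
    continuousAt_const.mul (Real.continuousAt_rpow_const _ _ (Or.inr α.2))
  have h0 : B * (0 : ℝ) ^ (α : ℝ) = 0 := by
    rw [Real.zero_rpow (by exact_mod_cast hα.ne'), mul_zero]
  rwa [ContinuousAt, h0] at this

end Estimates

/-! ### The eigenfunction -/

section Eigenfunction

variable {M : Type*} [MetricSpace M] [CompactSpace M] [MeasurableSpace M] [BorelSpace M]
  {A : M × M → ℝ} {I : Set ℝ} [CompactSpace (Subshift A I)]

/-- The cone of non-negative functions `f` with `f(x) ≤ e^{C d(x, y)^α} f(y)` at distances
`d(x, y) < δ`. The Ruelle operator preserves it for suitable `C`, and its unit sphere is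
compact. -/
def logHolderCone (A : M × M → ℝ) (I : Set ℝ) (α : ℝ≥0) (δ C : ℝ) : Set C(Subshift A I, ℝ) :=
  {f | 0 ≤ f ∧ ∀ x y, dist x y < δ → f x ≤ Real.exp (C * dist x y ^ (α : ℝ)) * f y}

variable {α : ℝ≥0} {δ C : ℝ}

theorem isClosed_logHolderCone : IsClosed (logHolderCone A I α δ C) := by
  have : logHolderCone A I α δ C = (⋂ x, {f : C(Subshift A I, ℝ) | 0 ≤ f x}) ∩
      ⋂ x, ⋂ y, ⋂ (_ : dist x y < δ), {f : C(Subshift A I, ℝ) |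
        f x ≤ Real.exp (C * dist x y ^ (α : ℝ)) * f y} := by
    ext f
    simp only [logHolderCone, Set.mem_ofPred_eq, Set.mem_inter_iff, Set.mem_iInter]
    rfl
  rw [this]
  have hev := fun x : Subshift A I => continuous_eval_const (F := C(Subshift A I, ℝ)) x
  refine (isClosed_iInter fun x => isClosed_le continuous_const (hev x)).inter
    (isClosed_iInter fun x => isClosed_iInter fun y => isClosed_iInter fun _ => ?_)
  exact isClosed_le (hev x) (continuous_const.mul (hev y))

theorem sum_mem_logHolderCone {ι : Type*} (s : Finset ι) {f : ι → C(Subshift A I, ℝ)}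
    (hf : ∀ i ∈ s, f i ∈ logHolderCone A I α δ C) :
    ∑ i ∈ s, f i ∈ logHolderCone A I α δ C := by
  refine ⟨Finset.sum_nonneg fun i hi => (hf i hi).1, fun x y hxy => ?_⟩
  rw [ContinuousMap.sum_apply, ContinuousMap.sum_apply, Finset.mul_sum]
  exact Finset.sum_le_sum fun i hi => (hf i hi).2 x y hxy

theorem smul_mem_logHolderCone {f : C(Subshift A I, ℝ)} (hf : f ∈ logHolderCone A I α δ C)
    {c : ℝ} (hc : 0 ≤ c) : c • f ∈ logHolderCone A I α δ C := by
  refine ⟨smul_nonneg hc hf.1, fun x y hxy => ?_⟩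
  have := mul_le_mul_of_nonneg_left (hf.2 x y hxy) hc
  simp only [ContinuousMap.smul_apply, smul_eq_mul]
  linarith

/-- Functions in the cone are Hölder at small distances. -/
theorem abs_sub_le_of_mem_logHolderCone (hC : 0 ≤ C) {f : C(Subshift A I, ℝ)}
    (hf : f ∈ logHolderCone A I α δ C) (x y : Subshift A I) (hxy : dist x y < δ) :
    |f x - f y| ≤ C * Real.exp (C * δ ^ (α : ℝ)) * ‖f‖ * dist x y ^ (α : ℝ) := by
  have key : ∀ x y : Subshift A I, dist x y < δ →
      f x - f y ≤ C * Real.exp (C * δ ^ (α : ℝ)) * ‖f‖ * dist x y ^ (α : ℝ) := by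
    intro x y hxy
    set s := C * dist x y ^ (α : ℝ)
    have hd : 0 ≤ dist x y ^ (α : ℝ) := by positivity
    have hs : 0 ≤ s := mul_nonneg hC hd
    have hsδ : s ≤ C * δ ^ (α : ℝ) :=
      mul_le_mul_of_nonneg_left (Real.rpow_le_rpow dist_nonneg hxy.le α.2) hC
    have h1 : Real.exp s - 1 ≤ s * Real.exp (C * δ ^ (α : ℝ)) := by
      have h2 : Real.exp s * (1 - s) ≤ 1 := by
        have := mul_le_mul_of_nonneg_left (Real.add_one_le_exp (-s)) (Real.exp_pos s).le
        rw [← Real.exp_add, add_neg_cancel, Real.exp_zero] at this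
        linarith
      have h3 := mul_le_mul_of_nonneg_left (Real.exp_le_exp.2 hsδ) hs
      linarith
    have hy0 : 0 ≤ f y := hf.1 y
    have h4 : (Real.exp s - 1) * f y ≤ s * Real.exp (C * δ ^ (α : ℝ)) * ‖f‖ :=
      mul_le_mul h1 (f.apply_le_norm y) hy0 (by positivity)
    have h5 := hf.2 x y hxy
    calc f x - f y ≤ (Real.exp s - 1) * f y := by linarith
      _ ≤ _ := h4
      _ = _ := by ring
  have h' := key y x (by rwa [dist_comm])
  rw [dist_comm] at h'
  exact abs_le.2 ⟨by linarith, key x y hxy⟩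

theorem isCompact_sphere_logHolderCone (hα : 0 < α) (hC : 0 ≤ C) (hδ : 0 < δ) :
    IsCompact (logHolderCone A I α δ C ∩ {f | ‖f‖ = 1}) := by
  refine isCompact_of_uniformEquicontinuous
    (isClosed_logHolderCone.inter (isClosed_eq continuous_norm continuous_const)) 1
    (fun f hf => hf.2.le) fun ε hε => ?_
  set B := C * Real.exp (C * δ ^ (α : ℝ))
  obtain ⟨η, hη, hη'⟩ := Metric.tendsto_nhds_nhds.1
    (tendsto_const_mul_rpow_zero hα B) ε hε
  refine ⟨min δ η, lt_min hδ hη, fun f hf x y hxy => ?_⟩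
  have h1 := abs_sub_le_of_mem_logHolderCone hC hf.1 x y (hxy.trans_le (min_le_left _ _))
  rw [show ‖f‖ = 1 from hf.2, mul_one] at h1
  have h2 := @hη' (dist x y) (by
    rw [Real.dist_0_eq_abs, abs_of_nonneg dist_nonneg]
    exact hxy.trans_le (min_le_right _ _))
  rw [Real.dist_0_eq_abs] at h2
  exact h1.trans_lt ((le_abs_self _).trans_lt h2)

variable (hA : Continuous A) (hI : IsClosed I) (hs : IsLocallyConstant (sec A I))
  (ν : Measure M) [IsProbabilityMeasure ν] (φ : C(Subshift A I, ℝ))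

theorem half_dist_rpow (α : ℝ≥0) (d : ℝ) (hd : 0 ≤ d) :
    (d / 2) ^ (α : ℝ) = (1 / 2 : ℝ) ^ (α : ℝ) * d ^ (α : ℝ) := by
  rw [← Real.mul_rpow (by norm_num) hd]
  congr 1
  ring

theorem half_rpow_lt_one (hα : 0 < α) : (1 / 2 : ℝ) ^ (α : ℝ) < 1 :=
  Real.rpow_lt_one (by norm_num) (by norm_num) (by exact_mod_cast hα)

/-- The condition on `C` reflects that the inverse branches of the shift halve distances. -/
theorem transfer_mem_logHolderCone {H : ℝ}
    (hH : ∀ u v, φ u - φ v ≤ H * dist u v ^ (α : ℝ))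
    (hCH : (H + C) * (1 / 2 : ℝ) ^ (α : ℝ) ≤ C) (hδ : 0 < δ)
    (hsec : ∀ x y : Subshift A I, dist x y < δ → sec A I (x 0) = sec A I (y 0))
    {f : C(Subshift A I, ℝ)} (hf : f ∈ logHolderCone A I α δ C) :
    transfer hA hI hs ν φ f ∈ logHolderCone A I α δ C := by
  refine ⟨by simpa using transfer_mono hA hI hs ν φ hf.1, fun x y hxy => ?_⟩
  have hS := hsec x y hxy
  have hG : Continuous fun u => Real.exp (φ u) • f u := by fun_prop
  have hi := integrableOn_comp_prepend hA hI ν hG y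
  rw [transfer_apply, transfer_apply, ruelle_eq_setIntegral hA hI, ruelle_eq_setIntegral hA hI,
    ← integral_const_mul]
  rw [← hS] at hi ⊢
  refine setIntegral_mono_on (integrableOn_comp_prepend hA hI ν hG x) (hi.const_mul _)
    (isClosed_sec hA hI _).measurableSet fun a ha => ?_
  have ha' : a ∈ sec A I (y 0) := hS ▸ ha
  set u := prepend x a
  set v := prepend y a
  have huv : dist u v = dist x y / 2 := dist_prepend ha ha'
  have hd := dist_nonneg (x := x) (y := y)
  have hpow : dist u v ^ (α : ℝ) = (1 / 2 : ℝ) ^ (α : ℝ) * dist x y ^ (α : ℝ) := by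
    rw [huv, half_dist_rpow _ _ hd]
  have hf' := hf.2 u v (by rw [huv]; linarith)
  simp only [smul_eq_mul]
  calc Real.exp (φ u) * f u
      ≤ Real.exp (φ u) * (Real.exp (C * dist u v ^ (α : ℝ)) * f v) :=
        mul_le_mul_of_nonneg_left hf' (Real.exp_pos _).le
    _ = Real.exp (φ u + C * dist u v ^ (α : ℝ)) * f v := by rw [Real.exp_add]; ring
    _ ≤ Real.exp (C * dist x y ^ (α : ℝ) + φ v) * f v := by
        refine mul_le_mul_of_nonneg_right (Real.exp_le_exp.2 ?_) (hf.1 v)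
        have h1 := hH u v
        have h2 := mul_le_mul_of_nonneg_right hCH
          (Real.rpow_nonneg hd (α : ℝ))
        rw [hpow] at h1 ⊢
        linarith
    _ = _ := by rw [Real.exp_add]; ring

variable {ν} in
/-- If `Tf ≥ t f` but `Tf ≠ t f`, then applying a sum of iterates of `T` to `f` yields an element
`g` of the cone with `Tg ≥ (t + ε) g` for some `ε > 0`. -/
theorem exists_improvement [Nonempty (Subshift A I)] (hν : HasFullSupportOnSections A I ν)
    (ht : IsTransitive A I)
    (hT : ∀ f ∈ logHolderCone A I α δ C, transfer hA hI hs ν φ f ∈ logHolderCone A I α δ C)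
    {f : C(Subshift A I, ℝ)} (hf : f ∈ logHolderCone A I α δ C) {t : ℝ}
    (hle : t • f ≤ transfer hA hI hs ν φ f) (hne : transfer hA hI hs ν φ f ≠ t • f) :
    ∃ g ∈ logHolderCone A I α δ C, ‖g‖ = 1 ∧
      ∃ s > t, s • g ≤ transfer hA hI hs ν φ g := by
  set T := transfer hA hI hs ν φ
  obtain ⟨n, hn⟩ := exists_sum_transfer_pow_pos hA hI hs φ hν ht
    (ψ := T f - t • f) (sub_nonneg.2 hle) (sub_ne_zero.2 hne)
  set g : C(Subshift A I, ℝ) := ∑ k ∈ Finset.range n, (T ^ k) f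
  have hTg : ∑ k ∈ Finset.range n, (T ^ k) (T f - t • f) = T g - t • g := by
    simp only [g, map_sub, map_smul, map_sum, Finset.sum_sub_distrib, Finset.smul_sum]
    congr 1
    refine Finset.sum_congr rfl fun k _ => ?_
    rw [← mul_apply_eq_comp, ← mul_apply_eq_comp, ← pow_succ, pow_succ']
  rw [hTg] at hn
  have hgc : g ∈ logHolderCone A I α δ C := by
    refine sum_mem_logHolderCone _ fun k hk => ?_
    clear hk
    induction k with
    | zero => exact hf
    | succ k ih =>
      rw [pow_succ']
      exact hT _ ih
  have hg0 : g ≠ 0 := by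
    intro h0
    obtain ⟨x⟩ := ‹Nonempty (Subshift A I)›
    have := hn x
    rw [h0] at this
    simp at this
  have hgn : 0 < ‖g‖ := norm_pos_iff.2 hg0
  obtain ⟨x₀, -, hx₀⟩ := (isCompact_univ (X := Subshift A I)).exists_isMinOn Set.univ_nonempty
    (T g - t • g).continuous.continuousOn
  set m := (T g - t • g) x₀
  have hm : 0 < m := hn x₀
  refine ⟨‖g‖⁻¹ • g, smul_mem_logHolderCone hgc (by positivity), ?_, t + m / ‖g‖, ?_, ?_⟩
  · rw [norm_smul, norm_inv, norm_norm, inv_mul_cancel₀ hgn.ne']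
  · have : 0 < m / ‖g‖ := by positivity
    linarith
  · rw [smul_comm, map_smul]
    refine smul_le_smul_of_nonneg_left (fun x => ?_) (by positivity)
    change (t + m / ‖g‖) * g x ≤ T g x
    have h1 : m ≤ (T g - t • g) x := hx₀ (Set.mem_univ x)
    have h2 : m / ‖g‖ * g x ≤ m := by
      rw [div_mul_eq_mul_div, div_le_iff₀ hgn]
      exact mul_le_mul_of_nonneg_left (g.apply_le_norm x) hm.le
    simp only [ContinuousMap.sub_apply, ContinuousMap.smul_apply, smul_eq_mul] at h1 ⊢
    linarith

variable {ν} in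
/-- The eigenvalue is the largest `t` for which some non-zero `f` in the cone satisfies
`t f ≤ L_φ f`; by irreducibility equality holds for a maximiser `f`. -/
theorem exists_eigenfunction [Nonempty (Subshift A I)] (hν : HasFullSupportOnSections A I ν)
    (ht : IsTransitive A I) (hα : 0 < α) (hφ : MemHolder α φ) :
    ∃ (lam : ℝ) (f : C(Subshift A I, ℝ)), 0 < lam ∧ (∀ x, 0 < f x) ∧ MemHolder α f ∧
      transfer hA hI hs ν φ f = lam • f := by
  set T := transfer hA hI hs ν φ with hTdef
  obtain ⟨δ, hδ, hsec⟩ := exists_sec_eq hs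
  obtain ⟨H, hH⟩ := hφ
  set θ := (1 / 2 : ℝ) ^ (α : ℝ)
  have hθ : θ < 1 := half_rpow_lt_one hα
  have hθ0 : 0 ≤ θ := by positivity
  -- `C` is the fixed point of `C ↦ (H + C) θ`
  set C : ℝ := H * θ / (1 - θ)
  have h1θ : 0 < 1 - θ := by linarith
  have hC : 0 ≤ C := div_nonneg (by positivity) h1θ.le
  have hCH : (H + C) * θ ≤ C := by
    have : C * (1 - θ) = H * θ := div_mul_cancel₀ _ h1θ.ne'
    linarith
  have hT : ∀ f ∈ logHolderCone A I α δ C, T f ∈ logHolderCone A I α δ C := fun f hf =>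
    transfer_mem_logHolderCone hA hI hs ν φ
      (fun u v => (le_abs_self _).trans (HolderSpace.dist_apply_le hH u v)) hCH hδ hsec hf
  set K := logHolderCone A I α δ C ∩ {f | ‖f‖ = 1}
  have hK : IsCompact K := isCompact_sphere_logHolderCone hα hC hδ
  let S : Set (ℝ × C(Subshift A I, ℝ)) :=
    (Set.Icc 0 ‖T‖ ×ˢ K) ∩ ⋂ x, {p | p.1 * p.2 x ≤ T p.2 x}
  have hev := fun x : Subshift A I => continuous_eval_const (F := C(Subshift A I, ℝ)) x
  have hScompact : IsCompact S := by
    refine (isCompact_Icc.prod hK).inter_right (isClosed_iInter fun x => isClosed_le ?_ ?_)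
    · exact continuous_fst.mul ((hev x).comp continuous_snd)
    · exact (hev x).comp (T.continuous.comp continuous_snd)
  have hSne : S.Nonempty := by
    refine ⟨(0, 1), ⟨⟨⟨le_rfl, norm_nonneg T⟩, ⟨zero_le_one, fun x y _ => ?_⟩, norm_one⟩, ?_⟩⟩
    · simp only [ContinuousMap.one_apply, mul_one]
      exact Real.one_le_exp (by positivity)
    · refine Set.mem_iInter.2 fun x => ?_
      simp only [Set.mem_ofPred_eq, zero_mul]
      exact transfer_pow_nonneg hA hI hs ν φ (ψ := 1) zero_le_one 1 x
  obtain ⟨⟨lam, f⟩, ⟨⟨⟨hlam0, -⟩, hfK⟩, hle⟩, hmax⟩ :=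
    hScompact.exists_isMaxOn hSne continuous_fst.continuousOn
  rw [Set.mem_iInter] at hle
  have heig : T f = lam • f := by
    by_contra hne
    obtain ⟨g, hg, hg1, s, hs', hsg⟩ := exists_improvement hA hI hs φ hν ht hT hfK.1
      (fun x => hle x) hne
    have hs0 : 0 ≤ s := hlam0.trans (le_of_lt hs')
    have hsT : s ≤ ‖T‖ := by
      have h1 : ‖s • g‖ ≤ ‖T g‖ := by
        refine (ContinuousMap.norm_le _ (norm_nonneg _)).2 fun x => ?_
        have h2 : 0 ≤ (s • g) x := mul_nonneg hs0 (hg.1 x)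
        rw [Real.norm_of_nonneg h2]
        exact (hsg x).trans ((T g).apply_le_norm x)
      rw [norm_smul, hg1, mul_one, Real.norm_of_nonneg hs0] at h1
      simpa [hg1] using h1.trans (T.le_opNorm g)
    have hmem : (s, g) ∈ S := ⟨⟨⟨hs0, hsT⟩, hg, hg1⟩, Set.mem_iInter.2 fun x => hsg x⟩
    exact absurd (hmax hmem) (not_le.2 hs')
  have hfne : f ≠ 0 := by
    rintro rfl
    simpa using hfK.2
  have hpow : ∀ k : ℕ, (T ^ k) f = lam ^ k • f := by
    intro k
    induction k with
    | zero => simp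
    | succ k ih =>
      rw [pow_succ', mul_apply_eq_comp, ih, map_smul, heig, smul_smul, ← pow_succ]
  have hfpos : ∀ x, 0 < f x := by
    obtain ⟨n, hn⟩ := exists_sum_transfer_pow_pos hA hI hs φ hν ht hfK.1.1 hfne
    intro x
    refine lt_of_le_of_ne (hfK.1.1 x) fun h0 => ?_
    have := hn x
    simp only [← hTdef, hpow, ContinuousMap.sum_apply, ContinuousMap.smul_apply, ← h0,
      smul_zero, Finset.sum_const_zero, lt_self_iff_false] at this
  refine ⟨lam, f, ?_, hfpos, ?_, heig⟩
  · obtain ⟨x⟩ := ‹Nonempty (Subshift A I)›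
    obtain ⟨a, ha⟩ := ht.sec_nonempty x
    have h1 : 0 < T f x := ruelle_pos hA hI hν φ.continuous f.continuous (fun u => (hfpos u).le)
      (shift_prepend ha) (hfpos _)
    rw [heig] at h1
    exact pos_of_mul_pos_left h1 (hfpos x).le
  · set B := C * Real.exp (C * δ ^ (α : ℝ))
    have hB : 0 ≤ B := by positivity
    have hnorm : ‖f‖ = 1 := hfK.2
    refine ⟨⟨B + 2 * 1 / δ ^ (α : ℝ), by positivity⟩, HolderSpace.memHolder_of_le fun x y => ?_⟩
    refine norm_sub_le_of_local (f := f) α.2 hδ hB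
      (fun x => (f.norm_coe_le_norm x).trans hnorm.le) (fun x y hxy => ?_) x y
    have := abs_sub_le_of_mem_logHolderCone hC hfK.1 x y hxy
    rwa [hnorm, mul_one] at this

end Eigenfunction

/-! ### Equicontinuity of the iterates of a normalized operator -/

section Composition

/-- The composition of a Hölder function with a function whose derivative is bounded on an interval
containing all the values. -/
theorem memHolder_comp_of_hasDerivAt {X : Type*} [PseudoMetricSpace X] {α : ℝ≥0} {φ : X → ℝ}
    (hφ : MemHolder α φ) {F F' : ℝ → ℝ} {a b K : ℝ} (hK : 0 ≤ K) (hr : ∀ x, φ x ∈ Set.Icc a b)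
    (hF : ∀ t ∈ Set.Icc a b, HasDerivAt F (F' t) t) (hF' : ∀ t ∈ Set.Icc a b, |F' t| ≤ K) :
    MemHolder α fun x => F (φ x) := by
  obtain ⟨H, hH⟩ := hφ
  have hlip : LipschitzOnWith ⟨K, hK⟩ F (Set.Icc a b) := by
    refine LipschitzOnWith.of_dist_le_mul fun s hs t ht => ?_
    rw [Real.dist_eq, Real.dist_eq]
    exact (convex_Icc a b).norm_image_sub_le_of_norm_hasDerivWithin_le
      (fun u hu => (hF u hu).hasDerivWithinAt) hF' ht hs
  have h1 := holderOnWith_one.2 hlip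
  have := h1.comp_holderWith (hf := hH) hr
  exact ⟨_, by simpa using! this⟩

end Composition

section Normalized

variable {M : Type*} [MetricSpace M] [CompactSpace M] [MeasurableSpace M] [BorelSpace M]
  {A : M × M → ℝ} {I : Set ℝ} [CompactSpace (Subshift A I)] {α : ℝ≥0}
  (hA : Continuous A) (hI : IsClosed I) (hs : IsLocallyConstant (sec A I))
  (ν : Measure M) [IsProbabilityMeasure ν] (φ : C(Subshift A I, ℝ))

/-- One step of the Lasota–Yorke inequality: an oscillation bound `B` for `ψ` at half the distance
becomes the bound `B + D ‖ψ‖ d(x, y)^α` for `Tψ`. -/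
theorem exists_oscillation_bound (h1 : transfer hA hI hs ν φ 1 = 1) (hφ : MemHolder α φ) :
    ∃ D : ℝ, 0 ≤ D ∧ ∀ (ψ : C(Subshift A I, ℝ)) (x y : Subshift A I) (B : ℝ), 0 ≤ B →
      sec A I (x 0) = sec A I (y 0) →
      (∀ u v, dist u v = dist x y / 2 → |ψ u - ψ v| ≤ B) →
      |transfer hA hI hs ν φ ψ x - transfer hA hI hs ν φ ψ y|
        ≤ B + D * ‖ψ‖ * dist x y ^ (α : ℝ) := by
  obtain ⟨D, hD⟩ := memHolder_comp_of_hasDerivAt hφ (F := Real.exp) (F' := Real.exp)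
    (Real.exp_pos ‖φ‖).le (fun x => ⟨φ.neg_norm_le_apply x, φ.apply_le_norm x⟩)
    (fun t _ => Real.hasDerivAt_exp t)
    (fun t ht => by rw [Real.abs_exp]; exact Real.exp_le_exp.2 ht.2)
  refine ⟨D, D.2, fun ψ x y B hB hxy h => ?_⟩
  set d := dist x y ^ (α : ℝ)
  have hd : 0 ≤ d := by positivity
  set E := D * ‖ψ‖ * d
  have hE : 0 ≤ E := by positivity
  have hbound := abs_ruelle_sub_le hA hI ν φ.continuous ψ.continuous
    (K := fun u => Real.exp (φ u) * B + E) (by fun_prop) hxy (fun u v _ _ huv => ?_)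
  · refine hbound.trans ?_
    rw [integral_add (integrableOn_comp_prepend hA hI ν
      (G := fun u => Real.exp (φ u) * B) (by fun_prop) x) (integrable_const _)]
    refine add_le_add (le_of_eq ?_) (setIntegral_const_le ν _ hE)
    have h2 : transfer hA hI hs ν φ 1 x = 1 := by rw [h1]; rfl
    rw [transfer_apply, ruelle_eq_setIntegral hA hI] at h2
    simp only [ContinuousMap.one_apply, smul_eq_mul, mul_one] at h2
    rw [integral_mul_const, h2, one_mul]
  · have e1 : |Real.exp (φ u) * (ψ u - ψ v)| ≤ Real.exp (φ u) * B := by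
      rw [abs_mul, Real.abs_exp]
      exact mul_le_mul_of_nonneg_left (h u v huv) (Real.exp_pos _).le
    have e2 : |(Real.exp (φ u) - Real.exp (φ v)) * ψ v| ≤ E := by
      rw [abs_mul]
      have e3 : |Real.exp (φ u) - Real.exp (φ v)| ≤ D * d := by
        refine (HolderSpace.dist_apply_le hD u v).trans
          (mul_le_mul_of_nonneg_left (Real.rpow_le_rpow dist_nonneg ?_ α.2) D.2)
        rw [huv]
        linarith [dist_nonneg (x := x) (y := y)]
      calc _ ≤ D * d * ‖ψ‖ :=
            mul_le_mul e3 (ψ.norm_coe_le_norm v) (abs_nonneg _) (by positivity)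
        _ = E := by ring
    calc |Real.exp (φ u) * ψ u - Real.exp (φ v) * ψ v|
        = |Real.exp (φ u) * (ψ u - ψ v) + (Real.exp (φ u) - Real.exp (φ v)) * ψ v| := by
          congr 1
          ring
      _ ≤ _ := (abs_add_le _ _).trans (add_le_add e1 e2)

theorem norm_transfer_le (h1 : transfer hA hI hs ν φ 1 = 1) (ψ : C(Subshift A I, ℝ)) :
    ‖transfer hA hI hs ν φ ψ‖ ≤ ‖ψ‖ := by
  refine (ContinuousMap.norm_le _ (norm_nonneg _)).2 fun x => abs_le.2 ⟨?_, ?_⟩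
  · have h := transfer_mono hA hI hs ν φ (ψ := (-‖ψ‖) • 1) (ψ' := ψ)
      (fun u => by simpa using ψ.neg_norm_le_apply u) x
    rw [map_smul, h1] at h
    simpa using! h
  · have h := transfer_mono hA hI hs ν φ (ψ := ψ) (ψ' := ‖ψ‖ • 1)
      (fun u => by simpa using ψ.apply_le_norm u) x
    rw [map_smul, h1] at h
    simpa using! h

theorem norm_transfer_pow_le (h1 : transfer hA hI hs ν φ 1 = 1) (ψ : C(Subshift A I, ℝ)) (n : ℕ) :
    ‖(transfer hA hI hs ν φ ^ n) ψ‖ ≤ ‖ψ‖ := by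
  induction n with
  | zero => exact le_rfl
  | succ n ih =>
    rw [pow_succ']
    exact (norm_transfer_le hA hI hs ν φ h1 _).trans ih

theorem transfer_pow_one (h1 : transfer hA hI hs ν φ 1 = 1) (n : ℕ) :
    (transfer hA hI hs ν φ ^ n) 1 = 1 := by
  induction n with
  | zero => rfl
  | succ n ih => rw [pow_succ', mul_apply_eq_comp, ih, h1]

/-- The iterated Lasota–Yorke inequality. With `E = 0` it bounds the iterates of a continuous
function, with `B = 0` those of a Hölder function. -/
theorem exists_oscillation_bound_pow (h1 : transfer hA hI hs ν φ 1 = 1) (hα : 0 < α)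
    (hφ : MemHolder α φ) {δ : ℝ}
    (hsec : ∀ x y : Subshift A I, dist x y < δ → sec A I (x 0) = sec A I (y 0)) :
    ∃ D : ℝ, 0 ≤ D ∧ ∀ (ψ : C(Subshift A I, ℝ)) (B E η : ℝ), 0 ≤ B → 0 ≤ E → η ≤ δ →
      (∀ x y, dist x y < η → |ψ x - ψ y| ≤ B + E * dist x y ^ (α : ℝ)) →
      ∀ (n : ℕ) x y, dist x y < η →
        |(transfer hA hI hs ν φ ^ n) ψ x - (transfer hA hI hs ν φ ^ n) ψ y|
          ≤ B + (((1 / 2 : ℝ) ^ (α : ℝ)) ^ n * E + D * ‖ψ‖) * dist x y ^ (α : ℝ) := by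
  obtain ⟨D, hD, hosc⟩ := exists_oscillation_bound hA hI hs ν φ h1 hφ
  set θ := (1 / 2 : ℝ) ^ (α : ℝ)
  have hθ0 : 0 ≤ θ := by positivity
  have hθ : 0 < 1 - θ := sub_pos.2 (half_rpow_lt_one hα)
  have hD' : 0 ≤ D / (1 - θ) := div_nonneg hD hθ.le
  refine ⟨D / (1 - θ), hD', fun ψ B E η hB hE hη hψ n => ?_⟩
  induction n with
  | zero =>
    intro x y hxy
    have h2 : 0 ≤ D / (1 - θ) * ‖ψ‖ * dist x y ^ (α : ℝ) := by positivity
    have := hψ x y hxy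
    simp only [pow_zero, one_mul]
    change |ψ x - ψ y| ≤ _
    linarith
  | succ n ih =>
    intro x y hxy
    have hd := dist_nonneg (x := x) (y := y)
    set T := transfer hA hI hs ν φ
    have hstep := hosc ((T ^ n) ψ) x y
      (B + (θ ^ n * E + D / (1 - θ) * ‖ψ‖) * (θ * dist x y ^ (α : ℝ))) (by positivity)
      (hsec x y (hxy.trans_le hη)) (fun u v huv => by
        have := ih u v (by rw [huv]; linarith)
        rwa [huv, half_dist_rpow _ _ hd] at this)
    rw [pow_succ' T]
    refine hstep.trans ?_
    have hn : D * ‖(T ^ n) ψ‖ * dist x y ^ (α : ℝ) ≤ D * ‖ψ‖ * dist x y ^ (α : ℝ) := by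
      have := norm_transfer_pow_le hA hI hs ν φ h1 ψ n
      gcongr
    -- `D' = D / (1 - θ)` solves `θ D' + D = D'`
    have hDθ : D / (1 - θ) * θ + D = D / (1 - θ) := by
      field_simp
      ring
    calc _ ≤ B + (θ ^ n * E + D / (1 - θ) * ‖ψ‖) * (θ * dist x y ^ (α : ℝ))
          + D * ‖ψ‖ * dist x y ^ (α : ℝ) := by linarith
      _ = B + (θ ^ n * θ * E + (D / (1 - θ) * θ + D) * ‖ψ‖) * dist x y ^ (α : ℝ) := by ring
      _ = _ := by rw [hDθ, ← pow_succ]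

/-- The iterates of a continuous function stay in a compact convex set. -/
theorem exists_compact_convex (h1 : transfer hA hI hs ν φ 1 = 1) (hα : 0 < α)
    (hφ : MemHolder α φ) (ψ : C(Subshift A I, ℝ)) :
    ∃ K : Set C(Subshift A I, ℝ), IsCompact K ∧ Convex ℝ K ∧
      ∀ n : ℕ, (transfer hA hI hs ν φ ^ n) ψ ∈ K := by
  obtain ⟨δ, hδ, hsec⟩ := exists_sec_eq hs
  obtain ⟨D, hD, hosc⟩ := exists_oscillation_bound_pow hA hI hs ν φ h1 hα hφ hsec
  let P : ℝ → ℝ → Prop := fun B η => 0 ≤ B ∧ η ≤ δ ∧ ∀ x y, dist x y < η → |ψ x - ψ y| ≤ B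
  let c : ℝ → Subshift A I → Subshift A I → ℝ := fun B x y =>
    B + D * ‖ψ‖ * dist x y ^ (α : ℝ)
  let K : Set C(Subshift A I, ℝ) := Metric.closedBall 0 ‖ψ‖ ∩ ⋂ B, ⋂ η, ⋂ (_ : P B η),
    ⋂ x, ⋂ y, ⋂ (_ : dist x y < η), {g | |g x - g y| ≤ c B x y}
  have hmem : ∀ g, g ∈ K ↔ ‖g‖ ≤ ‖ψ‖ ∧ ∀ B η, P B η → ∀ x y, dist x y < η →
      |g x - g y| ≤ c B x y := by
    intro g
    simp only [K, Set.mem_inter_iff, mem_closedBall_zero_iff, Set.mem_iInter, Set.mem_ofPred_eq]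
  have hev := fun x : Subshift A I => continuous_eval_const (F := C(Subshift A I, ℝ)) x
  refine ⟨K, isCompact_of_uniformEquicontinuous ?_ ‖ψ‖ (fun g hg => ((hmem g).1 hg).1) ?_, ?_, ?_⟩
  · refine Metric.isClosed_closedBall.inter (isClosed_iInter fun B => isClosed_iInter fun η =>
      isClosed_iInter fun _ => isClosed_iInter fun x => isClosed_iInter fun y =>
      isClosed_iInter fun _ => ?_)
    exact isClosed_le ((hev x).sub (hev y)).abs continuous_const
  · intro ε hε
    obtain ⟨η, hη, hη'⟩ := Metric.uniformContinuous_iff.1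
      (CompactSpace.uniformContinuous_of_continuous ψ.continuous) (ε / 2) (half_pos hε)
    obtain ⟨η₂, hη₂, hη₂'⟩ := Metric.tendsto_nhds_nhds.1
      (tendsto_const_mul_rpow_zero hα (D * ‖ψ‖)) (ε / 2) (half_pos hε)
    refine ⟨min (min η δ) η₂, lt_min (lt_min hη hδ) hη₂, fun g hg x y hxy => ?_⟩
    have h2 := ((hmem g).1 hg).2 (ε / 2) (min η δ) ⟨(half_pos hε).le, min_le_right _ _,
      fun x y h => (hη' (h.trans_le (min_le_left _ _))).le⟩ x y (hxy.trans_le (min_le_left _ _))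
    have h3 := @hη₂' (dist x y) (by
      rw [Real.dist_0_eq_abs, abs_of_nonneg dist_nonneg]
      exact hxy.trans_le (min_le_right _ _))
    rw [Real.dist_0_eq_abs] at h3
    have h4 := (le_abs_self _).trans_lt h3
    simp only [c] at h2
    linarith
  · intro g hg g' hg' a b ha hb hab
    rw [hmem] at hg hg' ⊢
    refine ⟨?_, fun B η hP x y hxy => ?_⟩
    · exact mem_closedBall_zero_iff.1 (convex_closedBall (0 : C(Subshift A I, ℝ)) ‖ψ‖
        (mem_closedBall_zero_iff.2 hg.1) (mem_closedBall_zero_iff.2 hg'.1) ha hb hab)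
    · have e1 := mul_le_mul_of_nonneg_left (hg.2 B η hP x y hxy) ha
      have e2 := mul_le_mul_of_nonneg_left (hg'.2 B η hP x y hxy) hb
      simp only [ContinuousMap.add_apply, ContinuousMap.smul_apply, smul_eq_mul]
      calc |a * g x + b * g' x - (a * g y + b * g' y)|
          = |a * (g x - g y) + b * (g' x - g' y)| := by congr 1; ring
        _ ≤ a * |g x - g y| + b * |g' x - g' y| := by
            refine (abs_add_le _ _).trans (le_of_eq ?_)
            rw [abs_mul, abs_mul, abs_of_nonneg ha, abs_of_nonneg hb]
        _ ≤ a * c B x y + b * c B x y := add_le_add e1 e2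
        _ = c B x y := by rw [← add_mul, hab, one_mul]
  · intro n
    refine (hmem _).2 ⟨norm_transfer_pow_le hA hI hs ν φ h1 ψ n, fun B η hP x y hxy => ?_⟩
    have := hosc ψ B 0 η hP.1 le_rfl hP.2.1 (fun x y h => by simpa using hP.2.2 x y h) n x y hxy
    simpa using this

/-! ### The stationary measure -/

variable {ν} in
/-- Continuous fixed functions of the normalized operator are constant: otherwise irreducibility,
applied to the difference of the function and its minimum, gives a contradiction. -/
theorem eq_const_of_transfer_eq [Nonempty (Subshift A I)] (hν : HasFullSupportOnSections A I ν)
    (ht : IsTransitive A I) (h1 : transfer hA hI hs ν φ 1 = 1) {g : C(Subshift A I, ℝ)}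
    (hg : transfer hA hI hs ν φ g = g) : ∃ c : ℝ, g = c • 1 := by
  obtain ⟨x₀, -, hx₀⟩ := (isCompact_univ (X := Subshift A I)).exists_isMinOn Set.univ_nonempty
    g.continuous.continuousOn
  refine ⟨g x₀, by_contra fun hne => ?_⟩
  set T := transfer hA hI hs ν φ with hT
  set h : C(Subshift A I, ℝ) := g - g x₀ • 1
  have hfix : T h = h := by simp only [h, map_sub, map_smul, hg, h1]
  have hpow : ∀ k : ℕ, (T ^ k) h = h := by
    intro k
    induction k with
    | zero => rfl
    | succ k ih => rw [pow_succ', mul_apply_eq_comp, ih, hfix]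
  obtain ⟨n, hn⟩ := exists_sum_transfer_pow_pos hA hI hs φ hν ht (ψ := h)
    (fun x => by simpa [h] using! hx₀ (Set.mem_univ x)) (sub_ne_zero.2 hne)
  have := hn x₀
  simp only [← hT, hpow] at this
  simp [h, mul_comm] at this

/-- The Cesàro averages of the iterates of an operator. -/
noncomputable def cesaro {E : Type*} [NormedAddCommGroup E] [NormedSpace ℝ E] (T : E →L[ℝ] E)
    (n : ℕ) : E →L[ℝ] E :=
  ((n : ℝ) + 1)⁻¹ • ∑ k ∈ Finset.range (n + 1), T ^ k

theorem cesaro_apply {E : Type*} [NormedAddCommGroup E] [NormedSpace ℝ E] (T : E →L[ℝ] E)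
    (n : ℕ) (v : E) :
    cesaro T n v = ∑ k ∈ Finset.range (n + 1), ((n : ℝ) + 1)⁻¹ • (T ^ k) v := by
  simp [cesaro, Finset.smul_sum]

theorem apply_cesaro_sub {E : Type*} [NormedAddCommGroup E] [NormedSpace ℝ E] (T : E →L[ℝ] E)
    (n : ℕ) (v : E) :
    T (cesaro T n v) - cesaro T n v = ((n : ℝ) + 1)⁻¹ • ((T ^ (n + 1)) v - v) := by
  simp only [cesaro_apply, ← Finset.smul_sum, map_smul, map_sum]
  rw [← smul_sub, ← Finset.sum_sub_distrib]
  congr 1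
  have h : ∀ k, T ((T ^ k) v) = (T ^ (k + 1)) v := fun k => by
    rw [pow_succ', mul_apply_eq_comp]
  simp only [h]
  rw [Finset.sum_range_sub (fun k => (T ^ k) v)]
  simp

/-- If the orbit of `v` stays in a compact convex set, then along a fixed ultrafilter the Cesàro
averages of `v` converge to a fixed vector of the operator. -/
theorem exists_tendsto_cesaro {E : Type*} [NormedAddCommGroup E] [NormedSpace ℝ E] (T : E →L[ℝ] E)
    {K : Set E} (hK : IsCompact K) (hconv : Convex ℝ K) {v : E} (hv : ∀ n : ℕ, (T ^ n) v ∈ K) :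
    ∃ w, T w = w ∧ Tendsto (fun n => cesaro T n v) (hyperfilter ℕ) (𝓝 w) := by
  have hmem : ∀ n, cesaro T n v ∈ K := by
    intro n
    rw [cesaro_apply]
    refine hconv.sum_mem (fun _ _ => by positivity) ?_ fun k _ => hv k
    rw [Finset.sum_const, Finset.card_range, nsmul_eq_mul]
    push_cast
    exact mul_inv_cancel₀ (by positivity)
  obtain ⟨w, -, hw⟩ := hK.ultrafilter_le_nhds ((hyperfilter ℕ).map fun n => cesaro T n v)
    (by
      rw [le_principal_iff]
      exact Filter.mem_map.2 (Filter.univ_mem' hmem))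
  have hw' : Tendsto (fun n => cesaro T n v) (hyperfilter ℕ) (𝓝 w) := hw
  refine ⟨w, ?_, hw'⟩
  obtain ⟨R, hR⟩ := hK.isBounded.exists_norm_le
  have hdiff : Tendsto (fun n => T (cesaro T n v) - cesaro T n v) atTop (𝓝 0) := by
    have hlim : Tendsto (fun n : ℕ => ((n : ℝ) + 1)⁻¹ * (R + R)) atTop (𝓝 0) := by
      have := (tendsto_one_div_add_atTop_nhds_zero_nat (𝕜 := ℝ)).mul_const (R + R)
      simpa using this
    refine squeeze_zero_norm (fun n => ?_) hlim
    rw [apply_cesaro_sub, norm_smul, Real.norm_of_nonneg (by positivity)]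
    exact mul_le_mul_of_nonneg_left ((norm_sub_le _ _).trans
      (add_le_add (hR _ (hv _)) (hR _ (hv 0)))) (by positivity)
  have h2 := ((T.continuous.tendsto w).comp hw').sub hw'
  exact sub_eq_zero.1 (tendsto_nhds_unique h2 (hdiff.mono_left Nat.hyperfilter_le_atTop))

/-- The mean of continuous functions with respect to a finite measure, as a bounded functional. -/
noncomputable def meanCLM {X : Type*} [TopologicalSpace X] [CompactSpace X] [MeasurableSpace X]
    [BorelSpace X] (μ : Measure X) [IsFiniteMeasure μ] : C(X, ℝ) →L[ℝ] ℝ :=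
  LinearMap.mkContinuous
    { toFun := fun ψ => ∫ x, ψ x ∂μ
      map_add' := fun ψ ψ' => integral_add
        (ψ.continuous.integrable_of_hasCompactSupport (HasCompactSupport.of_compactSpace _))
        (ψ'.continuous.integrable_of_hasCompactSupport (HasCompactSupport.of_compactSpace _))
      map_smul' := fun c ψ => integral_smul c _ }
    (μ.real Set.univ) fun ψ => by
      rw [mul_comm]
      exact norm_integral_le_of_norm_le_const (ae_of_all _ ψ.norm_coe_le_norm)

theorem meanCLM_apply {X : Type*} [TopologicalSpace X] [CompactSpace X] [MeasurableSpace X]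
    [BorelSpace X] (μ : Measure X) [IsFiniteMeasure μ] (ψ : C(X, ℝ)) :
    meanCLM μ ψ = ∫ x, ψ x ∂μ := rfl

theorem meanCLM_smul_one {X : Type*} [TopologicalSpace X] [CompactSpace X] [MeasurableSpace X]
    [BorelSpace X] (μ : Measure X) [IsProbabilityMeasure μ] (c : ℝ) :
    meanCLM μ (c • 1) = c := by
  simp [meanCLM_apply]

theorem meanCLM_pow {X : Type*} [TopologicalSpace X] [CompactSpace X] [MeasurableSpace X]
    [BorelSpace X] (μ : Measure X) [IsFiniteMeasure μ] {T : C(X, ℝ) →L[ℝ] C(X, ℝ)}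
    (hμ : ∀ ψ, meanCLM μ (T ψ) = meanCLM μ ψ) (ψ : C(X, ℝ)) (n : ℕ) :
    meanCLM μ ((T ^ n) ψ) = meanCLM μ ψ := by
  induction n with
  | zero => rfl
  | succ n ih => rw [pow_succ', mul_apply_eq_comp, hμ, ih]

theorem meanCLM_cesaro {X : Type*} [TopologicalSpace X] [CompactSpace X] [MeasurableSpace X]
    [BorelSpace X] (μ : Measure X) [IsFiniteMeasure μ] {T : C(X, ℝ) →L[ℝ] C(X, ℝ)}
    (hμ : ∀ ψ, meanCLM μ (T ψ) = meanCLM μ ψ) (ψ : C(X, ℝ)) (n : ℕ) :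
    meanCLM μ (cesaro T n ψ) = meanCLM μ ψ := by
  rw [cesaro_apply, map_sum]
  simp only [map_smul, meanCLM_pow μ hμ, Finset.sum_const, Finset.card_range, nsmul_eq_mul,
    smul_eq_mul]
  push_cast
  rw [← mul_assoc, mul_inv_cancel₀ (by positivity), one_mul]

/-- A positive normalized functional on the continuous functions of a compact metric space is the
integral with respect to a Borel probability measure. -/
theorem exists_measure_of_positive {X : Type*} [MetricSpace X] [CompactSpace X]
    [MeasurableSpace X] [BorelSpace X] (ℓ : C(X, ℝ) →ₗ[ℝ] ℝ) (h1 : ℓ 1 = 1)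
    (h0 : ∀ ψ : C(X, ℝ), 0 ≤ ψ → 0 ≤ ℓ ψ) :
    ∃ μ : Measure X, IsProbabilityMeasure μ ∧ ∀ ψ : C(X, ℝ), ∫ x, ψ x ∂μ = ℓ ψ := by
  let e := CompactlySupportedContinuousMap.continuousMapEquiv (α := X) (β := ℝ)
  let L : CompactlySupportedContinuousMap X ℝ →ₗ[ℝ] ℝ :=
    { toFun := fun f => ℓ (e.symm f)
      map_add' := fun f g => ℓ.map_add (e.symm f) (e.symm g)
      map_smul' := fun c f => ℓ.map_smul c (e.symm f) }
  let Λ : CompactlySupportedContinuousMap X ℝ →ₚ[ℝ] ℝ :=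
    PositiveLinearMap.mk₀ L fun f hf => h0 _ fun x => hf x
  have hint : ∀ ψ : C(X, ℝ), ∫ x, ψ x ∂(RealRMK.rieszMeasure Λ) = ℓ ψ := fun ψ =>
    RealRMK.integral_rieszMeasure Λ (e ψ)
  refine ⟨RealRMK.rieszMeasure Λ, ⟨?_⟩, hint⟩
  have h := hint 1
  simp only [ContinuousMap.one_apply, integral_const, smul_eq_mul, mul_one, h1] at h
  rw [Measure.real, ENNReal.toReal_eq_one_iff] at h
  exact h

variable {ν} in
/-- For every continuous function, the Cesàro averages converge to a constant along the
ultrafilter. -/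
theorem exists_tendsto_cesaro_transfer [Nonempty (Subshift A I)]
    (hν : HasFullSupportOnSections A I ν) (ht : IsTransitive A I)
    (h1 : transfer hA hI hs ν φ 1 = 1) (hα : 0 < α) (hφ : MemHolder α φ)
    (ψ : C(Subshift A I, ℝ)) :
    ∃ c : ℝ, Tendsto (fun n => cesaro (transfer hA hI hs ν φ) n ψ) (hyperfilter ℕ)
      (𝓝 (c • 1)) := by
  obtain ⟨K, hK, hconv, hmem⟩ := exists_compact_convex hA hI hs ν φ h1 hα hφ ψ
  obtain ⟨g, hg, hlim⟩ := exists_tendsto_cesaro _ hK hconv hmem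
  obtain ⟨c, rfl⟩ := eq_const_of_transfer_eq hA hI hs φ hν ht h1 hg
  exact ⟨c, hlim⟩

variable {ν} in
/-- The limits of the Cesàro averages define a positive functional, which is represented by a
stationary measure. -/
theorem exists_stationary_measure [Nonempty (Subshift A I)]
    (hν : HasFullSupportOnSections A I ν) (ht : IsTransitive A I)
    (h1 : transfer hA hI hs ν φ 1 = 1) (hα : 0 < α) (hφ : MemHolder α φ) :
    ∃ μ : Measure (Subshift A I), IsProbabilityMeasure μ ∧ IsDualImage ν φ μ μ := by
  set T := transfer hA hI hs ν φ
  choose ℓ hℓ using exists_tendsto_cesaro_transfer hA hI hs φ hν ht h1 hα hφ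
  have huniq : ∀ (ψ : C(Subshift A I, ℝ)) (c : ℝ),
      Tendsto (fun n => cesaro T n ψ) (hyperfilter ℕ) (𝓝 (c • 1)) → ℓ ψ = c := by
    intro ψ c hc
    obtain ⟨x⟩ := ‹Nonempty (Subshift A I)›
    simpa using congrArg (fun g : C(Subshift A I, ℝ) => g x) (tendsto_nhds_unique (hℓ ψ) hc)
  let L : C(Subshift A I, ℝ) →ₗ[ℝ] ℝ :=
    { toFun := ℓ
      map_add' := fun ψ ψ' => huniq _ _ (by
        simpa only [map_add, add_smul] using (hℓ ψ).add (hℓ ψ'))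
      map_smul' := fun c ψ => huniq _ _ (by
        have h2 := (hℓ ψ).const_smul c
        rw [smul_smul] at h2
        exact h2.congr fun n => ((cesaro T n).map_smul c ψ).symm) }
  have hpow1 := transfer_pow_one hA hI hs ν φ h1
  obtain ⟨μ, hμ, hint⟩ := exists_measure_of_positive L
    (huniq 1 1 (by
      refine tendsto_const_nhds.congr fun n => ?_
      rw [cesaro_apply]
      simp only [T, hpow1, Finset.sum_const, Finset.card_range]
      rw [← Nat.cast_smul_eq_nsmul ℝ, smul_smul]
      push_cast
      rw [mul_inv_cancel₀ (by positivity)]))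
    (fun ψ hψ => by
      obtain ⟨x⟩ := ‹Nonempty (Subshift A I)›
      have hx := ((continuous_eval_const (F := C(Subshift A I, ℝ)) x).tendsto _).comp (hℓ ψ)
      have h2 : 0 ≤ (ℓ ψ • (1 : C(Subshift A I, ℝ))) x := by
        refine ge_of_tendsto' hx fun n => ?_
        rw [Function.comp_apply, cesaro_apply, ContinuousMap.sum_apply]
        exact Finset.sum_nonneg fun k _ => mul_nonneg (by positivity)
          (transfer_pow_nonneg hA hI hs ν φ hψ k x)
      simpa using! h2)
  refine ⟨μ, hμ, fun ψ => ?_⟩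
  have h2 : ℓ (T ψ) = ℓ ψ := by
    refine huniq _ _ ?_
    have h3 := (T.continuous.tendsto _).comp (hℓ ψ)
    rw [map_smul, h1] at h3
    refine h3.congr fun n => ?_
    simp only [Function.comp_apply, cesaro_apply, map_sum, map_smul]
    refine Finset.sum_congr rfl fun k _ => ?_
    rw [← mul_apply_eq_comp, ← mul_apply_eq_comp, ← pow_succ, pow_succ']
  exact (hint ψ).trans (h2.symm.trans (hint (T ψ)).symm)

variable {ν} in
/-- Two stationary measures agree, since both assign to a function the limit of its Cesàro
averages. -/
theorem stationary_measure_unique [Nonempty (Subshift A I)]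
    (hν : HasFullSupportOnSections A I ν) (ht : IsTransitive A I)
    (h1 : transfer hA hI hs ν φ 1 = 1) (hα : 0 < α) (hφ : MemHolder α φ)
    {μ μ' : Measure (Subshift A I)} [IsProbabilityMeasure μ] [IsProbabilityMeasure μ']
    (hμ : IsDualImage ν φ μ μ) (hμ' : IsDualImage ν φ μ' μ') : μ = μ' := by
  set T := transfer hA hI hs ν φ
  refine ext_of_forall_integral_eq_of_IsFiniteMeasure fun ψ => ?_
  obtain ⟨c, hc⟩ := exists_tendsto_cesaro_transfer hA hI hs φ hν ht h1 hα hφ ψ.toContinuousMap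
  have key : ∀ (m : Measure (Subshift A I)) [IsProbabilityMeasure m], IsDualImage ν φ m m →
      meanCLM m ψ.toContinuousMap = c := by
    intro m _ hm
    have h2 := ((meanCLM m).continuous.tendsto _).comp hc
    rw [meanCLM_smul_one] at h2
    refine tendsto_nhds_unique (tendsto_const_nhds.congr fun n => ?_) h2
    exact (meanCLM_cesaro m (T := T) (fun ψ => (hm ψ).symm) _ n).symm
  exact (key μ hμ).trans (key μ' hμ').symm

/-! ### Convergence of the iterates in the mixing case -/

variable {ν} in
/-- All limits `g` of iterates of `ψ ≥ 0` have the same norm `a`, and so do their images `T^m g`.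
If `g` were not constant, then `a - g` would be positive on an open set, and by mixing some
`T^m (a - g)` would be positive everywhere. -/
theorem tendsto_transfer_pow_of_nonneg [Nonempty (Subshift A I)]
    (hν : HasFullSupportOnSections A I ν) (hm : IsMixing A I)
    (h1 : transfer hA hI hs ν φ 1 = 1) (hα : 0 < α) (hφ : MemHolder α φ)
    {μ : Measure (Subshift A I)} [IsProbabilityMeasure μ] (hμ : IsDualImage ν φ μ μ)
    {ψ : C(Subshift A I, ℝ)} (hψ : 0 ≤ ψ) :
    Tendsto (fun n => (transfer hA hI hs ν φ ^ n) ψ) atTop (𝓝 (meanCLM μ ψ • 1)) := by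
  set T := transfer hA hI hs ν φ with hT
  obtain ⟨K, hK, -, hmem⟩ := exists_compact_convex hA hI hs ν φ h1 hα hφ ψ
  have hanti : Antitone fun n : ℕ => ‖(T ^ n) ψ‖ := by
    refine antitone_nat_of_succ_le fun n => ?_
    rw [pow_succ']
    exact norm_transfer_le hA hI hs ν φ h1 _
  obtain ⟨a, ha⟩ : ∃ a, Tendsto (fun n : ℕ => ‖(T ^ n) ψ‖) atTop (𝓝 a) :=
    ⟨_, tendsto_atTop_ciInf hanti ⟨0, by rintro _ ⟨n, rfl⟩; exact norm_nonneg _⟩⟩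
  rw [tendsto_iff_ultrafilter]
  intro 𝒰 h𝒰
  obtain ⟨g, -, hg⟩ := hK.ultrafilter_le_nhds (𝒰.map fun n => (T ^ n) ψ) (by
    rw [le_principal_iff]
    exact Filter.mem_map.2 (Filter.univ_mem' hmem))
  have hg' : Tendsto (fun n => (T ^ n) ψ) 𝒰 (𝓝 g) := hg
  have hnorm : ∀ m : ℕ, ‖(T ^ m) g‖ = a := by
    intro m
    have h2 := (((T ^ m).continuous.tendsto g).comp hg').norm
    have h3 : Tendsto (fun n : ℕ => ‖(T ^ (m + n)) ψ‖) 𝒰 (𝓝 a) :=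
      (ha.comp (tendsto_atTop_mono (fun n => Nat.le_add_left n m) tendsto_id)).mono_left h𝒰
    refine tendsto_nhds_unique h2 (h3.congr fun n => ?_)
    rw [pow_add]
    rfl
  have hg0 : 0 ≤ g := fun x =>
    ge_of_tendsto' (((continuous_eval_const (F := C(Subshift A I, ℝ)) x).tendsto _).comp hg')
      fun n => transfer_pow_nonneg hA hI hs ν φ hψ n x
  have hconst : g = a • 1 := by
    by_contra hne
    set h : C(Subshift A I, ℝ) := a • 1 - g
    have hga : ‖g‖ = a := hnorm 0
    have hh0 : 0 ≤ h := fun x => by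
      have := g.apply_le_norm x
      rw [hga] at this
      simpa [h] using! this
    obtain ⟨u, hu⟩ : ∃ u, 0 < h u := by
      by_contra! hle
      exact hne (sub_eq_zero.1 (ContinuousMap.ext fun u => le_antisymm (hle u) (hh0 u))).symm
    obtain ⟨m, hpre⟩ := hm.exists_preimage_mem hs
      (isOpen_lt continuous_const h.continuous) ⟨u, hu⟩
    have hlt : ‖(T ^ m) g‖ < a := by
      refine (ContinuousMap.norm_lt_iff_of_nonempty _).2 fun x => ?_
      obtain ⟨y, hy, hyx⟩ := hpre x
      have h2 : 0 < (T ^ m) h x := transfer_pow_pos hA hI hs φ hν hh0 hy m x hyx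
      rw [map_sub, map_smul, transfer_pow_one hA hI hs ν φ h1] at h2
      have h3 : 0 ≤ (T ^ m) g x := transfer_pow_nonneg hA hI hs ν φ hg0 m x
      rw [Real.norm_of_nonneg h3]
      simpa using h2
    exact hlt.ne (hnorm m)
  have hmean : meanCLM μ ψ = a := by
    have h2 := ((meanCLM μ).continuous.tendsto g).comp hg'
    rw [hconst, meanCLM_smul_one] at h2
    refine tendsto_nhds_unique (tendsto_const_nhds.congr fun n => ?_) h2
    exact (meanCLM_pow μ (T := T) (fun ψ => (hμ ψ).symm) ψ n).symm
  rw [hmean, ← hconst]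
  exact hg'

variable {ν} in
theorem tendsto_transfer_pow [Nonempty (Subshift A I)]
    (hν : HasFullSupportOnSections A I ν) (hm : IsMixing A I)
    (h1 : transfer hA hI hs ν φ 1 = 1) (hα : 0 < α) (hφ : MemHolder α φ)
    {μ : Measure (Subshift A I)} [IsProbabilityMeasure μ] (hμ : IsDualImage ν φ μ μ)
    (ψ : C(Subshift A I, ℝ)) :
    Tendsto (fun n => (transfer hA hI hs ν φ ^ n) ψ) atTop (𝓝 (meanCLM μ ψ • 1)) := by
  have h := tendsto_transfer_pow_of_nonneg hA hI hs φ hν hm h1 hα hφ hμ (ψ := ψ + ‖ψ‖ • 1)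
    (fun x => by
      have := ψ.neg_norm_le_apply x
      change 0 ≤ ψ x + ‖ψ‖ * 1
      linarith)
  have h2 := h.sub_const (‖ψ‖ • 1)
  simp only [map_add, map_smul, transfer_pow_one hA hI hs ν φ h1, add_sub_cancel_right,
    add_smul] at h2
  have h3 : meanCLM μ (1 : C(Subshift A I, ℝ)) = 1 := by simpa using meanCLM_smul_one μ 1
  rw [h3, smul_eq_mul, mul_one, add_sub_cancel_right] at h2
  exact h2

variable {ν} in
/-- The convergence of the iterates is uniform on compact sets of functions, because the iterates
are contractions. -/
theorem exists_norm_transfer_pow_sub_le [Nonempty (Subshift A I)]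
    (hν : HasFullSupportOnSections A I ν) (hm : IsMixing A I)
    (h1 : transfer hA hI hs ν φ 1 = 1) (hα : 0 < α) (hφ : MemHolder α φ)
    {μ : Measure (Subshift A I)} [IsProbabilityMeasure μ] (hμ : IsDualImage ν φ μ μ)
    {K : Set C(Subshift A I, ℝ)} (hK : IsCompact K) {ε : ℝ} (hε : 0 < ε) :
    ∃ n₀ : ℕ, ∀ n ≥ n₀, ∀ ψ ∈ K,
      ‖(transfer hA hI hs ν φ ^ n) ψ - meanCLM μ ψ • 1‖ ≤ ε := by
  set T := transfer hA hI hs ν φ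
  have hε3 : 0 < ε / 3 := by positivity
  obtain ⟨t, -, htf, hcover⟩ := hK.finite_cover_balls hε3
  have hev : ∀ᶠ n in atTop, ∀ g ∈ t, ‖(T ^ n) g - meanCLM μ g • 1‖ < ε / 3 := by
    refine (htf.eventually_all).2 fun g _ => ?_
    have := tendsto_transfer_pow hA hI hs φ hν hm h1 hα hφ hμ g
    rw [tendsto_iff_norm_sub_tendsto_zero] at this
    exact this.eventually (gt_mem_nhds hε3)
  obtain ⟨n₀, hn₀⟩ := eventually_atTop.1 hev
  refine ⟨n₀, fun n hn ψ hψ => ?_⟩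
  obtain ⟨g, hg, hψg⟩ := Set.mem_iUnion₂.1 (hcover hψ)
  rw [Metric.mem_ball, dist_eq_norm] at hψg
  have e1 : ‖(T ^ n) (ψ - g)‖ ≤ ‖ψ - g‖ := norm_transfer_pow_le hA hI hs ν φ h1 _ n
  have e2 : ‖meanCLM μ (ψ - g) • (1 : C(Subshift A I, ℝ))‖ ≤ ‖ψ - g‖ := by
    rw [norm_smul, norm_one, mul_one]
    have h2 := norm_integral_le_of_norm_le_const (μ := μ)
      (ae_of_all _ (ψ - g).norm_coe_le_norm)
    rwa [probReal_univ, mul_one] at h2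
  have hsplit : (T ^ n) ψ - meanCLM μ ψ • 1 = (T ^ n) (ψ - g)
      + ((T ^ n) g - meanCLM μ g • 1) - meanCLM μ (ψ - g) • 1 := by
    rw [map_sub, map_sub, sub_smul]
    abel
  rw [hsplit]
  refine (norm_sub_le _ _).trans ((add_le_add (norm_add_le _ _) le_rfl).trans ?_)
  linarith [hn₀ n hn g hg]

end Normalized

/-! ### The Banach space of Hölder functions -/

namespace HolderSpace

variable {M : Type*} [MetricSpace M] [CompactSpace M] {A : M × M → ℝ} {I : Set ℝ} {α : ℝ≥0}

theorem norm_le_of_bounds {f : HolderSpace A I α} {a b : ℝ} (ha : 0 ≤ a) (hb : 0 ≤ b)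
    (h1 : ∀ x, ‖f x‖ ≤ a) (h2 : ∀ x y, ‖f x - f y‖ ≤ b * dist x y ^ (α : ℝ)) : ‖f‖ ≤ a + b := by
  rw [norm_def]
  refine add_le_add (Real.iSup_le h1 ha) ?_
  have : nnHolderNorm α f.toFun ≤ ⟨b, hb⟩ := (memHolder_of_le (C := ⟨b, hb⟩) h2).nnholderNorm_le
  exact_mod_cast this

theorem norm_apply_le_norm (f : HolderSpace A I α) (x : Subshift A I) : ‖f x‖ ≤ ‖f‖ :=
  (norm_apply_le f x).trans (le_add_of_nonneg_right (NNReal.coe_nonneg _))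

theorem norm_sub_le_norm_mul (f : HolderSpace A I α) (x y : Subshift A I) :
    ‖f x - f y‖ ≤ ‖f‖ * dist x y ^ (α : ℝ) :=
  (dist_apply_le f.mem.holderWith x y).trans
    (mul_le_mul_of_nonneg_right (le_add_of_nonneg_left (sup_nonneg f)) (by positivity))

instance completeSpace : CompleteSpace (HolderSpace A I α) := by
  refine Metric.complete_of_cauchySeq_tendsto fun u hu => ?_
  rw [Metric.cauchySeq_iff] at hu
  have hpt : ∀ x, ∃ z, Tendsto (fun n => u n x) atTop (𝓝 z) := by
    intro x
    refine cauchySeq_tendsto_of_complete (Metric.cauchySeq_iff.2 fun ε hε => ?_)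
    obtain ⟨N, hN⟩ := hu ε hε
    refine ⟨N, fun m hm n hn => ?_⟩
    rw [dist_eq_norm]
    exact (norm_apply_le_norm (u m - u n) x).trans_lt (by
      rw [← dist_eq_norm]
      exact hN m hm n hn)
  choose g hg using hpt
  have hbound : ∀ ε > 0, ∃ N, ∀ n ≥ N, (∀ x, ‖u n x - g x‖ ≤ ε) ∧
      ∀ x y, ‖(u n x - g x) - (u n y - g y)‖ ≤ ε * dist x y ^ (α : ℝ) := by
    intro ε hε
    obtain ⟨N, hN⟩ := hu ε hε
    have hle : ∀ n ≥ N, ∀ m ≥ N, ‖u n - u m‖ ≤ ε := fun n hn m hm => by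
      rw [← dist_eq_norm]
      exact (hN n hn m hm).le
    refine ⟨N, fun n hn => ⟨fun x => ?_, fun x y => ?_⟩⟩
    · refine le_of_tendsto ((tendsto_const_nhds.sub (hg x)).norm)
        (eventually_atTop.2 ⟨N, fun m hm => ?_⟩)
      exact (norm_apply_le_norm (u n - u m) x).trans (hle n hn m hm)
    · refine le_of_tendsto (((tendsto_const_nhds.sub (hg x)).sub
        (tendsto_const_nhds.sub (hg y))).norm) (eventually_atTop.2 ⟨N, fun m hm => ?_⟩)
      exact (norm_sub_le_norm_mul (u n - u m) x y).trans
        (mul_le_mul_of_nonneg_right (hle n hn m hm) (by positivity))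
  have hmem : MemHolder α g := by
    obtain ⟨N, hN⟩ := hbound 1 one_pos
    have h1 : MemHolder α fun x => u N x - g x :=
      ⟨1, memHolder_of_le fun x y => by simpa using (hN N le_rfl).2 x y⟩
    have h2 := (u N - ⟨_, h1⟩ : HolderSpace A I α).mem
    have h3 : (u N - ⟨_, h1⟩ : HolderSpace A I α).toFun = g := by
      funext x
      simp
    rwa [h3] at h2
  refine ⟨⟨g, hmem⟩, Metric.tendsto_atTop.2 fun ε hε => ?_⟩
  obtain ⟨N, hN⟩ := hbound (ε / 3) (by positivity)
  refine ⟨N, fun n hn => ?_⟩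
  rw [dist_eq_norm]
  have := norm_le_of_bounds (f := u n - ⟨g, hmem⟩) (by positivity) (by positivity)
    (hN n hn).1 (hN n hn).2
  linarith

/-- The constant function `1`. -/
noncomputable def one (A : M × M → ℝ) (I : Set ℝ) (α : ℝ≥0) : HolderSpace A I α :=
  ⟨fun _ => 1, memHolder_const'⟩

instance nontrivial [h : Nonempty (Subshift A I)] : Nontrivial (HolderSpace A I α) := by
  obtain ⟨x⟩ := h
  refine ⟨one A I α, 0, fun h => ?_⟩
  exact one_ne_zero (congrArg (fun f : HolderSpace A I α => f x) h)

theorem norm_mul_sub_mul_le (f g : HolderSpace A I α) (x y : Subshift A I) :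
    ‖f x * g x - f y * g y‖ ≤ 2 * ‖f‖ * ‖g‖ * dist x y ^ (α : ℝ) := by
  have e1 : ‖f x * (g x - g y)‖ ≤ ‖f‖ * (‖g‖ * dist x y ^ (α : ℝ)) := by
    rw [norm_mul]
    exact mul_le_mul (norm_apply_le_norm f x) (norm_sub_le_norm_mul g x y) (norm_nonneg _)
      (norm_nonneg _)
  have e2 : ‖(f x - f y) * g y‖ ≤ ‖f‖ * dist x y ^ (α : ℝ) * ‖g‖ := by
    rw [norm_mul]
    exact mul_le_mul (norm_sub_le_norm_mul f x y) (norm_apply_le_norm g y) (norm_nonneg _)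
      (by positivity)
  calc ‖f x * g x - f y * g y‖ = ‖f x * (g x - g y) + (f x - f y) * g y‖ := by
        congr 1
        ring
    _ ≤ _ := (norm_add_le _ _).trans (add_le_add e1 e2)
    _ = _ := by ring

theorem memHolder_mul (f g : HolderSpace A I α) : MemHolder α fun x => f x * g x :=
  ⟨⟨2 * ‖f‖ * ‖g‖, by positivity⟩, memHolder_of_le (norm_mul_sub_mul_le f g)⟩

/-- Multiplication by a Hölder function, as a bounded operator. -/
noncomputable def mulCLM (f : HolderSpace A I α) : HolderSpace A I α →L[ℂ] HolderSpace A I α :=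
  LinearMap.mkContinuous
    { toFun := fun g => ⟨fun x => f x * g x, memHolder_mul f g⟩
      map_add' := fun g g' => HolderSpace.ext (funext fun x => mul_add _ _ _)
      map_smul' := fun c g => HolderSpace.ext (funext fun x => mul_left_comm _ _ _) }
    (3 * ‖f‖) fun g => by
      have h := norm_le_of_bounds
        (f := (⟨fun x => f x * g x, memHolder_mul f g⟩ : HolderSpace A I α))
        (a := ‖f‖ * ‖g‖) (b := 2 * ‖f‖ * ‖g‖) (by positivity) (by positivity)
        (fun x => by
          change ‖f x * g x‖ ≤ _
          rw [norm_mul]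
          exact mul_le_mul (norm_apply_le_norm f x) (norm_apply_le_norm g x) (norm_nonneg _)
            (norm_nonneg _))
        (norm_mul_sub_mul_le f g)
      refine h.trans (le_of_eq ?_)
      ring

/-- Two pointwise inverse Hölder functions define an invertible multiplication operator. -/
noncomputable def mulUnit (f g : HolderSpace A I α) (h : ∀ x, f x * g x = 1) :
    (HolderSpace A I α →L[ℂ] HolderSpace A I α)ˣ where
  val := mulCLM f
  inv := mulCLM g
  val_inv := ContinuousLinearMap.ext fun ψ => HolderSpace.ext <| funext fun x => by
    change f x * (g x * ψ x) = ψ x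
    rw [← mul_assoc, h, one_mul]
  inv_val := ContinuousLinearMap.ext fun ψ => HolderSpace.ext <| funext fun x => by
    change g x * (f x * ψ x) = ψ x
    rw [← mul_assoc, mul_comm (g x), h, one_mul]

/-- The composition of a Hölder function with a real linear functional on `ℂ`, such as the real or
the imaginary part. -/
noncomputable def realComp (hα : 0 < α) (L : ℂ →L[ℝ] ℝ) (ψ : HolderSpace A I α) :
    C(Subshift A I, ℝ) :=
  ⟨fun x => L (ψ x), L.continuous.comp (ψ.mem.holderWith.continuous hα)⟩

/-- The mean of complex valued Hölder functions, as a bounded functional. -/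
noncomputable def complexMean [CompactSpace (Subshift A I)] (hα : 0 < α)
    (μ : Measure (Subshift A I)) [IsFiniteMeasure μ] : HolderSpace A I α →L[ℂ] ℂ :=
  LinearMap.mkContinuous
    { toFun := fun ψ => ∫ x, ψ x ∂μ
      map_add' := fun ψ ψ' => integral_add
        ((ψ.mem.holderWith.continuous hα).integrable_of_hasCompactSupport
          (HasCompactSupport.of_compactSpace _))
        ((ψ'.mem.holderWith.continuous hα).integrable_of_hasCompactSupport
          (HasCompactSupport.of_compactSpace _))
      map_smul' := fun c ψ => integral_smul c _ }
    (μ.real Set.univ) fun ψ => by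
      rw [mul_comm]
      exact norm_integral_le_of_norm_le_const (ae_of_all _ ψ.norm_apply_le_norm)

theorem apply_complexMean [CompactSpace (Subshift A I)] (hα : 0 < α)
    (μ : Measure (Subshift A I)) [IsFiniteMeasure μ] (L : ℂ →L[ℝ] ℝ) (ψ : HolderSpace A I α) :
    L (complexMean hα μ ψ) = meanCLM μ (realComp hα L ψ) :=
  (L.integral_comp_comm ((ψ.mem.holderWith.continuous hα).integrable_of_hasCompactSupport
    (HasCompactSupport.of_compactSpace _))).symm

/-- The projection of a Hölder function to its mean. -/
noncomputable def meanProj [CompactSpace (Subshift A I)] (hα : 0 < α)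
    (μ : Measure (Subshift A I)) [IsFiniteMeasure μ] :
    HolderSpace A I α →L[ℂ] HolderSpace A I α :=
  (complexMean hα μ).smulRight (one A I α)

theorem meanProj_apply [CompactSpace (Subshift A I)] (hα : 0 < α)
    (μ : Measure (Subshift A I)) [IsFiniteMeasure μ] (ψ : HolderSpace A I α) (x : Subshift A I) :
    meanProj hα μ ψ x = complexMean hα μ ψ := mul_one _

theorem complexMean_one [CompactSpace (Subshift A I)] (hα : 0 < α)
    (μ : Measure (Subshift A I)) [IsProbabilityMeasure μ] :
    complexMean hα μ (one A I α) = 1 := by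
  change ∫ _, (1 : ℂ) ∂μ = 1
  simp

end HolderSpace

/-! ### The spectral gap -/

/-- If `p` is a projection with `ap = pa = p` and some power of `a` is close to `p`, then `1` is an
isolated point of the spectrum of `a`: for `z ≠ 0` one has `z - a = (z - (a - p)) (1 - z⁻¹ p)`. -/
theorem spectrum_subset_of_norm_pow_sub_le {R : Type*} [NormedRing R] [NormedAlgebra ℂ R]
    [CompleteSpace R] [NormOneClass R] {a p : R} (hp : p * p = p) (hap : a * p = p)
    (hpa : p * a = p) {n : ℕ} (hn : n ≠ 0) (h : ‖a ^ n - p‖ ≤ 1 / 2) :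
    ∃ r : ℝ, 0 ≤ r ∧ r < 1 ∧ spectrum ℂ a \ {1} ⊆ Metric.closedBall 0 r := by
  have hpow : ∀ k : ℕ, (a - p) ^ (k + 1) = a ^ (k + 1) - p := by
    intro k
    induction k with
    | zero => simp
    | succ k ih =>
      have hapk : ∀ k : ℕ, a ^ k * p = p := by
        intro k
        induction k with
        | zero => simp
        | succ k ih => rw [pow_succ, mul_assoc, hap, ih]
      rw [pow_succ, ih, sub_mul, mul_sub, mul_sub, hpa, hp, hapk, ← pow_succ]
      abel
  obtain ⟨k, rfl⟩ := Nat.exists_eq_succ_of_ne_zero hn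
  set r : ℝ := (1 / 2 : ℝ) ^ (((k + 1 : ℕ) : ℝ)⁻¹)
  have hr0 : 0 ≤ r := by positivity
  have hrpow : r ^ (k + 1) = 1 / 2 := Real.rpow_inv_natCast_pow (by norm_num) hn
  refine ⟨r, hr0, Real.rpow_lt_one (by norm_num) (by norm_num) (by positivity), ?_⟩
  rintro z ⟨hz, hz1⟩
  rw [mem_closedBall_zero_iff]
  by_contra! hrz
  have hz0 : z ≠ 0 := norm_pos_iff.1 (hr0.trans_lt hrz)
  have hz1' : z - 1 ≠ 0 := sub_ne_zero.2 hz1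
  refine hz ?_
  have hN : IsUnit (algebraMap ℂ R z - (a - p)) := by
    by_contra hmem
    have h1 := spectrum.norm_le_norm_of_mem
      (spectrum.pow_mem_pow (a - p) (k + 1) (spectrum.mem_iff.2 hmem))
    rw [hpow, norm_pow] at h1
    have h2 : r ^ (k + 1) < ‖z‖ ^ (k + 1) := pow_lt_pow_left₀ hrz hr0 hn
    linarith
  have hU : IsUnit (1 - z⁻¹ • p) := by
    have hc : (z - 1)⁻¹ - z⁻¹ - z⁻¹ * (z - 1)⁻¹ = 0 := by
      field_simp
      ring
    have key : ∀ s t : ℂ, (1 - s • p) * (1 + t • p) = 1 + (t - s - s * t) • p := by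
      intro s t
      simp only [sub_mul, mul_add, one_mul, mul_one, smul_mul_smul_comm, hp, sub_smul]
      abel
    have key' : ∀ s t : ℂ, (1 + t • p) * (1 - s • p) = 1 + (t - s - s * t) • p := by
      intro s t
      simp only [add_mul, mul_sub, one_mul, mul_one, smul_mul_smul_comm, hp, sub_smul,
        mul_comm s t]
      abel
    exact ⟨⟨_, 1 + (z - 1)⁻¹ • p, by rw [key, hc, zero_smul, add_zero],
      by rw [key', hc, zero_smul, add_zero]⟩, rfl⟩
  have hfactor : algebraMap ℂ R z - a = (algebraMap ℂ R z - (a - p)) * (1 - z⁻¹ • p) := by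
    have h1 : (a - p) * p = 0 := by rw [sub_mul, hap, hp, sub_self]
    rw [mul_sub, mul_one, mul_smul_comm, sub_mul, h1, sub_zero, ← Algebra.smul_def, smul_smul,
      inv_mul_cancel₀ hz0, one_smul]
    abel
  rw [spectrum.mem_resolventSet_iff, hfactor]
  exact hN.mul hU

section Gap

variable {M : Type*} [MetricSpace M] [CompactSpace M] [MeasurableSpace M] [BorelSpace M]
  {A : M × M → ℝ} {I : Set ℝ} [CompactSpace (Subshift A I)] {α : ℝ≥0}
  (hA : Continuous A) (hI : IsClosed I) (hs : IsLocallyConstant (sec A I))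
  (ν : Measure M) [IsProbabilityMeasure ν] (φ : C(Subshift A I, ℝ))

open HolderSpace

theorem realComp_ruelleHolder_pow (hα : 0 < α) (hφ : MemHolder α φ) (L : ℂ →L[ℝ] ℝ)
    (ψ : HolderSpace A I α) (n : ℕ) :
    realComp hα L ((ruelleHolder hs ν hα hφ ^ n) ψ) =
      (transfer hA hI hs ν φ ^ n) (realComp hα L ψ) := by
  induction n with
  | zero => rfl
  | succ n ih =>
    rw [pow_succ', pow_succ', mul_apply_eq_comp, mul_apply_eq_comp, ← ih]
    ext x
    exact map_ruelle hA hI ν φ.continuous (HolderSpace.mem _ |>.holderWith.continuous hα) L x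

theorem isCompact_holder_ball (hα : 0 < α) :
    IsCompact {g : C(Subshift A I, ℝ) | ‖g‖ ≤ 1 ∧ ∀ x y, |g x - g y| ≤ dist x y ^ (α : ℝ)} := by
  have hev := fun x : Subshift A I => continuous_eval_const (F := C(Subshift A I, ℝ)) x
  refine isCompact_of_uniformEquicontinuous ?_ 1 (fun g hg => hg.1) fun ε hε => ?_
  · have : {g : C(Subshift A I, ℝ) | ‖g‖ ≤ 1 ∧ ∀ x y, |g x - g y| ≤ dist x y ^ (α : ℝ)} =
        {g | ‖g‖ ≤ 1} ∩ ⋂ x, ⋂ y, {g | |g x - g y| ≤ dist x y ^ (α : ℝ)} := by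
      ext g
      simp
    rw [this]
    exact (isClosed_le continuous_norm continuous_const).inter (isClosed_iInter fun x =>
      isClosed_iInter fun y => isClosed_le ((hev x).sub (hev y)).abs continuous_const)
  · obtain ⟨η, hη, hη'⟩ := Metric.tendsto_nhds_nhds.1 (tendsto_const_mul_rpow_zero hα 1) ε hε
    refine ⟨η, hη, fun g hg x y hxy => (hg.2 x y).trans_lt ?_⟩
    have h3 := @hη' (dist x y) (by
      rwa [Real.dist_0_eq_abs, abs_of_nonneg dist_nonneg])
    rw [Real.dist_0_eq_abs, one_mul] at h3
    exact (le_abs_self _).trans_lt h3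

variable {ν} in
/-- Uniform decay on the unit ball of the Hölder space: after `n₁` steps the sup norm is at most `ε`
by compactness of the ball in the space of continuous functions, and then `m` further steps make the
Hölder constant small by the Lasota–Yorke inequality. -/
theorem exists_holder_decay [Nonempty (Subshift A I)] (hν : HasFullSupportOnSections A I ν)
    (hm : IsMixing A I) (h1 : transfer hA hI hs ν φ 1 = 1) (hα : 0 < α) (hφ : MemHolder α φ)
    {μ : Measure (Subshift A I)} [IsProbabilityMeasure μ] (hμ : IsDualImage ν φ μ μ)
    {κ : ℝ} (hκ : 0 < κ) :
    ∃ n : ℕ, n ≠ 0 ∧ ∀ g : C(Subshift A I, ℝ), ‖g‖ ≤ 1 →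
      (∀ x y, |g x - g y| ≤ dist x y ^ (α : ℝ)) →
      (∀ x, |(transfer hA hI hs ν φ ^ n) g x - meanCLM μ g| ≤ κ) ∧
      ∀ x y, |(transfer hA hI hs ν φ ^ n) g x - (transfer hA hI hs ν φ ^ n) g y|
        ≤ κ * dist x y ^ (α : ℝ) := by
  obtain ⟨δ, hδ, hsec⟩ := exists_sec_eq hs
  obtain ⟨D, hD, hosc⟩ := exists_oscillation_bound_pow hA hI hs ν φ h1 hα hφ hsec
  set T := transfer hA hI hs ν φ with hT
  set θ := (1 / 2 : ℝ) ^ (α : ℝ)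
  have hθ0 : 0 ≤ θ := by positivity
  have hθ1 : θ < 1 := half_rpow_lt_one hα
  have hδα : 0 < δ ^ (α : ℝ) := Real.rpow_pos_of_pos hδ _
  -- the sup norm `ε` contributes `D ε` to the local Hölder constant and `2 ε / δ^α` to the global
  -- one; with this `ε` both together stay below `κ / 2`
  set ε : ℝ := κ / (2 * (1 + D + 2 / δ ^ (α : ℝ)))
  have hQ : 0 < 1 + D + 2 / δ ^ (α : ℝ) := by positivity
  have hε : 0 < ε := by positivity
  have hεκ : ε * (1 + D + 2 / δ ^ (α : ℝ)) = κ / 2 := by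
    simp only [ε]
    field_simp
  obtain ⟨n₁, hn₁⟩ := exists_norm_transfer_pow_sub_le hA hI hs φ hν hm h1 hα hφ hμ
    (isCompact_holder_ball (A := A) (I := I) hα) hε
  obtain ⟨m, hm'⟩ := exists_pow_lt_of_lt_one (by positivity : 0 < κ / (2 * (1 + D))) hθ1
  have hθm : θ ^ m * (1 + D) ≤ κ / 2 := by
    rw [lt_div_iff₀ (by positivity)] at hm'
    linarith
  have hm1 : θ ^ (m + 1) * (1 + D) ≤ κ / 2 :=
    (mul_le_mul_of_nonneg_right (pow_le_pow_of_le_one hθ0 hθ1.le (Nat.le_succ m))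
      (by positivity)).trans hθm
  refine ⟨m + 1 + n₁, by omega, fun g hg hgH => ?_⟩
  set h : C(Subshift A I, ℝ) := (T ^ n₁) g - meanCLM μ g • 1
  have hhε : ‖h‖ ≤ ε := hn₁ n₁ le_rfl g ⟨hg, hgH⟩
  have hTh : (T ^ (m + 1 + n₁)) g = (T ^ (m + 1)) h + meanCLM μ g • 1 := by
    simp only [h, map_sub, map_smul, hT, transfer_pow_one hA hI hs ν φ h1]
    rw [sub_add_cancel, pow_add]
    rfl
  have hTn : ‖(T ^ (m + 1)) h‖ ≤ ε := (norm_transfer_pow_le hA hI hs ν φ h1 h _).trans hhε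
  have hεκ' : ε ≤ κ := by
    have h2 : 0 ≤ ε * (D + 2 / δ ^ (α : ℝ)) := by positivity
    linarith
  have hE : ∀ x y, dist x y < δ → |h x - h y| ≤ 0 + (1 + D) * dist x y ^ (α : ℝ) := by
    intro x y hxy
    have h2 := hosc g 0 1 δ le_rfl zero_le_one le_rfl (fun x y _ => by simpa using hgH x y) n₁ x y
      hxy
    have h3 : h x - h y = (T ^ n₁) g x - (T ^ n₁) g y := by simp [h]
    rw [h3]
    refine h2.trans ?_
    have h4 : θ ^ n₁ ≤ 1 := pow_le_one₀ hθ0 hθ1.le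
    have h5 : D * ‖g‖ ≤ D := mul_le_of_le_one_right hD hg
    gcongr
    linarith
  have hlocal : ∀ x y, dist x y < δ →
      ‖(T ^ (m + 1)) h x - (T ^ (m + 1)) h y‖ ≤ (κ / 2 + D * ε) * dist x y ^ (α : ℝ) := by
    intro x y hxy
    have h2 := hosc h 0 (1 + D) δ le_rfl (by positivity) le_rfl hE (m + 1) x y hxy
    rw [zero_add] at h2
    refine h2.trans ?_
    gcongr
  have hglobal := norm_sub_le_of_local (f := (T ^ (m + 1)) h) α.2 hδ (by positivity)
    (fun x => ((T ^ (m + 1)) h).norm_coe_le_norm x |>.trans hTn) hlocal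
  rw [hTh]
  refine ⟨fun x => ?_, fun x y => ?_⟩
  · have h2 := ((T ^ (m + 1)) h).norm_coe_le_norm x
    rw [Real.norm_eq_abs] at h2
    simpa using h2.trans (hTn.trans hεκ')
  · have h2 : κ / 2 + D * ε + 2 * ε / δ ^ (α : ℝ) ≤ κ := by
      have h3 : ε * (1 + D + 2 / δ ^ (α : ℝ)) = ε + D * ε + 2 * ε / δ ^ (α : ℝ) := by ring
      linarith
    have h4 := (hglobal x y).trans (mul_le_mul_of_nonneg_right h2 (by positivity))
    simpa using h4

variable {ν} in
theorem exists_norm_ruelleHolder_pow_sub_le [Nonempty (Subshift A I)]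
    (hν : HasFullSupportOnSections A I ν)
    (hm : IsMixing A I) (h1 : transfer hA hI hs ν φ 1 = 1) (hα : 0 < α) (hφ : MemHolder α φ)
    {μ : Measure (Subshift A I)} [IsProbabilityMeasure μ] (hμ : IsDualImage ν φ μ μ) :
    ∃ n : ℕ, n ≠ 0 ∧ ‖ruelleHolder hs ν hα hφ ^ n - meanProj hα μ‖ ≤ 1 / 2 := by
  obtain ⟨n, hn, hdecay⟩ := exists_holder_decay hA hI hs φ hν hm h1 hα hφ hμ
    (by norm_num : (0 : ℝ) < 1 / 8)
  -- the Hölder norm is bounded by four terms of size `1 / 8`: the sup norms and the Hölder constants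
  -- of the real and the imaginary part
  refine ⟨n, hn, ?_⟩
  set T := ruelleHolder hs ν hα hφ
  have hunit : ∀ ψ : HolderSpace A I α, ‖ψ‖ = 1 → ‖(T ^ n - meanProj hα μ) ψ‖ ≤ 1 / 2 := by
    intro ψ hψ
    have hL : ∀ L : ℂ →L[ℝ] ℝ, (∀ z, |L z| ≤ ‖z‖) →
        (∀ x, |L ((T ^ n - meanProj hα μ) ψ x)| ≤ 1 / 8) ∧
        ∀ x y, |L ((T ^ n - meanProj hα μ) ψ x - (T ^ n - meanProj hα μ) ψ y)|
          ≤ 1 / 8 * dist x y ^ (α : ℝ) := by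
      intro L hL
      obtain ⟨d1, d2⟩ := hdecay (realComp hα L ψ)
        ((ContinuousMap.norm_le _ zero_le_one).2 fun x =>
          (hL _).trans (hψ ▸ norm_apply_le_norm ψ x))
        (fun x y => by
          change |L (ψ x) - L (ψ y)| ≤ _
          rw [← map_sub]
          refine (hL _).trans ((norm_sub_le_norm_mul ψ x y).trans ?_)
          rw [hψ, one_mul])
      have hpt : ∀ x, (T ^ n - meanProj hα μ) ψ x = (T ^ n) ψ x - complexMean hα μ ψ := by
        intro x
        rw [← meanProj_apply hα μ ψ x]
        rfl
      have hre : ∀ x, L ((T ^ n) ψ x) = (transfer hA hI hs ν φ ^ n) (realComp hα L ψ) x := by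
        intro x
        rw [← realComp_ruelleHolder_pow hA hI hs ν φ hα hφ]
        rfl
      refine ⟨fun x => ?_, fun x y => ?_⟩
      · rw [hpt, map_sub, hre, apply_complexMean]
        exact d1 x
      · rw [hpt, hpt, sub_sub_sub_cancel_right, map_sub, hre, hre]
        exact d2 x y
    obtain ⟨r1, r2⟩ := hL Complex.reCLM Complex.abs_re_le_norm
    obtain ⟨i1, i2⟩ := hL Complex.imCLM Complex.abs_im_le_norm
    have := norm_le_of_bounds (f := (T ^ n - meanProj hα μ) ψ) (a := 1 / 8 + 1 / 8)
      (b := 1 / 8 + 1 / 8) (by norm_num) (by norm_num)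
      (fun x => (Complex.norm_le_abs_re_add_abs_im _).trans (add_le_add (r1 x) (i1 x)))
      (fun x y => (Complex.norm_le_abs_re_add_abs_im _).trans
        ((add_le_add (r2 x y) (i2 x y)).trans (le_of_eq (by ring))))
    linarith
  refine ContinuousLinearMap.opNorm_le_bound _ (by norm_num) fun ψ => ?_
  rcases eq_or_ne ψ 0 with rfl | hψ
  · simp
  · have hψn : ‖ψ‖ ≠ 0 := norm_ne_zero_iff.2 hψ
    have h2 := hunit ((‖ψ‖⁻¹ : ℂ) • ψ) (by
      rw [norm_smul, norm_inv, Complex.norm_real, norm_norm, inv_mul_cancel₀ hψn])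
    rw [map_smul, norm_smul, norm_inv, Complex.norm_real, norm_norm,
      inv_mul_le_iff₀ (norm_pos_iff.2 hψ)] at h2
    linarith

variable {ν} in
/-- The spectral gap of the normalized operator of a mixing subshift. -/
theorem exists_spectrum_subset [Nonempty (Subshift A I)] (hν : HasFullSupportOnSections A I ν)
    (hm : IsMixing A I) (h1 : transfer hA hI hs ν φ 1 = 1) (hα : 0 < α) (hφ : MemHolder α φ)
    {μ : Measure (Subshift A I)} [IsProbabilityMeasure μ] (hμ : IsDualImage ν φ μ μ) :
    ∃ r : ℝ, 0 ≤ r ∧ r < 1 ∧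
      spectrum ℂ (ruelleHolder hs ν hα hφ) \ {1} ⊆ Metric.closedBall 0 r := by
  obtain ⟨n, hn, hle⟩ := exists_norm_ruelleHolder_pow_sub_le hA hI hs φ hν hm h1 hα hφ hμ
  set T := ruelleHolder hs ν hα hφ
  have hcomp : ∀ (L : ℂ →L[ℝ] ℝ) (ψ : HolderSpace A I α), realComp hα L (T ψ) =
      transfer hA hI hs ν φ (realComp hα L ψ) := fun L ψ =>
    realComp_ruelleHolder_pow hA hI hs ν φ hα hφ L ψ 1
  have hT1 : T (one A I α) = one A I α := by
    have hL : ∀ (L : ℂ →L[ℝ] ℝ) x, L (T (one A I α) x) = L 1 := by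
      intro L x
      have h2 : realComp hα L (one A I α) = L 1 • 1 := by
        ext x
        simp [realComp, one]
      have h3 := hcomp L (one A I α)
      rw [h2, map_smul, h1] at h3
      simpa [realComp] using congrArg (fun g : C(Subshift A I, ℝ) => g x) h3
    refine HolderSpace.ext (funext fun x => Complex.ext ?_ ?_)
    · exact hL Complex.reCLM x
    · exact hL Complex.imCLM x
  have hmean : ∀ ψ, complexMean hα μ (T ψ) = complexMean hα μ ψ := by
    have hL : ∀ (L : ℂ →L[ℝ] ℝ) ψ, L (complexMean hα μ (T ψ)) = L (complexMean hα μ ψ) := by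
      intro L ψ
      rw [apply_complexMean, apply_complexMean, hcomp]
      exact (hμ _).symm
    exact fun ψ => Complex.ext (hL Complex.reCLM ψ) (hL Complex.imCLM ψ)
  refine spectrum_subset_of_norm_pow_sub_le (p := meanProj hα μ) ?_ ?_ ?_ hn hle
  · ext ψ : 1
    change complexMean hα μ (complexMean hα μ ψ • one A I α) • one A I α = _
    rw [map_smul, complexMean_one, smul_eq_mul, mul_one]
    rfl
  · ext ψ : 1
    change T (complexMean hα μ ψ • one A I α) = _
    rw [map_smul, hT1]
    rfl
  · ext ψ : 1
    change complexMean hα μ (T ψ) • one A I α = _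
    rw [hmean]
    rfl

end Gap

/-! ### Normalization of the potential -/

section Normalization

variable {M : Type*} [MetricSpace M] [CompactSpace M] [MeasurableSpace M] [BorelSpace M]
  {A : M × M → ℝ} {I : Set ℝ} {α : ℝ≥0}

theorem ruelle_normalized {E : Type*} [NormedAddCommGroup E] [NormedSpace ℝ E] (ν : Measure M)
    (φ : Subshift A I → ℝ) {f : Subshift A I → ℝ} (hf : ∀ x, 0 < f x) {lam : ℝ} (hlam : 0 < lam)
    (ψ : Subshift A I → E) (x : Subshift A I) :
    ruelle ν (normalized φ f lam) ψ x = (lam * f x)⁻¹ • ruelle ν φ (fun u => f u • ψ u) x := by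
  rw [ruelle, ruelle, ← integral_smul]
  refine integral_congr_ae (ae_of_all _ fun a => ?_)
  simp only [normalized, shift_cons, Real.exp_sub, Real.exp_add, Real.exp_log (hf _),
    Real.exp_log hlam, smul_smul]
  congr 1
  field_simp

theorem normalized_const_mul (φ : Subshift A I → ℝ) {f : Subshift A I → ℝ} (hf : ∀ x, 0 < f x)
    (lam : ℝ) {c : ℝ} (hc : 0 < c) : normalized φ (fun x => c * f x) lam = normalized φ f lam := by
  funext x
  simp only [normalized, Real.log_mul hc.ne' (hf _).ne']
  ring

theorem memHolder_comp_shift {g : Subshift A I → ℝ} (hg : MemHolder α g) :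
    MemHolder α fun x : Subshift A I => g x.shift := by
  obtain ⟨H, hH⟩ := hg
  have h2 : LipschitzWith 2 (shift : Subshift A I → Subshift A I) :=
    LipschitzWith.of_dist_le_mul fun x y => by simpa using dist_shift_le x y
  have := hH.comp (holderWith_one.2 h2)
  exact ⟨_, by simpa using! this⟩

theorem exists_bounds [CompactSpace (Subshift A I)] [Nonempty (Subshift A I)]
    {f : Subshift A I → ℝ} (hc : Continuous f) (hf : ∀ x, 0 < f x) :
    ∃ a b : ℝ, 0 < a ∧ ∀ x, f x ∈ Set.Icc a b := by
  obtain ⟨x₀, -, h₀⟩ := (isCompact_univ (X := Subshift A I)).exists_isMinOn Set.univ_nonempty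
    hc.continuousOn
  obtain ⟨x₁, -, h₁⟩ := (isCompact_univ (X := Subshift A I)).exists_isMaxOn Set.univ_nonempty
    hc.continuousOn
  exact ⟨f x₀, f x₁, hf x₀, fun x => ⟨h₀ (Set.mem_univ x), h₁ (Set.mem_univ x)⟩⟩

theorem memHolder_log [CompactSpace (Subshift A I)] [Nonempty (Subshift A I)] (hα : 0 < α)
    {f : Subshift A I → ℝ} (hfH : MemHolder α f) (hf : ∀ x, 0 < f x) :
    MemHolder α fun x => Real.log (f x) := by
  obtain ⟨a, b, ha, hab⟩ := exists_bounds (hfH.holderWith.continuous hα) hf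
  refine memHolder_comp_of_hasDerivAt hfH (F := Real.log) (F' := fun t => t⁻¹)
    (inv_nonneg.2 ha.le) hab (fun t ht => Real.hasDerivAt_log (ha.trans_le ht.1).ne')
    fun t ht => ?_
  rw [abs_of_pos (inv_pos.2 (ha.trans_le ht.1))]
  exact inv_anti₀ ha ht.1

theorem memHolder_inv [CompactSpace (Subshift A I)] [Nonempty (Subshift A I)] (hα : 0 < α)
    {f : Subshift A I → ℝ} (hfH : MemHolder α f) (hf : ∀ x, 0 < f x) :
    MemHolder α fun x => (f x)⁻¹ := by
  obtain ⟨a, b, ha, hab⟩ := exists_bounds (hfH.holderWith.continuous hα) hf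
  refine memHolder_comp_of_hasDerivAt hfH (F := fun t => t⁻¹) (F' := fun t => -(t ^ 2)⁻¹)
    (K := (a ^ 2)⁻¹) (by positivity) hab
    (fun t ht => hasDerivAt_inv (ha.trans_le ht.1).ne') fun t ht => ?_
  have := ha.trans_le ht.1
  rw [abs_neg, abs_of_pos (by positivity)]
  exact inv_anti₀ (by positivity) (pow_le_pow_left₀ ha.le ht.1 2)

theorem memHolder_normalized [CompactSpace (Subshift A I)] [Nonempty (Subshift A I)] (hα : 0 < α)
    {φ f : Subshift A I → ℝ} (hφ : MemHolder α φ) (hfH : MemHolder α f) (hf : ∀ x, 0 < f x)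
    (lam : ℝ) : MemHolder α (normalized φ f lam) := by
  have hlog := memHolder_log hα hfH hf
  have h := ((hφ.add hlog).add ((memHolder_comp_shift hlog).smul (c := (-1 : ℝ)))).add
    (memHolder_const' (c := -Real.log lam))
  have heq : normalized φ f lam = φ + (fun x => Real.log (f x)) +
      (-1 : ℝ) • (fun x => Real.log (f x.shift)) + fun _ => -Real.log lam := by
    funext x
    simp only [normalized, Pi.add_apply, Pi.smul_apply, smul_eq_mul]
    ring
  rw [heq]
  exact h

theorem memHolder_ofReal {g : Subshift A I → ℝ} (hg : MemHolder α g) :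
    MemHolder α fun x => (g x : ℂ) := by
  obtain ⟨H, hH⟩ := hg
  refine ⟨H, HolderSpace.memHolder_of_le fun x y => ?_⟩
  rw [← Complex.ofReal_sub, Complex.norm_real]
  exact HolderSpace.dist_apply_le hH x y

variable [CompactSpace (Subshift A I)]
  (hA : Continuous A) (hI : IsClosed I) (hs : IsLocallyConstant (sec A I))
  {ν : Measure M} [IsProbabilityMeasure ν]

/-- Complex valued continuous solutions of `TG = G + c` for a normalized operator: integration
against a stationary measure gives `c = 0`, so that the real and imaginary parts of `G` are fixed
functions. -/
theorem eq_const_of_ruelle_eq_add [Nonempty (Subshift A I)] (φ : C(Subshift A I, ℝ))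
    (hν : HasFullSupportOnSections A I ν) (ht : IsTransitive A I)
    (h1 : transfer hA hI hs ν φ 1 = 1) {μ : Measure (Subshift A I)} [IsProbabilityMeasure μ]
    (hμ : IsDualImage ν φ μ μ) {G : Subshift A I → ℂ} (hG : Continuous G) {c : ℂ}
    (h : ∀ x, ruelle ν φ G x = G x + c) : c = 0 ∧ ∃ d : ℂ, ∀ x, G x = d := by
  have key : ∀ L : ℂ →L[ℝ] ℝ, L c = 0 ∧ ∃ d : ℝ, ∀ x, L (G x) = d := by
    intro L
    let g : C(Subshift A I, ℝ) := ⟨fun x => L (G x), L.continuous.comp hG⟩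
    have hg : transfer hA hI hs ν φ g = g + L c • 1 := by
      ext x
      have h2 := map_ruelle hA hI ν φ.continuous hG L x
      rw [h, map_add] at h2
      simpa [g] using! h2.symm
    have hc : L c = 0 := by
      have h2 : meanCLM μ (transfer hA hI hs ν φ g) = meanCLM μ g := (hμ g).symm
      rw [hg, map_add, meanCLM_smul_one] at h2
      linarith
    rw [hc, zero_smul, add_zero] at hg
    obtain ⟨d, hd⟩ := eq_const_of_transfer_eq hA hI hs φ hν ht h1 hg
    exact ⟨hc, d, fun x => by simpa [g] using congrArg (fun g : C(Subshift A I, ℝ) => g x) hd⟩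
  obtain ⟨hr, a, ha⟩ := key Complex.reCLM
  obtain ⟨hi, b, hb⟩ := key Complex.imCLM
  exact ⟨Complex.ext hr hi, ⟨a, b⟩, fun x => Complex.ext (ha x) (hb x)⟩

/-- A stationary measure of a normalized operator is invariant under the shift, because
`T(ψ ∘ σ) = ψ`. -/
theorem measurePreserving_shift (φ : C(Subshift A I, ℝ)) (h1 : transfer hA hI hs ν φ 1 = 1)
    {μ : Measure (Subshift A I)} [IsProbabilityMeasure μ] (hμ : IsDualImage ν φ μ μ) :
    MeasurePreserving shift μ μ := by
  refine ⟨continuous_shift.measurable, ?_⟩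
  have : IsProbabilityMeasure (μ.map (shift : Subshift A I → Subshift A I)) :=
    Measure.isProbabilityMeasure_map continuous_shift.measurable.aemeasurable
  refine ext_of_forall_integral_eq_of_IsFiniteMeasure fun ψ => ?_
  rw [integral_map continuous_shift.measurable.aemeasurable
    ψ.continuous.aestronglyMeasurable]
  refine (hμ ⟨fun x => ψ x.shift, ψ.continuous.comp continuous_shift⟩).trans
    (integral_congr_ae (ae_of_all _ fun x => ?_))
  have h2 : ruelle ν φ (fun _ => (1 : ℝ)) x = 1 :=
    congrArg (fun g : C(Subshift A I, ℝ) => g x) h1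
  change ruelle ν φ (fun u => ψ u.shift) x = ψ x
  calc ruelle ν φ (fun u => ψ u.shift) x = ruelle ν φ (fun _ => ψ x * 1) x := by
        rw [ruelle, ruelle]
        refine integral_congr_ae (ae_of_all _ fun a => ?_)
        simp only [shift_cons, mul_one]
    _ = ψ x := by rw [ruelle_const_mul ν _ (fun _ => (1 : ℝ)), h2, mul_one]

end Normalization

/-! ### Eigenfunctions and spectrum of the Ruelle operator -/

section Eigen

variable {M : Type*} [MetricSpace M] [CompactSpace M] [MeasurableSpace M] [BorelSpace M]
  {A : M × M → ℝ} {I : Set ℝ} {α : ℝ≥0} [CompactSpace (Subshift A I)]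
  [Nonempty (Subshift A I)]
  (hA : Continuous A) (hI : IsClosed I) (hs : IsLocallyConstant (sec A I))
  {ν : Measure M} [IsProbabilityMeasure ν]

/-- At a maximum of `|g| / f` the eigenvalue equation of `g` and the positivity of the operator give
`|z| ≤ λ`. -/
theorem norm_eigenvalue_le (hA : Continuous A) (hI : IsClosed I) {φ f : Subshift A I → ℝ}
    (hφ : Continuous φ) (hfc : Continuous f)
    (hf : ∀ x, 0 < f x) {lam : ℝ} (heig : ∀ x, ruelle ν φ f x = lam * f x) (z : ℂ)
    (g : C(Subshift A I, ℂ)) (hg : g ≠ 0) (hz : ∀ x, ruelle ν φ g x = z * g x) : ‖z‖ ≤ lam := by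
  have hc : Continuous fun x => ‖g x‖ / f x :=
    g.continuous.norm.div hfc fun x => (hf x).ne'
  obtain ⟨x, -, hx⟩ := (isCompact_univ (X := Subshift A I)).exists_isMaxOn Set.univ_nonempty
    hc.continuousOn
  set m := ‖g x‖ / f x with hm
  have hle : ∀ u, ‖g u‖ ≤ m * f u := fun u => (div_le_iff₀ (hf u)).1 (hx (Set.mem_univ u))
  have hgx : 0 < ‖g x‖ := by
    refine lt_of_le_of_ne (norm_nonneg _) fun h0 => hg (ContinuousMap.ext fun u => ?_)
    have := hle u
    rw [hm, ← h0, zero_div, zero_mul] at this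
    exact norm_le_zero_iff.1 this
  have h1 : ‖ruelle ν φ g x‖ ≤ ruelle ν φ (fun u => ‖g u‖) x := by
    refine (norm_integral_le_integral_norm _).trans (le_of_eq ?_)
    refine integral_congr_ae (ae_of_all _ fun a => ?_)
    simp only [norm_smul, Real.norm_eq_abs, Real.abs_exp, smul_eq_mul]
  have h2 := ruelle_mono hA hI ν hφ g.continuous.norm
    (ψ' := fun u => m * f u) (continuous_const.mul hfc) (x := x) fun u _ => hle u
  rw [ruelle_const_mul, heig] at h2
  have h3 : ‖z‖ * ‖g x‖ ≤ lam * ‖g x‖ := by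
    have h4 : m * (lam * f x) = lam * ‖g x‖ := by
      have := div_mul_cancel₀ ‖g x‖ (hf x).ne'
      rw [hm]
      linear_combination lam * this
    rw [← norm_mul, ← hz, ← h4]
    exact h1.trans h2
  exact le_of_mul_le_mul_right h3 hgx

/-- A solution of `Lg = λ g + c f` becomes, after division by `f`, a solution of
`TG = G + c / λ` for the normalized operator `T`. -/
theorem eq_mul_of_ruelle_eq_add (φ f : Subshift A I → ℝ) {φ' : C(Subshift A I, ℝ)} {lam : ℝ}
    (hφ' : ⇑φ' = normalized φ f lam) (hlam : 0 < lam) (hfc : Continuous f) (hf : ∀ x, 0 < f x)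
    (hν : HasFullSupportOnSections A I ν) (ht : IsTransitive A I)
    (h1 : transfer hA hI hs ν φ' 1 = 1) {μ : Measure (Subshift A I)} [IsProbabilityMeasure μ]
    (hμ : IsDualImage ν φ' μ μ) {g : Subshift A I → ℂ} (hg : Continuous g) {c : ℂ}
    (h : ∀ x, ruelle ν φ g x = lam * g x + c * f x) :
    c = 0 ∧ ∃ d : ℂ, ∀ x, g x = d * f x := by
  have hf0 : ∀ x, (f x : ℂ) ≠ 0 := fun x => Complex.ofReal_ne_zero.2 (hf x).ne'
  have hlam0 : (lam : ℂ) ≠ 0 := Complex.ofReal_ne_zero.2 hlam.ne'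
  have hG : Continuous fun x => g x / (f x : ℂ) :=
    hg.div (Complex.continuous_ofReal.comp hfc) hf0
  obtain ⟨hc, d, hd⟩ := eq_const_of_ruelle_eq_add hA hI hs φ' hν ht h1 hμ hG (c := c / lam)
    fun x => by
      have h2 : (fun u => f u • (g u / (f u : ℂ))) = g := by
        funext u
        rw [Complex.real_smul]
        exact mul_div_cancel₀ _ (hf0 u)
      rw [hφ', ruelle_normalized ν φ hf hlam, h2, h, Complex.real_smul]
      push_cast
      have := hf0 x
      field_simp
  exact ⟨(div_eq_zero_iff.1 hc).resolve_right hlam0, d, fun x => by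
    rw [← hd x, div_mul_cancel₀ _ (hf0 x)]⟩

theorem finrank_maxGenEigenspace_eq_one (hA : Continuous A) (hI : IsClosed I)
    (hs : IsLocallyConstant (sec A I)) {φ f : Subshift A I → ℝ} (hα : 0 < α)
    (hφ : MemHolder α φ) (hfH : MemHolder α f) (hf : ∀ x, 0 < f x) {lam : ℝ}
    (heig : ∀ x, ruelle ν φ f x = lam * f x)
    (hsol : ∀ (g : Subshift A I → ℂ) (c : ℂ), Continuous g →
      (∀ x, ruelle ν φ g x = lam * g x + c * f x) → c = 0 ∧ ∃ d : ℂ, ∀ x, g x = d * f x) :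
    Module.finrank ℂ (Module.End.maxGenEigenspace
      (ruelleHolder hs ν hα hφ).toLinearMap (lam : ℂ)) = 1 := by
  set T := ruelleHolder hs ν hα hφ
  let F : HolderSpace A I α := ⟨fun x => f x, memHolder_ofReal hfH⟩
  have hF : F ≠ 0 := by
    obtain ⟨x⟩ := ‹Nonempty (Subshift A I)›
    intro h0
    have : (f x : ℂ) = 0 := congrArg (fun g : HolderSpace A I α => g x) h0
    exact (hf x).ne' (Complex.ofReal_eq_zero.1 this)
  have hTF : T F = (lam : ℂ) • F := by
    refine HolderSpace.ext (funext fun x => ?_)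
    have h2 := map_ruelle hA hI ν (hφ.holderWith.continuous hα) (hfH.holderWith.continuous hα)
      Complex.ofRealCLM x
    rw [heig] at h2
    simpa using! h2.symm
  have hspan : Module.End.maxGenEigenspace T.toLinearMap (lam : ℂ) = ℂ ∙ F := by
    refine le_antisymm (fun g hg => ?_) ?_
    · obtain ⟨k, hk⟩ := (Module.End.mem_maxGenEigenspace _ _ _).1 hg
      clear hg
      induction k generalizing g with
      | zero =>
        have : g = 0 := hk
        rw [this]
        exact Submodule.zero_mem _
      | succ k ih =>
        rw [pow_succ] at hk
        obtain ⟨c, hc⟩ := Submodule.mem_span_singleton.1 (ih _ hk)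
        have hTg : T g = (lam : ℂ) • g + c • F := by
          rw [hc]
          change T g = (lam : ℂ) • g + (T g - (lam : ℂ) • g)
          abel
        obtain ⟨-, d, hd⟩ := hsol g c (g.mem.holderWith.continuous hα) fun x =>
          congrArg (fun g : HolderSpace A I α => g x) hTg
        exact Submodule.mem_span_singleton.2 ⟨d, HolderSpace.ext (funext fun x => (hd x).symm)⟩
    · rw [Submodule.span_singleton_le_iff_mem, Module.End.mem_maxGenEigenspace]
      refine ⟨1, ?_⟩
      rw [pow_one]
      change T F - (lam : ℂ) • F = 0
      rw [hTF, sub_self]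
  rw [hspan]
  exact finrank_span_singleton hF

open scoped Pointwise in
/-- The Ruelle operator is conjugate, by multiplication with the eigenfunction, to `λ` times the
normalized operator. -/
theorem spectrum_ruelleHolder_subset {φ f : Subshift A I → ℝ} (hα : 0 < α)
    (hφ : MemHolder α φ) (hfH : MemHolder α f) (hf : ∀ x, 0 < f x) {lam : ℝ} (hlam : 0 < lam)
    (hφ' : MemHolder α (normalized φ f lam)) {r : ℝ}
    (hr : spectrum ℂ (ruelleHolder hs ν hα hφ') \ {1} ⊆ Metric.closedBall 0 r) :
    spectrum ℂ (ruelleHolder hs ν hα hφ) \ {(lam : ℂ)} ⊆ Metric.closedBall 0 (lam * r) := by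
  set T := ruelleHolder hs ν hα hφ
  set T' := ruelleHolder hs ν hα hφ'
  have hf0 : ∀ x, (f x : ℂ) ≠ 0 := fun x => Complex.ofReal_ne_zero.2 (hf x).ne'
  have hlam0 : (lam : ℂ) ≠ 0 := Complex.ofReal_ne_zero.2 hlam.ne'
  let U := HolderSpace.mulUnit (α := α) ⟨fun x => f x, memHolder_ofReal hfH⟩
    ⟨fun x => ((f x)⁻¹ : ℝ), memHolder_ofReal (memHolder_inv hα hfH hf)⟩ (fun x => by
      change (f x : ℂ) * ((f x)⁻¹ : ℝ) = 1
      rw [Complex.ofReal_inv, mul_inv_cancel₀ (hf0 x)])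
  have hconj : T = (lam : ℂ) • (U * T' * U⁻¹ : HolderSpace A I α →L[ℂ] HolderSpace A I α) := by
    ext ψ : 1
    refine HolderSpace.ext (funext fun x => ?_)
    change ruelle ν φ ψ.toFun x = lam * (f x * ruelle ν (normalized φ f lam)
      (fun u => (((f u)⁻¹ : ℝ) : ℂ) * ψ u) x)
    have h2 : (fun u => f u • ((((f u)⁻¹ : ℝ) : ℂ) * ψ u)) = ψ.toFun := by
      funext u
      rw [Complex.real_smul, Complex.ofReal_inv, mul_inv_cancel_left₀ (hf0 u)]
    rw [ruelle_normalized ν φ hf hlam, h2, Complex.real_smul]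
    push_cast
    have := hf0 x
    field_simp
  rintro z ⟨hz, hz1⟩
  have hspec : spectrum ℂ T = Units.mk0 (lam : ℂ) hlam0 • spectrum ℂ T' := by
    rw [hconj, ← spectrum.units_conjugate (a := T') (u := U)]
    exact spectrum.unit_smul_eq_smul _ (Units.mk0 (lam : ℂ) hlam0)
  rw [hspec] at hz
  obtain ⟨w, hw, rfl⟩ := hz
  change (lam : ℂ) * w ∉ ({(lam : ℂ)} : Set ℂ) at hz1
  change (lam : ℂ) * w ∈ _
  have hw1 : w ≠ 1 := by
    rintro rfl
    exact hz1 (mul_one _)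
  have := mem_closedBall_zero_iff.1 (hr ⟨hw, hw1⟩)
  rw [mem_closedBall_zero_iff, norm_mul, Complex.norm_real, Real.norm_of_nonneg hlam.le]
  exact mul_le_mul_of_nonneg_left this hlam.le

theorem tendstoUniformly_iterate_ruelle (hν : HasFullSupportOnSections A I ν)
    (hm : IsMixing A I) (φ : C(Subshift A I, ℝ)) (h1 : transfer hA hI hs ν φ 1 = 1) (hα : 0 < α)
    (hφ : MemHolder α φ) {μ : Measure (Subshift A I)} [IsProbabilityMeasure μ]
    (hμ : IsDualImage ν φ μ μ) {ψ : Subshift A I → ℝ} (hψ : Continuous ψ) :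
    TendstoUniformly (fun n : ℕ => (ruelle ν φ)^[n] ψ) (fun _ => ∫ x, ψ x ∂μ) atTop := by
  have h := ContinuousMap.tendsto_iff_tendstoUniformly.1
    (tendsto_transfer_pow hA hI hs φ hν hm h1 hα hφ hμ ⟨ψ, hψ⟩)
  simp only [coe_transfer_pow] at h
  have heq : (fun _ => ∫ x, ψ x ∂μ) = ⇑(meanCLM μ ⟨ψ, hψ⟩ • (1 : C(Subshift A I, ℝ))) :=
    funext fun _ => (mul_one (∫ x, ψ x ∂μ)).symm
  rw [heq]
  exact h

/-- The eigenmeasure `ρ = f⁻¹ μ` of the dual operator. -/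
theorem isDualImage_withDensity_inv (φ f : Subshift A I → ℝ) {lam : ℝ} (hlam : 0 < lam)
    (hfc : Continuous f) (hf : ∀ x, 0 < f x) {μ : Measure (Subshift A I)}
    (hμ : IsDualImage ν (normalized φ f lam) μ μ) :
    IsDualImage ν φ (μ.withDensity fun x => ENNReal.ofReal (f x)⁻¹)
      (ENNReal.ofReal lam • μ.withDensity fun x => ENNReal.ofReal (f x)⁻¹) := by
  intro ψ
  have hm : Measurable fun x => ((f x)⁻¹).toNNReal :=
    (hfc.inv₀ fun x => (hf x).ne').measurable.real_toNNReal
  have hint : ∀ h : Subshift A I → ℝ,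
      ∫ x, h x ∂(μ.withDensity fun x => ENNReal.ofReal (f x)⁻¹) = ∫ x, (f x)⁻¹ * h x ∂μ := by
    intro h
    refine (integral_withDensity_eq_integral_smul hm h).trans
      (integral_congr_ae (ae_of_all _ fun x => ?_))
    simp only [NNReal.smul_def, smul_eq_mul, Real.coe_toNNReal _ (inv_pos.2 (hf x)).le]
  rw [integral_smul_measure, ENNReal.toReal_ofReal hlam.le, hint, hint, smul_eq_mul]
  have h2 := hμ ⟨fun x => (f x)⁻¹ * ψ x, (hfc.inv₀ fun x => (hf x).ne').mul ψ.continuous⟩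
  simp only [ContinuousMap.coe_mk] at h2
  rw [h2, ← integral_const_mul]
  refine integral_congr_ae (ae_of_all _ fun x => ?_)
  have h3 : (fun u => f u * ((f u)⁻¹ * ψ u)) = ψ := by
    funext u
    rw [mul_inv_cancel_left₀ (hf u).ne']
  simp only [ruelle_normalized ν φ hf hlam, smul_eq_mul, h3]
  rw [mul_inv, ← mul_assoc, mul_inv_cancel_left₀ hlam.ne']

/-- The normalized operator of the potential built from an eigenfunction, and its stationary
measure. The eigenfunction is scaled so that `f⁻¹ μ` is a probability measure. -/
theorem exists_normalization (hν : HasFullSupportOnSections A I ν) (ht : IsTransitive A I)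
    (hα : 0 < α) {φ : Subshift A I → ℝ} (hφ : MemHolder α φ) :
    ∃ (lam : ℝ) (f : Subshift A I → ℝ) (φ' : C(Subshift A I, ℝ)) (μ : Measure (Subshift A I)),
      0 < lam ∧ (∀ x, 0 < f x) ∧ MemHolder α f ∧ (∀ x, ruelle ν φ f x = lam * f x) ∧
      ⇑φ' = normalized φ f lam ∧ MemHolder α φ' ∧ transfer hA hI hs ν φ' 1 = 1 ∧
      IsProbabilityMeasure μ ∧ IsDualImage ν φ' μ μ ∧
      IsProbabilityMeasure (μ.withDensity fun x => ENNReal.ofReal (f x)⁻¹) := by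
  obtain ⟨lam, f, hlam, hf, hfH, heig⟩ := exists_eigenfunction hA hI hs
    ⟨φ, hφ.holderWith.continuous hα⟩ hν ht hα hφ
  have heig' : ∀ x, ruelle ν φ f x = lam * f x := fun x =>
    congrArg (fun g : C(Subshift A I, ℝ) => g x) heig
  have hnH := memHolder_normalized hα hφ hfH hf lam
  let φ' : C(Subshift A I, ℝ) := ⟨normalized φ f lam, hnH.holderWith.continuous hα⟩
  have h1 : transfer hA hI hs ν φ' 1 = 1 := by
    ext x
    refine (ruelle_normalized ν φ hf hlam _ x).trans ?_
    simp only [ContinuousMap.one_apply, smul_eq_mul, mul_one]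
    rw [heig', inv_mul_cancel₀ (mul_pos hlam (hf x)).ne']
  obtain ⟨μ, hμp, hμ⟩ := exists_stationary_measure hA hI hs φ' hν ht h1 hα hnH
  have hci : Continuous fun x => (f x)⁻¹ := f.continuous.inv₀ fun x => (hf x).ne'
  have hi : Integrable (fun x => (f x)⁻¹) μ :=
    hci.integrable_of_hasCompactSupport (HasCompactSupport.of_compactSpace _)
  set c := ∫ x, (f x)⁻¹ ∂μ
  have hc : 0 < c := by
    refine (integral_pos_iff_support_of_nonneg (fun x => (inv_pos.2 (hf x)).le) hi).2 ?_
    rw [Function.support_eq_univ fun x => (inv_pos.2 (hf x)).ne', measure_univ]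
    exact one_pos
  have hcf : ∀ x, 0 < c * f x := fun x => mul_pos hc (hf x)
  have hnorm := normalized_const_mul φ hf lam hc
  refine ⟨lam, fun x => c * f x, φ', μ, hlam, hcf, hfH.smul (c := c), fun x => ?_, hnorm.symm, hnH,
    h1, hμp, hμ, ⟨?_⟩⟩
  · rw [ruelle_const_mul, heig']
    ring
  · have hi' : Integrable (fun x => (c * f x)⁻¹) μ := by
      simp only [mul_inv]
      exact hi.const_mul _
    rw [withDensity_apply _ MeasurableSet.univ, Measure.restrict_univ,
      ← ofReal_integral_eq_lintegral_ofReal hi' (ae_of_all _ fun x => (inv_pos.2 (hcf x)).le)]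
    simp only [mul_inv]
    rw [integral_const_mul, inv_mul_cancel₀ hc.ne', ENNReal.ofReal_one]

end Eigen

end RPF

theorem theorem1 {M : Type*} [MetricSpace M] [CompactSpace M] [MeasurableSpace M] [BorelSpace M]
    (A : M × M → ℝ) (hA : Continuous A) (I : Set ℝ) (hI : IsCompact I)
    (hne : Nonempty (RPF.Subshift A I))
    (hs : IsLocallyConstant (RPF.sec A I))
    (ht : RPF.IsTransitive A I) (hd : RPF.HasSpectralDecomposition A I)
    (ν : Measure M) [IsProbabilityMeasure ν] [ν.IsOpenPosMeasure]
    (hν : ∀ (x : RPF.Subshift A I) (U : Set M), IsOpen U →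
      (U ∩ RPF.sec A I (x 0)).Nonempty → 0 < ν (U ∩ RPF.sec A I (x 0)))
    (α : ℝ≥0) (hα : 0 < α) (hα1 : α ≤ 1)
    (φ : RPF.Subshift A I → ℝ) (hφ : MemHolder α φ) :
    ∃ (lam : ℝ) (f : RPF.Subshift A I → ℝ) (ρ μ : Measure (RPF.Subshift A I)),
      -- (1) the eigenvalue and its positive Hölder eigenfunction
      (0 < lam ∧ (∀ x, 0 < f x) ∧ MemHolder α f ∧ (∀ x, RPF.ruelle ν φ f x = lam * f x) ∧
        -- simplicity, for continuous eigenfunctions and with algebraic multiplicity on `H_α`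
        (∀ g : C(RPF.Subshift A I, ℂ), (∀ x, RPF.ruelle ν φ g x = lam * g x) →
          ∃ c : ℂ, ∀ x, g x = c * f x) ∧
        Module.finrank ℂ (Module.End.maxGenEigenspace
          (RPF.ruelleHolder hs ν hα hφ).toLinearMap (lam : ℂ)) = 1 ∧
        -- maximality
        (∀ (z : ℂ) (g : C(RPF.Subshift A I, ℂ)), g ≠ 0 →
          (∀ x, RPF.ruelle ν φ g x = z * g x) → ‖z‖ ≤ lam)) ∧
      -- (2) the eigenprobability
      (IsProbabilityMeasure ρ ∧ RPF.IsDualImage ν φ ρ (ENNReal.ofReal lam • ρ)) ∧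
      -- (3) the unique fixed point for the normalized potential
      (μ = ρ.withDensity (fun x => ENNReal.ofReal (f x)) ∧
        IsProbabilityMeasure μ ∧
        RPF.IsDualImage ν (RPF.normalized φ f lam) μ μ ∧
        (∀ μ' : Measure (RPF.Subshift A I), IsProbabilityMeasure μ' →
          RPF.IsDualImage ν (RPF.normalized φ f lam) μ' μ' → μ' = μ) ∧
        MeasurePreserving RPF.Subshift.shift μ μ) ∧
      -- (4) convergence and spectral gap in the mixing case
      (RPF.IsMixing A I →
        (∀ ψ : RPF.Subshift A I → ℝ, MemHolder α ψ →
          TendstoUniformly (fun n : ℕ => (RPF.ruelle ν (RPF.normalized φ f lam))^[n] ψ)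
            (fun _ => ∫ x, ψ x ∂μ) atTop) ∧
        ∃ r : ℝ, 0 ≤ r ∧ r < lam ∧
          spectrum ℂ (RPF.ruelleHolder hs ν hα hφ) \ {(lam : ℂ)} ⊆ Metric.closedBall 0 r) := by
  have hIc : IsClosed I := hI.isClosed
  have := RPF.compactSpace_subshift hA hIc
  obtain ⟨lam, f, φ', μ, hlam, hf, hfH, heig, hφ', hφ'H, h1, hμp, hμ, hρp⟩ :=
    RPF.exists_normalization hA hIc hs hν ht hα hφ
  have hφc := hφ.holderWith.continuous hα
  have hfc := hfH.holderWith.continuous hα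
  have hμ' := hμ
  rw [hφ'] at hμ'
  have hsol := fun (g : RPF.Subshift A I → ℂ) (c : ℂ) (hg : Continuous g) =>
    RPF.eq_mul_of_ruelle_eq_add hA hIc hs φ f hφ' hlam hfc hf hν ht h1 hμ hg (c := c)
  refine ⟨lam, f, μ.withDensity fun x => ENNReal.ofReal (f x)⁻¹, μ,
    ⟨hlam, hf, hfH, heig, fun g hg => ?_, ?_, ?_⟩, ⟨hρp, ?_⟩,
    ⟨?_, hμp, hμ', fun m hm hmd => ?_, ?_⟩, fun hmix => ⟨fun ψ hψ => ?_, ?_⟩⟩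
  · exact (hsol g 0 g.continuous fun x => by rw [hg, zero_mul, add_zero]).2
  · exact RPF.finrank_maxGenEigenspace_eq_one hA hIc hs hα hφ hfH hf heig hsol
  · exact RPF.norm_eigenvalue_le hA hIc hφc hfc hf heig
  · exact RPF.isDualImage_withDensity_inv φ f hlam hfc hf hμ'
  · have hinv : Measurable fun x => ENNReal.ofReal (f x)⁻¹ :=
      (hfc.inv₀ fun x => (hf x).ne').measurable.ennreal_ofReal
    rw [← withDensity_mul _ hinv hfc.measurable.ennreal_ofReal]
    conv_lhs => rw [← withDensity_one (μ := μ)]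
    congr 1
    funext x
    rw [Pi.one_apply, Pi.mul_apply, ← ENNReal.ofReal_mul (inv_pos.2 (hf x)).le,
      inv_mul_cancel₀ (hf x).ne', ENNReal.ofReal_one]
  · rw [← hφ'] at hmd
    exact RPF.stationary_measure_unique hA hIc hs φ' hν ht h1 hα hφ'H hmd hμ
  · exact RPF.measurePreserving_shift hA hIc hs φ' h1 hμ
  · rw [← hφ']
    exact RPF.tendstoUniformly_iterate_ruelle hA hIc hs hν hmix φ' h1 hα hφ'H hμ
      (hψ.holderWith.continuous hα)
  · obtain ⟨r, hr0, hr1, hr⟩ := RPF.exists_spectrum_subset hA hIc hs φ' hν hmix h1 hα hφ'H hμ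
    have hnH : MemHolder α (RPF.normalized φ f lam) := hφ' ▸ hφ'H
    have hr' : spectrum ℂ (RPF.ruelleHolder hs ν hα hnH) \ {1} ⊆ Metric.closedBall 0 r := by
      convert hr using 4
      exact hφ'.symm
    exact ⟨lam * r, mul_nonneg hlam.le hr0, mul_lt_of_lt_one_right hlam hr1,
      RPF.spectrum_ruelleHolder_subset hs hα hφ hfH hf hlam hnH hr'⟩
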